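/- An instance of the reallocation problem consists of a set $P$ of $m\ge 1$ products and a set $W$ of $n$ warehouses; each product $p$ has a size $\mathit{size}(p)\ge 0$, a source $s(p)\in W$, a sink $t(p)\in W$ with $s(p)\ne t(p)$, and an integer transit time $\tau(p)\ge 1$; each warehouse $w$ has a capacity $c(w)$, a carry-out capacity $d^+(w)$ and a carry-in capacity $d^-(w)$ in $[0,\infty]$. Put $P^+(w)=\{p: s(p)=w\}$ and $P^-(w)=\{p: t(p)=w\}$. It is assumed that $\mathit{size}(p)\le d^+(s(p))$, $\mathit{size}(p)\le d^-(t(p))$ for all $p$, and that the total size of $P^+(w)$ and that of $P^-(w)$ are each at most $c(w)$ for all $w$. A schedule $\varphi:P\to\mathbb Z_{\ge 0}$ is feasible if for every time $\theta\in\mathbb Z_{\ge0}$ and every $w$: the products of $P^+(w)$ with $\varphi(p)=\theta$ have total size at most $d^+(w)$; those of $P^-(w)$ with $\varphi(p)+\tau(p)=\theta$ have total size at most $d^-(w)$; and those of $P^+(w)$ with $\varphi(p)\ge\theta$ together with those of $P^-(w)$ with $\varphi(p)+\tau(p)\le\theta$ have total size at most $c(w)$. Its completion time is $\max_p(\varphi(p)+\tau(p))$.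 A schedule is 2-approximate if it is feasible and its completion time is at most twice that of every feasible schedule. Algorithm Uniform, for instances in which all products have the same size $k>0$: let $\rho=\max\bigl\{1,\max_{w}\lceil |P^+(w)|/\lfloor d^+(w)/k\rfloor\rceil,\max_w\lceil |P^-(w)|/\lfloor d^-(w)/k\rfloor\rceil\bigr\}$ (a quotient with infinite capacity, or with numerator $0$, is $0$). Divide each $w$ into copies $w_1,w_2,\dots$; number $P^+(w)$ and let its $j$-th product leave from $w_{\lceil j/\rho\rceil}$; number $P^-(w)$ and let its $j$-th product arrive at $w_{\lceil j/\rho\rceil}$. As long as some copy has different numbers of leaving and arriving products, add an extra product from a copy with fewer leaving than arriving products to one with more leaving than arriving products. Partition the resulting products into $\rho$ (possibly empty) classes $P_1,\dots,P_\rho$, each forming vertex-disjoint simple directed cycles on the copies, and output $\varphi(p)=i-1$ for $p\in P_i\cap P$. Theorem. Consider the reallocation problem with uniform product size $k \ge 0$ and arbitrary transit times. (1) If $d^-\equiv\infty$ and $k>0$, then every schedule that algorithm Uniform can output is 2-approximate. (2) If $d^-\equiv\infty$ or $d^+\equiv\infty$, the problem is 2-approximable in $O(mn\log m)$ time: there are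 one program for a real random access machine (unit-cost additions, subtractions, comparisons and indirect addressing on integers and reals, and halving of integers) and one constant $C$ such that on every such instance the program halts after at most $C\,mn\log\max(m,2)$ steps with a 2-approximate schedule; if $d^-\equiv\infty$ and $k>0$, this schedule is an output of algorithm Uniform. -/

import Mathlib

open scoped NNReal ENNReal

noncomputable section

/-! ### The reallocation problem -/

/-- An instance of the reallocation problem with `m` products and `n` warehouses.  The last four
fields are the standing assumptions of the problem. -/
structure Realloc (m n : ℕ) where
  /-- size of a product -/
  size : Fin m → ℝ≥0
  /-- source warehouse -/
  src : Fin m → Fin n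
  /-- sink warehouse -/
  tgt : Fin m → Fin n
  /-- transit time (discrete-time model) -/
  transit : Fin m → ℕ
  /-- warehouse capacity -/
  cap : Fin n → ℝ≥0∞
  /-- carry-out capacity -/
  dOut : Fin n → ℝ≥0∞
  /-- carry-in capacity -/
  dIn : Fin n → ℝ≥0∞
  src_ne_tgt : ∀ p, src p ≠ tgt p
  transit_pos : ∀ p, 0 < transit p
  size_le_dOut : ∀ p, (size p : ℝ≥0∞) ≤ dOut (src p)
  size_le_dIn : ∀ p, (size p : ℝ≥0∞) ≤ dIn (tgt p)
  initial_le_cap : ∀ w, ∑ p with src p = w, (size p : ℝ≥0∞) ≤ cap w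
  final_le_cap : ∀ w, ∑ p with tgt p = w, (size p : ℝ≥0∞) ≤ cap w

namespace Realloc

variable {m n : ℕ} (I : Realloc m n)

/-- Feasibility of the schedule that sends product `p` at time `φ p`: the carry-out, the carry-in
and the warehouse capacity constraints at every time `θ`. -/
structure Feasible (φ : Fin m → ℕ) : Prop where
  carry_out : ∀ (θ : ℕ) (w : Fin n),
    ∑ p with I.src p = w ∧ φ p = θ, (I.size p : ℝ≥0∞) ≤ I.dOut w
  carry_in : ∀ (θ : ℕ) (w : Fin n),
    ∑ p with I.tgt p = w ∧ φ p + I.transit p = θ, (I.size p : ℝ≥0∞) ≤ I.dIn w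
  storage : ∀ (θ : ℕ) (w : Fin n),
    ∑ p with I.src p = w ∧ θ ≤ φ p, (I.size p : ℝ≥0∞) +
      ∑ p with I.tgt p = w ∧ φ p + I.transit p ≤ θ, (I.size p : ℝ≥0∞) ≤ I.cap w

/-- The completion time `max_p (φ p + τ p)`. -/
def completion (φ : Fin m → ℕ) : ℕ := Finset.univ.sup fun p => φ p + I.transit p

/-- `φ` is a feasible schedule whose completion time is at most `r` times that of every feasible
schedule. -/
def IsApprox (r : ℕ) (φ : Fin m → ℕ) : Prop :=
  I.Feasible φ ∧ ∀ ψ : Fin m → ℕ, I.Feasible ψ → I.completion φ ≤ r * I.completion ψ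

/-! ### Algorithm Uniform, for uniform product size `k > 0` -/

/-- `⌈a / ⌊d / k⌋⌉`: the number of time steps that `a` products of size `k` need under
the capacity `d`, i.e. under the integral capacity `⌊d / k⌋` after rescaling to unit size
(it is `0` when `d = ∞`). -/
def rounds (k : ℝ≥0) (a : ℕ) (d : ℝ≥0∞) : ℕ :=
  (ENat.ceil ((a : ℝ≥0∞) / (ENat.floor (d / (k : ℝ≥0∞)) : ℝ≥0∞))).toNat

/-- The number `|P⁺(w)|` of products initially stored in `w`. -/
def numOut (w : Fin n) : ℕ := (Finset.univ.filter fun p => I.src p = w).card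

/-- The number `|P⁻(w)|` of products finally stored in `w`. -/
def numIn (w : Fin n) : ℕ := (Finset.univ.filter fun p => I.tgt p = w).card

/-- The number `ρ_max` of time steps used by the algorithm.  The maximum with `1` only matters when
there is no constraint at all on carrying out and carrying in. -/
def rhoMax (k : ℝ≥0) : ℕ :=
  max 1 (Finset.univ.sup fun w =>
    max (rounds k (I.numOut w) (I.dOut w)) (rounds k (I.numIn w) (I.dIn w)))

/-- `a` numbers, for each warehouse `w`, the products `p` with `f p = w` by `0, 1, 2, …`. -/
def IsNumbering (f : Fin m → Fin n) (a : Fin m → ℕ) : Prop :=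
  ∀ w, Set.BijOn a {p | f p = w} (Set.Iio (Finset.univ.filter fun p => f p = w).card)

/-- The arcs of a directed multigraph on the copies `(w, i)` of the warehouses `w`. -/
abbrev Arcs (n : ℕ) := List ((Fin n × ℕ) × (Fin n × ℕ))

/-- Out-degree of a copy of a warehouse. -/
def outDeg (L : Arcs n) (u : Fin n × ℕ) : ℕ := L.countP fun e => e.1 = u

/-- In-degree of a copy of a warehouse. -/
def inDeg (L : Arcs n) (u : Fin n × ℕ) : ℕ := L.countP fun e => e.2 = u

/-- The demand graph after every warehouse `w` has been divided into copies `(w, i)`: the products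
numbered `iρ, …, (i+1)ρ - 1` among those leaving (resp. entering) `w` leave (resp. enter) `(w, i)`.
The `p`-th arc belongs to product `p`. -/
def splitDemand (ρ : ℕ) (a b : Fin m → ℕ) : Arcs n :=
  List.ofFn fun p => ((I.src p, a p / ρ), (I.tgt p, b p / ρ))

/-- One execution of the loop that adds extra products: an arc is added from some `u`
with less outgoing than incoming arcs to some `v` with more outgoing than incoming arcs. -/
def ExtraStep (L L' : Arcs n) : Prop :=
  ∃ u v, outDeg L u < inDeg L u ∧ inDeg L v < outDeg L v ∧ L' = L ++ [(u, v)]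

/-- The set `M` of arcs (given by their positions in `L`) forms vertex-disjoint simple directed
cycles: no two arcs share their tail, no two share their head, and tails and heads are the same
vertices. -/
def DisjointCycles (L : Arcs n) (M : Set (Fin L.length)) : Prop :=
  Set.InjOn (fun e => (L.get e).1) M ∧ Set.InjOn (fun e => (L.get e).2) M ∧
    (fun e => (L.get e).1) '' M = (fun e => (L.get e).2) '' M

/-- `φ` is a possible output of algorithm Uniform on the instance `I` with uniform size `k`, over
all the choices that the algorithm leaves open: the numberings `a`, `b` of the products leaving and
entering each warehouse, the extra products added until every copy is balanced (`L` is the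
resulting demand graph), and the partition of the arcs into `ρ_max` classes `{e | κ e = i}` that
form vertex-disjoint simple cycles. The products in class `i` are sent at time `i`
(classes and times start at `0`). -/
def UniformOutput (k : ℝ≥0) (φ : Fin m → ℕ) : Prop :=
  ∃ a b : Fin m → ℕ, IsNumbering I.src a ∧ IsNumbering I.tgt b ∧
    ∃ L : Arcs n, Relation.ReflTransGen ExtraStep (I.splitDemand (I.rhoMax k) a b) L ∧
      (∀ u, outDeg L u = inDeg L u) ∧
      ∃ κ : ℕ → ℕ, (∀ e < L.length, κ e < I.rhoMax k) ∧
        (∀ i < I.rhoMax k, DisjointCycles L {e | κ e = i}) ∧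
        ∀ p : Fin m, φ p = κ p

end Realloc

/-! ### Machine model

A random access machine with integer and real memory, programmed by structured programs.  The
memory consists of arrays of natural numbers and arrays of real numbers; a program is a fixed
finite text and hence addresses a fixed finite number of arrays, by number, at computed indices.
Every constant, memory access, arithmetic operation, comparison and assignment takes one time unit.
There is no multiplication, no division and no rounding of real numbers. -/

namespace RAM

/-- Memory contents: `nat a i` (resp. `real a i`) is entry `i` of the integer (resp. real)
array number `a`. -/
structure Store where
  nat : ℕ → ℕ → ℕ
  real : ℕ → ℕ → ℝ

/-- Integer expressions: constants, array entries, addition, truncated subtraction, right shift. -/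
inductive NExpr where
  | lit (c : ℕ)
  | get (a : ℕ) (i : NExpr)
  | add (e f : NExpr)
  | sub (e f : NExpr)
  | half (e : NExpr)

/-- Real expressions: array entries, addition, subtraction. -/
inductive RExpr where
  | get (a : ℕ) (i : NExpr)
  | add (e f : RExpr)
  | sub (e f : RExpr)

/-- Tests. -/
inductive Test where
  | natEq (e f : NExpr)
  | natLt (e f : NExpr)
  | realLe (e f : RExpr)
  | not (b : Test)

/-- Programs. -/
inductive Prog where
  | skip
  | setNat (a : ℕ) (i e : NExpr)
  | setReal (a : ℕ) (i : NExpr) (e : RExpr)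
  | seq (c d : Prog)
  | ite (b : Test) (c d : Prog)
  | loop (b : Test) (c : Prog)

def NExpr.eval (σ : Store) : NExpr → ℕ
  | lit c => c
  | get a i => σ.nat a (i.eval σ)
  | add e f => e.eval σ + f.eval σ
  | sub e f => e.eval σ - f.eval σ
  | half e => e.eval σ / 2

def NExpr.cost : NExpr → ℕ
  | lit _ => 1
  | get _ i => i.cost + 1
  | add e f => e.cost + f.cost + 1
  | sub e f => e.cost + f.cost + 1
  | half e => e.cost + 1

def RExpr.eval (σ : Store) : RExpr → ℝ
  | get a i => σ.real a (i.eval σ)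
  | add e f => e.eval σ + f.eval σ
  | sub e f => e.eval σ - f.eval σ

def RExpr.cost : RExpr → ℕ
  | get _ i => i.cost + 1
  | add e f => e.cost + f.cost + 1
  | sub e f => e.cost + f.cost + 1

def Test.Holds (σ : Store) : Test → Prop
  | natEq e f => e.eval σ = f.eval σ
  | natLt e f => e.eval σ < f.eval σ
  | realLe e f => e.eval σ ≤ f.eval σ
  | not b => ¬ b.Holds σ

def Test.cost : Test → ℕ
  | natEq e f => e.cost + f.cost + 1
  | natLt e f => e.cost + f.cost + 1
  | realLe e f => e.cost + f.cost + 1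
  | not b => b.cost + 1

/-- Overwrite one entry of an integer array. -/
def Store.setNat (σ : Store) (a i v : ℕ) : Store :=
  { σ with nat := Function.update σ.nat a (Function.update (σ.nat a) i v) }

/-- Overwrite one entry of a real array. -/
def Store.setReal (σ : Store) (a i : ℕ) (v : ℝ) : Store :=
  { σ with real := Function.update σ.real a (Function.update (σ.real a) i v) }

/-- `Exec c σ σ' t`: started with memory `σ`, the program `c` halts after exactly `t` time units
with memory `σ'`. -/
inductive Exec : Prog → Store → Store → ℕ → Prop
  | skip (σ) : Exec .skip σ σ 1
  | setNat (a i e σ) :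
      Exec (.setNat a i e) σ (σ.setNat a (i.eval σ) (e.eval σ)) (i.cost + e.cost + 1)
  | setReal (a i e σ) :
      Exec (.setReal a i e) σ (σ.setReal a (i.eval σ) (e.eval σ)) (i.cost + e.cost + 1)
  | seq {c d σ σ' σ'' s t} (hc : Exec c σ σ' s) (hd : Exec d σ' σ'' t) :
      Exec (.seq c d) σ σ'' (s + t)
  | ite_true {b c d σ σ' t} (hb : b.Holds σ) (hc : Exec c σ σ' t) :
      Exec (.ite b c d) σ σ' (b.cost + t)
  | ite_false {b c d σ σ' t} (hb : ¬ b.Holds σ) (hd : Exec d σ σ' t) :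
      Exec (.ite b c d) σ σ' (b.cost + t)
  | loop_false {b c σ} (hb : ¬ b.Holds σ) : Exec (.loop b c) σ σ b.cost
  | loop_true {b c σ σ' σ'' s t} (hb : b.Holds σ) (hc : Exec c σ σ' s)
      (hl : Exec (.loop b c) σ' σ'' t) : Exec (.loop b c) σ σ'' (b.cost + s + t)

/-- Contents of an array whose first entries are given by `f`, all other entries being zero. -/
def array {α : Type} [Zero α] {k : ℕ} (f : Fin k → α) (i : ℕ) : α :=
  if h : i < k then f ⟨i, h⟩ else 0

/-- The flag `1` for an infinite capacity, `0` for a finite one. -/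
def flag (d : ℝ≥0∞) : ℕ := if d = ⊤ then 1 else 0

/-- The initial memory for the instance `I`.  Integer arrays: `0` holds `m, n`; `1`, `2`, `3` hold
the sources, sinks and transit times of the products; `4`, `5`, `6` tell which carry-out, carry-in
and warehouse capacities are infinite.  Real arrays: `0` holds the sizes, `1`, `2`, `3` the finite
carry-out, carry-in and warehouse capacities.  Everything else is zero. -/
def encode {m n : ℕ} (I : Realloc m n) : Store where
  nat := fun
    | 0 => array ![m, n]
    | 1 => array fun p => (I.src p : ℕ)
    | 2 => array fun p => (I.tgt p : ℕ)
    | 3 => array I.transit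
    | 4 => array fun w => flag (I.dOut w)
    | 5 => array fun w => flag (I.dIn w)
    | 6 => array fun w => flag (I.cap w)
    | _ => fun _ => 0
  real := fun
    | 0 => array fun p => (I.size p : ℝ)
    | 1 => array fun w => (I.dOut w).toReal
    | 2 => array fun w => (I.dIn w).toReal
    | 3 => array fun w => (I.cap w).toReal
    | _ => fun _ => 0

/-- The schedule written by a program: integer array `7`. -/
def output (m : ℕ) (σ : Store) : Fin m → ℕ := fun p => σ.nat 7 p

end RAM

end

/-!
# Reallocation with uniform product size: algorithm Uniform and an `O(m n log m)` program

*Algorithm Uniform is 2-approximate.*  If every product is sent before time `ρ`, the completion time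
is at most `ρ` plus the largest transit time, and each of these is at most the optimum
(`rhoMax_le_completion`).  For feasibility, extra products never change the larger one of the two
degrees of a copy (`max_deg_of_extraSteps`), and each class of disjoint cycles takes as many
products out of a copy as it brings in.  Hence the products not yet sent from a warehouse and those
sent towards it so far are together at most as many as there are initially or finally
(`card_stored_le`); arrivals are even later because of the transit times.

*A sufficient condition that needs no extra products.*  Suppose that the products are coloured with
`ρ` colours such that every colour has `⌊N/ρ⌋` or `⌊N/ρ⌋ + 1` of the `N` products leaving a warehouse,
likewise for those entering it, and such that no warehouse has a surplus of leaving products in one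
colour and a deficit in another (`Balanced`).  If the products of each warehouse are sorted by their
ranks within the colour classes, the copies are exactly the ranks, and the missing arcs of each
colour can be added as extra products.  So the colouring is an output of algorithm Uniform
(`Balanced.uniformOutput`).

*Computing such a colouring.*  A set of products that is a fair share for `c` colours (`Share`) is
split into fair shares for `⌊c/2⌋` and `⌈c/2⌉` colours.  For this, the fraction `⌊c/2⌋ / c` of each
product is regarded as a circulation in a network with three nodes and three arcs per warehouse,
which carry the numbers of leaving and of entering products and their difference; it is rounded to an
integral circulation (`Initial.share`).  All values are multiplied by `c`, so that they are integers.
The rounding processes the products one by one, and maintains a spanning tree that contains all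
processed arcs with fractional values: the arc of the next product closes a cycle with the tree, flow
is pushed around it until some arc becomes integral, and this arc leaves the tree
(`Rounded.insert`).  When all arcs have been processed, integrality of the balances forces all
values to be integral (`Rounded.dvd`).  A product costs `O(n)` time, so each of the `log ρ` levels of
the recursion costs `O(m n)`, and the at most `m` splittings cost `O(n)` each in addition
(`colour_runs`).

*The remaining parts of the program.*  The number `ρ` is computed by repeated subtraction, without
division (`countRounds_runs`).  If the carry-in capacities are not all infinite, the carry-out
capacities are; then the program works on the instance with all products reversed, whose schedules
run backwards are the schedules of the given instance (`IsApprox.of_rev`).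
-/

noncomputable section

namespace Realloc

/-! ### The number of rounds -/

theorem rounds_of_floor_top {k : ℝ≥0} {d : ℝ≥0∞} (a : ℕ) (h : ⌊d / k⌋ₑ = ⊤) :
    rounds k a d = 0 := by
  simp [rounds, h]

theorem rounds_zero (k : ℝ≥0) (d : ℝ≥0∞) : rounds k 0 d = 0 := by
  simp [rounds]

theorem rounds_le_iff {k : ℝ≥0} {d : ℝ≥0∞} {f : ℕ} (hf : ⌊d / k⌋ₑ = f) (hf0 : 0 < f) (a N : ℕ) :
    rounds k a d ≤ N ↔ a ≤ N * f := by
  have hfin : ((a : ℝ≥0∞) / (f : ℝ≥0∞)) ≠ ⊤ :=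
    ENNReal.div_ne_top (ENNReal.natCast_ne_top a) (by exact_mod_cast hf0.ne')
  have h1 : ENat.ceil ((a : ℝ≥0∞) / (f : ℝ≥0∞)) ≠ ⊤ := by simpa using hfin
  have h2 : rounds k a d ≤ N ↔ ENat.ceil ((a : ℝ≥0∞) / (f : ℝ≥0∞)) ≤ (N : ℕ∞) := by
    unfold rounds
    rw [hf]
    simp only [ENat.toENNReal_coe]
    obtain ⟨x, hx⟩ := ENat.ne_top_iff_exists.mp h1
    rw [← hx]
    simp
  rw [h2, ENat.ceil_le, ENat.toENNReal_coe, ENNReal.div_le_iff (by exact_mod_cast hf0.ne')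
    (ENNReal.natCast_ne_top f)]
  exact_mod_cast Iff.rfl

theorem le_floor_div {k : ℝ≥0} (hk : 0 < k) (d : ℝ≥0∞) (j : ℕ) :
    (j : ℕ∞) ≤ ⌊d / k⌋ₑ ↔ (j : ℝ≥0∞) * k ≤ d := by
  rw [ENat.le_floor, ENat.toENNReal_coe, ENNReal.le_div_iff_mul_le
    (Or.inl (by exact_mod_cast hk.ne')) (Or.inl ENNReal.coe_ne_top)]

variable {m n : ℕ} (I : Realloc m n)

theorem rhoMax_pos (k : ℝ≥0) : 0 < I.rhoMax k := lt_of_lt_of_le one_pos (le_max_left _ _)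

theorem rounds_out_le_rhoMax (k : ℝ≥0) (w : Fin n) :
    rounds k (I.numOut w) (I.dOut w) ≤ I.rhoMax k :=
  le_trans (le_trans (le_max_left _ _) (Finset.le_sup (f := fun w =>
    max (rounds k (I.numOut w) (I.dOut w)) (rounds k (I.numIn w) (I.dIn w)))
    (Finset.mem_univ w))) (le_max_right _ _)

theorem sum_size_eq {k : ℝ≥0} (hsize : ∀ p, I.size p = k) (S : Finset (Fin m)) :
    ∑ p ∈ S, (I.size p : ℝ≥0∞) = (S.card : ℝ≥0∞) * k := by
  simp [hsize]

/-- A warehouse with a product to send has a positive integral carry-out capacity. -/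
theorem one_le_floor_out {k : ℝ≥0} (hk : 0 < k) (hsize : ∀ p, I.size p = k) (p : Fin m) :
    (1 : ℕ∞) ≤ ⌊I.dOut (I.src p) / k⌋ₑ := by
  have := (le_floor_div hk (I.dOut (I.src p)) 1).2 (by
    simpa [hsize] using I.size_le_dOut p)
  simpa using this

theorem numOut_le_rhoMax_mul {k : ℝ≥0} (hk : 0 < k) (hsize : ∀ p, I.size p = k) (w : Fin n)
    {f : ℕ} (hf : ⌊I.dOut w / k⌋ₑ = f) : I.numOut w ≤ I.rhoMax k * f := by
  rcases Nat.eq_zero_or_pos (I.numOut w) with h0 | h0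
  · simp [h0]
  · obtain ⟨p, hp⟩ := Finset.card_pos.1 h0
    simp only [Finset.mem_filter, Finset.mem_univ, true_and] at hp
    have h1 := I.one_le_floor_out hk hsize p
    rw [hp, hf] at h1
    exact (rounds_le_iff hf (by exact_mod_cast h1) _ _).1 (I.rounds_out_le_rhoMax k w)

/-! ### Lower bounds on the completion time -/

theorem transit_lt_completion (ψ : Fin m → ℕ) (p : Fin m) : ψ p + I.transit p ≤ I.completion ψ :=
  Finset.le_sup (f := fun p => ψ p + I.transit p) (Finset.mem_univ p)

/-- Every feasible schedule takes at least `ρ` time steps, since at most `⌊d⁺(w)/k⌋` products can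
leave `w` at a time. -/
theorem rhoMax_le_completion {k : ℝ≥0} (hk : 0 < k) (hsize : ∀ p, I.size p = k)
    (hin : ∀ w, I.dIn w = ⊤) (hm : 0 < m) {ψ : Fin m → ℕ} (hψ : I.Feasible ψ) :
    I.rhoMax k ≤ I.completion ψ := by
  have hT : ∀ p, ψ p < I.completion ψ := fun p => by
    have := I.transit_lt_completion ψ p
    have := I.transit_pos p
    omega
  refine max_le (by have := hT ⟨0, hm⟩; omega) (Finset.sup_le fun w _ => max_le ?_ ?_)
  · rcases eq_or_ne ⌊I.dOut w / k⌋ₑ ⊤ with h | h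
    · simp [rounds_of_floor_top _ h]
    obtain ⟨f, hf⟩ := ENat.ne_top_iff_exists.mp h
    rcases Nat.eq_zero_or_pos (I.numOut w) with h0 | h0
    · simp [h0, rounds_zero]
    have hf0 : 0 < f := by
      obtain ⟨p, hp⟩ := Finset.card_pos.1 h0
      simp only [Finset.mem_filter, Finset.mem_univ, true_and] at hp
      have h1 := I.one_le_floor_out hk hsize p
      rw [hp, ← hf] at h1
      exact_mod_cast h1
    rw [rounds_le_iff hf.symm hf0]
    have h2 := Finset.card_le_mul_card_image_of_maps_to
      (s := Finset.univ.filter fun p => I.src p = w) (t := Finset.range (I.completion ψ))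
      (f := ψ) (fun p _ => Finset.mem_range.2 (hT p)) f (fun θ _ => by
        have h3 := hψ.carry_out θ w
        rw [I.sum_size_eq hsize, ← le_floor_div hk, ← hf] at h3
        rw [Finset.filter_filter]
        exact_mod_cast h3)
    rw [Finset.card_range, mul_comm] at h2
    exact h2
  · have : ⌊I.dIn w / k⌋ₑ = ⊤ := by simp [hin w, ENNReal.top_div]
    simp [rounds_of_floor_top _ this]

/-! ### Extra products -/

theorem countP_eq_card {α : Type*} (L : List α) (P : α → Prop) [DecidablePred P] :
    L.countP P = (Finset.univ.filter fun e : Fin L.length => P (L.get e)).card := by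
  conv_lhs => rw [← List.ofFn_get L]
  rw [← Multiset.coe_countP, ← Fin.univ_val_map, Multiset.countP_map]
  rfl

/-- Adding extra products does not change the larger one of the two degrees of a copy. -/
theorem max_deg_of_extraSteps {L L' : Arcs n} (h : Relation.ReflTransGen ExtraStep L L') :
    L <+: L' ∧ ∀ u, max (outDeg L' u) (inDeg L' u) = max (outDeg L u) (inDeg L u) := by
  induction h with
  | refl => exact ⟨List.prefix_refl _, fun _ => rfl⟩
  | tail _ hs ih =>
    obtain ⟨u, v, hu, hv, rfl⟩ := hs
    refine ⟨ih.1.trans (List.prefix_append _ _), fun x => ?_⟩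
    rw [← ih.2 x]
    simp only [outDeg, inDeg, List.countP_append, List.countP_singleton] at *
    by_cases hx : u = x <;> by_cases hy : v = x <;> simp [hx, hy] <;> subst_vars <;> omega

/-- A vertex lies on at most one cycle of each class: it has as many leaving as entering arcs. -/
theorem DisjointCycles.card_eq {L : Arcs n} {M : Finset (Fin L.length)}
    (h : DisjointCycles L M) (u : Fin n × ℕ) :
    (M.filter fun e => (L.get e).1 = u).card = (M.filter fun e => (L.get e).2 = u).card := by
  obtain ⟨h1, h2, h3⟩ := h
  have h1' : (M.filter fun e => (L.get e).1 = u).card ≤ 1 :=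
    Finset.card_le_one.2 fun a ha b hb => by
      simp only [Finset.mem_filter] at ha hb
      exact h1 ha.1 hb.1 (ha.2.trans hb.2.symm)
  have h2' : (M.filter fun e => (L.get e).2 = u).card ≤ 1 :=
    Finset.card_le_one.2 fun a ha b hb => by
      simp only [Finset.mem_filter] at ha hb
      exact h2 ha.1 hb.1 (ha.2.trans hb.2.symm)
  have h4 : 0 < (M.filter fun e => (L.get e).1 = u).card ↔
      0 < (M.filter fun e => (L.get e).2 = u).card := by
    have := Set.ext_iff.1 h3 u
    simpa [Finset.card_pos, Finset.Nonempty] using this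
  omega

/-- In a balanced graph partitioned into classes of disjoint cycles, the arcs leaving `u` in late
classes and those entering `u` in early classes are together at most as many as all those leaving
`u`. -/
theorem late_add_early_le {L : Arcs n} {ρ : ℕ} {κ : ℕ → ℕ} (hκ : ∀ e < L.length, κ e < ρ)
    (hc : ∀ i < ρ, DisjointCycles L {e | κ e = i}) (u : Fin n × ℕ) (θ : ℕ) :
    (Finset.univ.filter fun e : Fin L.length => (L.get e).1 = u ∧ θ ≤ κ e).card +
      (Finset.univ.filter fun e : Fin L.length => (L.get e).2 = u ∧ κ e < θ).card ≤
      outDeg L u := by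
  -- in each early class, as many arcs enter `u` as leave it
  have key : (Finset.univ.filter fun e : Fin L.length => (L.get e).2 = u ∧ κ e < θ).card =
      (Finset.univ.filter fun e : Fin L.length => (L.get e).1 = u ∧ κ e < θ).card := by
    rw [Finset.card_eq_sum_card_fiberwise (f := fun e : Fin L.length => κ e) (t := Finset.range ρ)
        (fun e _ => by simpa using hκ e e.2),
      Finset.card_eq_sum_card_fiberwise (f := fun e : Fin L.length => κ e) (t := Finset.range ρ)
        (fun e _ => by simpa using hκ e e.2)]
    refine Finset.sum_congr rfl fun i hi => ?_
    by_cases hiθ : i < θ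
    · have h1 := hc i (Finset.mem_range.1 hi)
      have h2 : ({e | κ e = i} : Set (Fin L.length)) =
          ((Finset.univ.filter fun e : Fin L.length => κ e = i : Finset (Fin L.length)) :
            Set (Fin L.length)) := by ext; simp
      rw [h2] at h1
      have h3 := DisjointCycles.card_eq h1 u
      have hfil : ∀ (P : Fin L.length → Prop) [DecidablePred P],
          ((Finset.univ.filter fun e : Fin L.length => P e ∧ κ e < θ).filter fun e : Fin L.length =>
            κ e = i) =
            (Finset.univ.filter fun e : Fin L.length => κ e = i).filter P := fun P _ => by
        ext e
        simp only [Finset.mem_filter, Finset.mem_univ, true_and]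
        constructor
        · rintro ⟨⟨h, _⟩, h'⟩; exact ⟨h', h⟩
        · rintro ⟨h', h⟩; exact ⟨⟨h, by omega⟩, h'⟩
      rw [hfil, hfil]
      exact h3.symm
    · rw [Finset.filter_filter, Finset.filter_filter]
      congr 1
      ext e
      simp
      omega
  rw [key, outDeg, countP_eq_card, ← Finset.card_union_of_disjoint]
  · refine Finset.card_le_card fun e => ?_
    simp
    rintro (h | h) <;> exact h.1
  · rw [Finset.disjoint_filter]
    rintro e - ⟨_, h⟩ ⟨_, h'⟩
    omega

/-! ### Numberings -/

theorem IsNumbering.lt {f : Fin m → Fin n} {a : Fin m → ℕ} (h : IsNumbering f a) (p : Fin m) :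
    a p < (Finset.univ.filter fun q => f q = f p).card :=
  (h (f p)).mapsTo (x := p) rfl

/-- The number of products that are assigned to the copy `(w, j)`. -/
theorem IsNumbering.card_copy {f : Fin m → Fin n} {a : Fin m → ℕ} (h : IsNumbering f a) (ρ : ℕ)
    (u : Fin n × ℕ) :
    (Finset.univ.filter fun p => (f p, a p / ρ) = u).card =
      ((Finset.range (Finset.univ.filter fun p => f p = u.1).card).filter
        fun x => x / ρ = u.2).card := by
  refine Finset.card_bij (fun p _ => a p) ?_ ?_ ?_
  · intro p hp
    simp only [Finset.mem_filter, Finset.mem_univ, true_and, Prod.ext_iff] at hp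
    simp only [Finset.mem_filter, Finset.mem_range]
    exact ⟨(h u.1).mapsTo hp.1, hp.2⟩
  · intro p hp q hq hpq
    simp only [Finset.mem_filter, Finset.mem_univ, true_and, Prod.ext_iff] at hp hq
    exact (h u.1).injOn hp.1 hq.1 hpq
  · intro x hx
    simp only [Finset.mem_filter, Finset.mem_range] at hx
    obtain ⟨p, hp, rfl⟩ := (h u.1).surjOn hx.1
    refine ⟨p, ?_, rfl⟩
    simp only [Finset.mem_filter, Finset.mem_univ, true_and, Prod.ext_iff]
    exact ⟨hp, hx.2⟩

theorem outDeg_splitDemand (ρ : ℕ) (a b : Fin m → ℕ) (u : Fin n × ℕ) :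
    outDeg (I.splitDemand ρ a b) u =
      (Finset.univ.filter fun p => (I.src p, a p / ρ) = u).card := by
  rw [outDeg, splitDemand, ← Multiset.coe_countP, ← Fin.univ_val_map, Multiset.countP_map]
  rfl

theorem inDeg_splitDemand (ρ : ℕ) (a b : Fin m → ℕ) (u : Fin n × ℕ) :
    inDeg (I.splitDemand ρ a b) u =
      (Finset.univ.filter fun p => (I.tgt p, b p / ρ) = u).card := by
  rw [inDeg, splitDemand, ← Multiset.coe_countP, ← Fin.univ_val_map, Multiset.countP_map]
  rfl

/-- The first `m` arcs of the demand graph belong to the products. -/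
theorem get_of_extraSteps {ρ : ℕ} {a b : Fin m → ℕ} {L : Arcs n}
    (hL : Relation.ReflTransGen ExtraStep (I.splitDemand ρ a b) L) :
    ∃ hmL : m ≤ L.length, ∀ p : Fin m, L.get (Fin.castLE hmL p) =
      ((I.src p, a p / ρ), (I.tgt p, b p / ρ)) := by
  have hpre := (max_deg_of_extraSteps hL).1
  have hlen : (I.splitDemand ρ a b).length = m := by simp [splitDemand]
  refine ⟨hlen ▸ hpre.length_le, fun p => ?_⟩
  have h1 := hpre.getElem (i := (p : ℕ)) (by rw [hlen]; exact p.2)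
  refine Eq.trans h1.symm ?_
  simp [splitDemand]

/-- The copies of `w` that are used have indices below `m`, and the copies partition the
products. -/
theorem sum_card_copy {f : Fin m → Fin n} {a : Fin m → ℕ} (h : IsNumbering f a) (ρ : ℕ)
    (w : Fin n) (P : Fin m → Prop) [DecidablePred P] :
    (Finset.univ.filter fun p => f p = w ∧ P p).card =
      ∑ j ∈ Finset.range m,
        (Finset.univ.filter fun p => (f p, a p / ρ) = (w, j) ∧ P p).card := by
  rw [Finset.card_eq_sum_card_fiberwise (f := fun p => a p / ρ) (t := Finset.range m)]
  · refine Finset.sum_congr rfl fun j _ => ?_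
    rw [Finset.filter_filter]
    congr 1
    ext p
    simp only [Finset.mem_filter, Finset.mem_univ, true_and, Prod.ext_iff]
    tauto
  · intro p _
    have h1 := h.lt p
    have h2 : (Finset.univ.filter fun q => f q = f p).card ≤ m := by
      simpa using Finset.card_le_univ (Finset.univ.filter fun q => f q = f p)
    have := Nat.div_le_self (a p) ρ
    simp only [Finset.coe_range, Set.mem_Iio]
    omega

/-! ### Outputs of algorithm Uniform are 2-approximate -/

section Output

variable {k : ℝ≥0} {φ : Fin m → ℕ} {a b : Fin m → ℕ} {L : Arcs n} {ρ : ℕ} {κ : ℕ → ℕ}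

/-- The products that are still stored in their source `w` at time `θ` and those that left for
their sink `w` before `θ` are together at most as many as the products in the initial or in the
final state of `w`. -/
theorem card_stored_le (ha : IsNumbering I.src a) (hb : IsNumbering I.tgt b)
    (hL : Relation.ReflTransGen ExtraStep (I.splitDemand ρ a b) L)
    (hbal : ∀ u, outDeg L u = inDeg L u) (hκ : ∀ e < L.length, κ e < ρ)
    (hc : ∀ i < ρ, DisjointCycles L {e | κ e = i}) (w : Fin n) (θ : ℕ) :
    (Finset.univ.filter fun p : Fin m => I.src p = w ∧ θ ≤ κ p).card +
      (Finset.univ.filter fun p : Fin m => I.tgt p = w ∧ κ p < θ).card ≤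
      max (I.numOut w) (I.numIn w) := by
  have hmax := (max_deg_of_extraSteps hL).2
  obtain ⟨hmL, hget⟩ := I.get_of_extraSteps hL
  have hcopy : ∀ u : Fin n × ℕ,
      (Finset.univ.filter fun p : Fin m => (I.src p, a p / ρ) = u ∧ θ ≤ κ p).card +
      (Finset.univ.filter fun p : Fin m => (I.tgt p, b p / ρ) = u ∧ κ p < θ).card ≤
      max ((Finset.range (I.numOut u.1)).filter fun x => x / ρ = u.2).card
        ((Finset.range (I.numIn u.1)).filter fun x => x / ρ = u.2).card := fun u => by
    have h1 := hmax u
    rw [hbal, max_self, outDeg_splitDemand, inDeg_splitDemand, ha.card_copy, hb.card_copy] at h1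
    unfold numOut numIn
    rw [← h1, ← hbal]
    refine le_trans (Nat.add_le_add ?_ ?_) (late_add_early_le hκ hc u θ)
    · refine Finset.card_le_card_of_injOn (Fin.castLE hmL) (fun p hp => ?_)
        (Fin.castLE_injective hmL).injOn
      simp only [Finset.coe_filter, Finset.mem_univ, true_and, Set.mem_ofPred_eq] at hp ⊢
      rw [hget]
      exact hp
    · refine Finset.card_le_card_of_injOn (Fin.castLE hmL) (fun p hp => ?_)
        (Fin.castLE_injective hmL).injOn
      simp only [Finset.coe_filter, Finset.mem_univ, true_and, Set.mem_ofPred_eq] at hp ⊢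
      rw [hget]
      exact hp
  rw [sum_card_copy ha ρ w, sum_card_copy hb ρ w, ← Finset.sum_add_distrib]
  refine le_trans (Finset.sum_le_sum fun j _ => hcopy (w, j)) ?_
  -- the copies with small indices are filled first, hence one of the two degrees dominates the
  -- other in all copies of `w` simultaneously
  have hsum : ∀ N, ∑ j ∈ Finset.range m, ((Finset.range N).filter fun x => x / ρ = j).card ≤ N :=
    fun N => by
      rw [← Finset.card_biUnion fun i _ j _ hij => Finset.disjoint_filter.2
        fun x _ h h' => hij (h.symm.trans h')]
      refine le_trans (Finset.card_le_card fun x hx => ?_) (Finset.card_range N).le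
      obtain ⟨j, -, hx⟩ := Finset.mem_biUnion.1 hx
      exact (Finset.mem_filter.1 hx).1
  have hmono : ∀ N N' j, N ≤ N' → ((Finset.range N).filter fun x => x / ρ = j).card ≤
      ((Finset.range N').filter fun x => x / ρ = j).card := fun N N' j h =>
    Finset.card_le_card (Finset.filter_subset_filter _ (Finset.range_mono h))
  rcases le_total (I.numOut w) (I.numIn w) with h | h
  · simp only [max_eq_right h, max_eq_right (hmono _ _ _ h)]
    exact hsum _
  · simp only [max_eq_left h, max_eq_left (hmono _ _ _ h)]
    exact hsum _

theorem feasible_of_uniformOutput (hk : 0 < k) (hsize : ∀ p, I.size p = k)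
    (hin : ∀ w, I.dIn w = ⊤) (hφ : I.UniformOutput k φ) : I.Feasible φ := by
  obtain ⟨a, b, ha, hb, L, hL, hbal, κ, hκ, hc, hφκ⟩ := hφ
  obtain ⟨hmL, hget⟩ := I.get_of_extraSteps hL
  refine ⟨fun θ w => ?_, fun θ w => by simp [hin], fun θ w => ?_⟩
  · rw [I.sum_size_eq hsize, ← le_floor_div hk]
    rcases eq_or_ne ⌊I.dOut w / k⌋ₑ ⊤ with h | h
    · simp [h]
    obtain ⟨f, hf⟩ := ENat.ne_top_iff_exists.mp h
    rw [← hf]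
    have h1 := I.numOut_le_rhoMax_mul hk hsize w hf.symm
    -- products of one class leave different copies, and `w` has at most `f` copies
    have h2 : (Finset.univ.filter fun p => I.src p = w ∧ φ p = θ).card ≤
        (Finset.range f).card := by
      refine Finset.card_le_card_of_injOn (fun p => a p / I.rhoMax k) (fun p hp => ?_) ?_
      · simp only [Finset.coe_filter, Finset.mem_univ, true_and, Set.mem_ofPred_eq] at hp
        have h3 := ha.lt p
        rw [hp.1] at h3
        simp only [Finset.coe_range, Set.mem_Iio]
        exact Nat.div_lt_of_lt_mul (lt_of_lt_of_le h3 h1)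
      · intro p hp q hq hpq
        simp only [Finset.coe_filter, Finset.mem_univ, true_and, Set.mem_ofPred_eq] at hp hq hpq
        have hθ : θ < I.rhoMax k := by
          rw [← hp.2, hφκ]
          exact hκ _ (lt_of_lt_of_le p.2 hmL)
        refine Fin.castLE_injective hmL ((hc θ hθ).1 ?_ ?_ ?_)
        · simp [← hφκ, hp.2]
        · simp [← hφκ, hq.2]
        · simp only [hget, hp.1, hq.1, hpq]
    rw [Finset.card_range] at h2
    exact_mod_cast h2
  · rw [I.sum_size_eq hsize, I.sum_size_eq hsize, ← add_mul]
    have h1 := I.card_stored_le ha hb hL hbal hκ hc w θ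
    have h2 : (Finset.univ.filter fun p => I.tgt p = w ∧ φ p + I.transit p ≤ θ).card ≤
        (Finset.univ.filter fun p : Fin m => I.tgt p = w ∧ κ p < θ).card := by
      refine Finset.card_le_card fun p => ?_
      simp only [Finset.mem_filter, Finset.mem_univ, true_and, ← hφκ]
      have := I.transit_pos p
      rintro ⟨h, h'⟩
      exact ⟨h, by omega⟩
    simp only [← hφκ] at h1 h2
    have h3 : (Finset.univ.filter fun p => I.src p = w ∧ θ ≤ φ p).card +
      (Finset.univ.filter fun p => I.tgt p = w ∧ φ p + I.transit p ≤ θ).card ≤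
      max (I.numOut w) (I.numIn w) := by omega
    have h4 : ((max (I.numOut w) (I.numIn w) : ℕ) : ℝ≥0∞) * k ≤ I.cap w := by
      have ho := I.initial_le_cap w
      have hi := I.final_le_cap w
      rw [I.sum_size_eq hsize] at ho hi
      rcases max_choice (I.numOut w) (I.numIn w) with h | h <;> rw [h]
      · exact ho
      · exact hi
    refine le_trans (mul_le_mul_left ?_ _) h4
    exact_mod_cast h3

theorem UniformOutput.lt_rhoMax (hφ : I.UniformOutput k φ) (p : Fin m) : φ p < I.rhoMax k := by
  obtain ⟨a, b, ha, hb, L, hL, hbal, κ, hκ, hc, hφκ⟩ := hφ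
  have h1 := (max_deg_of_extraSteps hL).1.length_le
  rw [hφκ]
  refine hκ _ (lt_of_lt_of_le ?_ h1)
  simp [splitDemand]

theorem completion_le_two_mul {ψ : Fin m → ℕ} {R : ℕ} (hφ : ∀ p, φ p < R)
    (hR : 0 < m → R ≤ I.completion ψ) : I.completion φ ≤ 2 * I.completion ψ := by
  refine Finset.sup_le fun p _ => ?_
  have h1 := hR (lt_of_le_of_lt (Nat.zero_le _) p.2)
  have h2 := hφ p
  have h3 := I.transit_lt_completion ψ p
  omega

/-- Algorithm Uniform sends every product before time `ρ`; both `ρ` and all transit times are at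
most the optimum. -/
theorem isApprox_of_uniformOutput (hk : 0 < k) (hsize : ∀ p, I.size p = k)
    (hin : ∀ w, I.dIn w = ⊤) (hφ : I.UniformOutput k φ) : I.IsApprox 2 φ :=
  ⟨I.feasible_of_uniformOutput hk hsize hin hφ, fun _ hψ =>
    I.completion_le_two_mul hφ.lt_rhoMax fun hm =>
      I.rhoMax_le_completion hk hsize hin hm hψ⟩

end Output

end Realloc

namespace Realloc

/-! ### Outputs of algorithm Uniform from balanced colourings -/

/-- Ranking the elements of a finite set by an injective key is a bijection onto an initial
segment of the natural numbers. -/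
theorem rank_bijOn {α : Type*} (S : Finset α) (key : α → ℕ) (hkey : Set.InjOn key S) :
    Set.BijOn (fun p => (S.filter fun q => key q < key p).card) S (Set.Iio S.card) := by
  have hmaps : Set.MapsTo (fun p => (S.filter fun q => key q < key p).card) S
      (Set.Iio S.card) := fun p hp =>
    Finset.card_lt_card ⟨Finset.filter_subset _ _, fun h => by
      have := h hp
      simp at this⟩
  have hlt : ∀ p ∈ S, ∀ q ∈ S, key p < key q → (S.filter fun x => key x < key p).card <
      (S.filter fun x => key x < key q).card := fun p hp q _ h =>
    Finset.card_lt_card ⟨fun x hx => by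
      simp only [Finset.mem_filter] at hx ⊢
      exact ⟨hx.1, hx.2.trans h⟩, fun h' => by
      have := h' (Finset.mem_filter.2 ⟨hp, h⟩)
      simp at this⟩
  have hinj : Set.InjOn (fun p => (S.filter fun q => key q < key p).card) S := by
    intro p hp q hq hpq
    rcases lt_trichotomy (key p) (key q) with h | h | h
    · exact absurd hpq (hlt p hp q hq h).ne
    · exact hkey hp hq h
    · exact absurd hpq (hlt q hq p hp h).ne'
  refine ⟨hmaps, hinj, ?_⟩
  have h1 := Finset.surjOn_of_injOn_of_card_le (s := S) (t := Finset.range S.card)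
    (fun p => (S.filter fun q => key q < key p).card)
    (by simpa using hmaps) hinj (by simp)
  simpa using h1

variable {m n : ℕ}

/-- The number of products of colour `i` at the warehouse `w`, where `f` is the map to sources or
the map to sinks. -/
def colourCount (f : Fin m → Fin n) (κ : Fin m → ℕ) (w : Fin n) (i : ℕ) : ℕ :=
  (Finset.univ.filter fun p => f p = w ∧ κ p = i).card

/-- The rank of a product among those with the same colour at the same warehouse. -/
def colourRank (f : Fin m → Fin n) (κ : Fin m → ℕ) (p : Fin m) : ℕ :=
  ((Finset.univ.filter fun q => f q = f p ∧ κ q = κ p).filter fun q : Fin m =>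
    (q : ℕ) < p).card

theorem colourRank_bijOn (f : Fin m → Fin n) (κ : Fin m → ℕ) (w : Fin n) (i : ℕ) :
    Set.BijOn (colourRank f κ) {p | f p = w ∧ κ p = i} (Set.Iio (colourCount f κ w i)) := by
  have h := rank_bijOn (Finset.univ.filter fun p => f p = w ∧ κ p = i) (fun p : Fin m => (p : ℕ))
    (Fin.val_injective.injOn)
  have h2 : (((Finset.univ.filter fun p => f p = w ∧ κ p = i) : Finset (Fin m)) : Set (Fin m)) =
      {p | f p = w ∧ κ p = i} := by ext; simp
  rw [h2] at h
  refine (Set.BijOn.congr h ?_)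
  rintro p ⟨rfl, rfl⟩
  rfl

/-- If every colour occurs `⌊N_w/ρ⌋` or `⌊N_w/ρ⌋ + 1` times among the `N_w` products at `w`, then
these can be numbered so that `⌊number/ρ⌋` is the rank within the colour class: sort by rank, then
by colour. -/
theorem exists_numbering {ρ : ℕ} {κ : Fin m → ℕ} (f : Fin m → Fin n) (hκ : ∀ p, κ p < ρ)
    (hlo : ∀ w, ∀ i < ρ, (Finset.univ.filter fun p => f p = w).card / ρ ≤ colourCount f κ w i)
    (hhi : ∀ w, ∀ i < ρ, colourCount f κ w i ≤ (Finset.univ.filter fun p => f p = w).card / ρ + 1) :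
    ∃ a, IsNumbering f a ∧ ∀ p, a p / ρ = colourRank f κ p := by
  have hkey : ∀ p q, colourRank f κ p * ρ + κ p = colourRank f κ q * ρ + κ q →
      colourRank f κ p = colourRank f κ q ∧ κ p = κ q := fun p q h => by
    have hρ : 0 < ρ := (Nat.zero_le _).trans_lt (hκ p)
    have h1 := congrArg (· / ρ) h
    have h2 := congrArg (· % ρ) h
    simp only [Nat.mul_add_mod_self_right, Nat.mod_eq_of_lt (hκ _)] at h2
    simp only [Nat.add_div_of_dvd_right (Dvd.intro_left _ rfl), Nat.div_eq_of_lt (hκ _),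
      Nat.mul_div_cancel _ hρ] at h1
    exact ⟨by simpa using h1, h2⟩
  have hinj : ∀ w, Set.InjOn (fun p => colourRank f κ p * ρ + κ p)
      ((Finset.univ.filter fun p => f p = w : Finset (Fin m)) : Set (Fin m)) := by
    intro w p hp q hq h
    simp only [Finset.coe_filter, Finset.mem_univ, true_and, Set.mem_ofPred_eq] at hp hq
    obtain ⟨h1, h2⟩ := hkey p q h
    exact (colourRank_bijOn f κ w (κ p)).injOn ⟨hp, rfl⟩ ⟨hq, h2.symm⟩ h1
  refine ⟨fun p => ((Finset.univ.filter fun q => f q = f p).filter fun q =>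
    colourRank f κ q * ρ + κ q < colourRank f κ p * ρ + κ p).card, fun w => ?_, fun p => ?_⟩
  · have h := rank_bijOn _ _ (hinj w)
    have h2 : (((Finset.univ.filter fun p => f p = w) : Finset (Fin m)) : Set (Fin m)) =
      {p | f p = w} := by ext; simp
    rw [h2] at h
    refine (Set.BijOn.congr h ?_)
    rintro p rfl
    rfl
  · have hρ : 0 < ρ := (Nat.zero_le _).trans_lt (hκ p)
    refine (Nat.div_eq_iff hρ).2 ⟨?_, ?_⟩
    · -- every smaller rank is attained in every colour
      have hr : colourRank f κ p ≤ (Finset.univ.filter fun q => f q = f p).card / ρ := by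
        have h1 := (colourRank_bijOn f κ (f p) (κ p)).mapsTo (x := p) ⟨rfl, rfl⟩
        have h2 := hhi (f p) (κ p) (hκ p)
        simp only [Set.mem_Iio] at h1
        omega
      have h1 : ∀ x : ℕ × ℕ, ∃ q, x.1 < colourRank f κ p → x.2 < ρ →
          f q = f p ∧ κ q = x.2 ∧ colourRank f κ q = x.1 := by
        rintro ⟨j, i⟩
        by_cases hj : j < colourRank f κ p ∧ i < ρ
        · have h2 := hlo (f p) i hj.2
          obtain ⟨q, hq, hq'⟩ := (colourRank_bijOn f κ (f p) i).surjOn (a := j)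
            (by simp only [Set.mem_Iio]; omega)
          exact ⟨q, fun _ _ => ⟨hq.1, hq.2, hq'⟩⟩
        · exact ⟨p, fun h h' => absurd ⟨h, h'⟩ hj⟩
      choose g hg using h1
      have h2 : (Finset.range (colourRank f κ p) ×ˢ Finset.range ρ).card ≤ _ :=
        Finset.card_le_card_of_injOn (t := (Finset.univ.filter fun q => f q = f p).filter fun q =>
          colourRank f κ q * ρ + κ q < colourRank f κ p * ρ + κ p) g
          (fun x hx => by
            simp only [Finset.coe_product, Finset.coe_range, Set.mem_prod, Set.mem_Iio] at hx
            obtain ⟨h3, h4, h5⟩ := hg x hx.1 hx.2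
            simp only [Finset.coe_filter, Finset.mem_filter, Finset.mem_univ, true_and,
              Set.mem_ofPred_eq]
            refine ⟨h3, ?_⟩
            rw [h4, h5]
            calc x.1 * ρ + x.2 < x.1 * ρ + ρ := by omega
              _ = (x.1 + 1) * ρ := by ring
              _ ≤ colourRank f κ p * ρ := Nat.mul_le_mul_right _ hx.1
              _ ≤ _ := Nat.le_add_right _ _)
          (fun x hx y hy hxy => by
            simp only [Finset.coe_product, Finset.coe_range, Set.mem_prod, Set.mem_Iio] at hx hy
            obtain ⟨-, h4, h5⟩ := hg x hx.1 hx.2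
            obtain ⟨-, h4', h5'⟩ := hg y hy.1 hy.2
            rw [hxy] at h4 h5
            exact Prod.ext (h5.symm.trans h5') (h4.symm.trans h4'))
      simpa using h2
    · have h1 : ((Finset.univ.filter fun q => f q = f p).filter fun q =>
          colourRank f κ q * ρ + κ q < colourRank f κ p * ρ + κ p).card ≤
          (Finset.range (colourRank f κ p * ρ + κ p)).card :=
        Finset.card_le_card_of_injOn (fun q => colourRank f κ q * ρ + κ q)
          (fun q hq => by simpa using (Finset.mem_filter.1 hq).2)
          ((hinj (f p)).mono (by
            intro q hq
            exact (Finset.mem_filter.1 hq).1))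
      rw [Finset.card_range] at h1
      have := hκ p
      have h2 := h1.trans_lt (Nat.add_lt_add_left this _)
      exact Nat.le_sub_one_of_lt h2

/-- Arcs can be added one by one by `ExtraStep`s if they lead to a balanced graph and no vertex is
both a tail and a head of them. -/
theorem extraSteps_append {L X : Arcs n} (hbal : ∀ u, outDeg (L ++ X) u = inDeg (L ++ X) u)
    (hX : ∀ e ∈ X, ∀ f ∈ X, e.1 ≠ f.2) : Relation.ReflTransGen ExtraStep L (L ++ X) := by
  induction X generalizing L with
  | nil => simpa using Relation.ReflTransGen.refl
  | cons e X ih =>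
    have h1 : L ++ e :: X = (L ++ [e]) ++ X := by simp
    have htail : inDeg (e :: X) e.1 = 0 := by
      simp only [inDeg, List.countP_eq_zero, decide_eq_true_eq]
      exact fun f hf h => hX e (by simp) f hf h.symm
    have hhead : outDeg (e :: X) e.2 = 0 := by
      simp only [outDeg, List.countP_eq_zero, decide_eq_true_eq]
      exact fun f hf h => hX f hf e (by simp) h
    refine Relation.ReflTransGen.head (b := L ++ [e]) ⟨e.1, e.2, ?_, ?_, rfl⟩ ?_
    · have := hbal e.1
      have h2 : 0 < outDeg (e :: X) e.1 := by simp [outDeg]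
      simp only [outDeg, inDeg, List.countP_append] at this h2 htail ⊢
      omega
    · have := hbal e.2
      have h2 : 0 < inDeg (e :: X) e.2 := by simp [inDeg]
      simp only [outDeg, inDeg, List.countP_append] at this h2 hhead ⊢
      omega
    · rw [h1]
      refine ih (fun u => by rw [← h1]; exact hbal u) fun e he f hf => hX e (by simp [he]) f
        (by simp [hf])

/-- Two finite sets with equally many elements of every colour are in colour-preserving
bijection. -/
theorem exists_fiber_equiv {α β γ : Type*} [DecidableEq γ] (A : Finset α) (B : Finset β)
    (f : α → γ) (g : β → γ)
    (h : ∀ i, (A.filter fun x => f x = i).card = (B.filter fun x => g x = i).card) :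
    ∃ e : A ≃ B, ∀ x : A, g (e x) = f x := by
  have h1 : ∀ i, Nonempty ({x : A // f x = i} ≃ {x : B // g x = i}) := fun i => by
    refine Fintype.card_eq.1 ?_
    have h2 := h i
    rw [Fintype.card_subtype, Fintype.card_subtype]
    rw [Finset.card_filter, Finset.card_filter] at h2 ⊢
    rw [← Finset.sum_coe_sort A, ← Finset.sum_coe_sort B] at h2
    exact h2
  exact ⟨Equiv.ofFiberEquiv (f := fun x : A => f x) (g := fun x : B => g x) fun i => (h1 i).some,
    fun x => Equiv.ofFiberEquiv_map (f := fun x : A => f x) (g := fun x : B => g x) _ x⟩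

variable (I : Realloc m n)

/-- A colouring of the products by `ρ` colours that is equitable at the sources and at the sinks
and such that the sign of the imbalance of a warehouse is the same in all colours. -/
structure Balanced (ρ : ℕ) (κ : Fin m → ℕ) : Prop where
  lt : ∀ p, κ p < ρ
  out_ge : ∀ w, ∀ i < ρ, I.numOut w / ρ ≤ colourCount I.src κ w i
  out_le : ∀ w, ∀ i < ρ, colourCount I.src κ w i ≤ I.numOut w / ρ + 1
  in_ge : ∀ w, ∀ i < ρ, I.numIn w / ρ ≤ colourCount I.tgt κ w i
  in_le : ∀ w, ∀ i < ρ, colourCount I.tgt κ w i ≤ I.numIn w / ρ + 1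
  surplus : ∀ w, ∀ i < ρ, I.numIn w ≤ I.numOut w → colourCount I.tgt κ w i ≤ colourCount I.src κ w i
  deficit : ∀ w, ∀ i < ρ, I.numOut w ≤ I.numIn w → colourCount I.src κ w i ≤ colourCount I.tgt κ w i

variable {I} in
/-- A balanced colouring is an output of algorithm Uniform.  A product leaves and enters the copies
given by its ranks in the two colour classes that it belongs to.  In every colour, the copies that
have only an entering product are as many as those that have only a leaving one, so that extra
products of this colour join the former to the latter. -/
theorem Balanced.uniformOutput {k : ℝ≥0} {κ : Fin m → ℕ} (h : I.Balanced (I.rhoMax k) κ) :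
    I.UniformOutput k κ := by
  obtain ⟨a, ha, hra⟩ := exists_numbering I.src h.lt h.out_ge h.out_le
  obtain ⟨b, hb, hrb⟩ := exists_numbering I.tgt h.lt h.in_ge h.in_le
  -- pairs of a colour and a copy that a product of this colour leaves or enters
  let tl : Fin m → ℕ × (Fin n × ℕ) := fun p => (κ p, (I.src p, colourRank I.src κ p))
  let hd : Fin m → ℕ × (Fin n × ℕ) := fun p => (κ p, (I.tgt p, colourRank I.tgt κ p))
  have htl : Function.Injective tl := fun p q hpq => by
    simp only [tl, Prod.mk.injEq] at hpq
    exact (colourRank_bijOn I.src κ (I.src q) (κ q)).injOn ⟨hpq.2.1, hpq.1⟩ ⟨rfl, rfl⟩ hpq.2.2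
  have hhd : Function.Injective hd := fun p q hpq => by
    simp only [hd, Prod.mk.injEq] at hpq
    exact (colourRank_bijOn I.tgt κ (I.tgt q) (κ q)).injOn ⟨hpq.2.1, hpq.1⟩ ⟨rfl, rfl⟩ hpq.2.2
  let T := Finset.univ.image tl
  let H := Finset.univ.image hd
  have hT : ∀ i w j, (i, (w, j)) ∈ T ↔ j < colourCount I.src κ w i := fun i w j => by
    have := Set.ext_iff.1 (colourRank_bijOn I.src κ w i).image_eq j
    simpa [T, tl, and_assoc, and_left_comm] using this
  have hH : ∀ i w j, (i, (w, j)) ∈ H ↔ j < colourCount I.tgt κ w i := fun i w j => by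
    have := Set.ext_iff.1 (colourRank_bijOn I.tgt κ w i).image_eq j
    simpa [H, hd, and_assoc, and_left_comm] using this
  have hTρ : ∀ x ∈ T, x.1 < I.rhoMax k := fun x hx => by
    obtain ⟨p, -, rfl⟩ := Finset.mem_image.1 hx
    exact h.lt p
  have hHρ : ∀ x ∈ H, x.1 < I.rhoMax k := fun x hx => by
    obtain ⟨p, -, rfl⟩ := Finset.mem_image.1 hx
    exact h.lt p
  -- every colour has as many tails as heads, hence as many heads that are no tails as conversely
  obtain ⟨e, he⟩ := exists_fiber_equiv (H \ T) (T \ H) (fun x => x.1) (fun x => x.1) (fun i => by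
    have h1 : ∀ A B : Finset (ℕ × (Fin n × ℕ)), (A \ B).filter (fun x => x.1 = i) =
        A.filter (fun x => x.1 = i) \ B.filter (fun x => x.1 = i) := fun A B => by
      ext x
      simp only [Finset.mem_filter, Finset.mem_sdiff]
      tauto
    rw [h1, h1]
    refine Finset.card_sdiff_comm ?_
    simp only [T, H]
    rw [Finset.filter_image, Finset.filter_image, Finset.card_image_of_injective _ htl,
      Finset.card_image_of_injective _ hhd])
  -- the extra products, and then all arcs, each with its colour
  let X : List (ℕ × ((Fin n × ℕ) × (Fin n × ℕ))) :=
    (H \ T).attach.toList.map fun x => (x.1.1, (x.1.2, (e x).1.2))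
  let F := List.ofFn (fun p => (κ p, ((tl p).2, (hd p).2))) ++ X
  let L : Arcs n := F.map Prod.snd
  have hF : F = List.ofFn (fun p => (κ p, ((tl p).2, (hd p).2))) ++ X := rfl
  have htails : F.map (fun f => (f.1, f.2.1)) =
      List.ofFn tl ++ (H \ T).attach.toList.map (fun x => x.1) := by
    simp only [hF, List.map_append, List.map_ofFn, X, List.map_map]
    rfl
  have hheads : F.map (fun f => (f.1, f.2.2)) =
      List.ofFn hd ++ (H \ T).attach.toList.map (fun x => (e x).1) := by
    simp only [hF, List.map_append, List.map_ofFn, X, List.map_map]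
    congr 1
    refine List.map_congr_left fun x _ => ?_
    exact Prod.ext (he x).symm rfl
  have hmemT : ∀ x, x ∈ F.map (fun f => (f.1, f.2.1)) ↔ x ∈ T ∪ H := fun x => by
    rw [htails]
    simp only [List.mem_append, List.mem_ofFn, List.mem_map, Finset.mem_toList, Finset.mem_attach,
      true_and, Subtype.exists, Finset.mem_union]
    simp only [T, Finset.mem_sdiff, Finset.mem_image, Finset.mem_univ, true_and]
    constructor
    · rintro (h | ⟨y, hy, rfl⟩)
      · exact Or.inl h
      · exact Or.inr hy.1
    · rintro (h | h)
      · exact Or.inl h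
      · by_cases h' : ∃ p, tl p = x
        · exact Or.inl h'
        · exact Or.inr ⟨x, ⟨h, h'⟩, rfl⟩
  have hmemH : ∀ x, x ∈ F.map (fun f => (f.1, f.2.2)) ↔ x ∈ T ∪ H := fun x => by
    rw [hheads]
    simp only [List.mem_append, List.mem_ofFn, List.mem_map, Finset.mem_toList, Finset.mem_attach,
      true_and, Finset.mem_union]
    constructor
    · rintro (⟨p, rfl⟩ | ⟨y, rfl⟩)
      · exact Or.inr (Finset.mem_image_of_mem _ (Finset.mem_univ _))
      · exact Or.inl (Finset.mem_sdiff.1 (e y).2).1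
    · intro h
      by_cases h' : x ∈ H
      · obtain ⟨p, -, hp⟩ := Finset.mem_image.1 h'
        exact Or.inl ⟨p, hp⟩
      · have h'' : x ∈ T \ H := Finset.mem_sdiff.2 ⟨h.resolve_right h', h'⟩
        exact Or.inr ⟨e.symm ⟨x, h''⟩, by simp⟩
  have hndT : (F.map (fun f => (f.1, f.2.1))).Nodup := by
    rw [htails]
    refine List.Nodup.append (List.nodup_ofFn.2 htl)
      ((Finset.nodup_toList _).map Subtype.val_injective) fun x hx hx' => ?_
    obtain ⟨y, -, rfl⟩ := List.mem_map.1 hx'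
    obtain ⟨p, hp⟩ := List.mem_ofFn.1 hx
    exact (Finset.mem_sdiff.1 y.2).2 (Finset.mem_image.2 ⟨p, Finset.mem_univ _, hp⟩)
  have hndH : (F.map (fun f => (f.1, f.2.2))).Nodup := by
    rw [hheads]
    refine List.Nodup.append (List.nodup_ofFn.2 hhd)
      ((Finset.nodup_toList _).map (Subtype.val_injective.comp e.injective)) fun x hx hx' => ?_
    obtain ⟨y, -, rfl⟩ := List.mem_map.1 hx'
    obtain ⟨p, hp⟩ := List.mem_ofFn.1 hx
    exact (Finset.mem_sdiff.1 (e y).2).2 (Finset.mem_image.2 ⟨p, Finset.mem_univ _, hp⟩)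
  have hbal : ∀ u, outDeg L u = inDeg L u := fun u => by
    have h1 := ((List.perm_ext_iff_of_nodup hndT hndH).2 fun x =>
      (hmemT x).trans (hmemH x).symm).countP_eq (fun x => decide (x.2 = u))
    simpa [List.countP_map, outDeg, inDeg, L, Function.comp_def] using h1
  have hsplit : L = I.splitDemand (I.rhoMax k) a b ++ X.map Prod.snd := by
    simp only [L, hF, List.map_append, List.map_ofFn, splitDemand, hra, hrb]
    rfl
  refine ⟨a, b, ha, hb, L, ?_, hbal, fun i => (F.map Prod.fst).getD i 0, ?_, ?_, ?_⟩
  · rw [hsplit]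
    refine extraSteps_append (by rw [← hsplit]; exact hbal) fun f hf g hg hfg => ?_
    simp only [X, List.map_map, List.mem_map, Finset.mem_toList, Finset.mem_attach, true_and]
      at hf hg
    obtain ⟨x, rfl⟩ := hf
    obtain ⟨y, rfl⟩ := hg
    simp only [Function.comp_apply] at hfg
    have hx := Finset.mem_sdiff.1 x.2
    have hy := Finset.mem_sdiff.1 (e y).2
    generalize x.1 = x' at hx hfg
    generalize (e y).1 = y' at hy hfg
    -- by the condition on the signs, a copy cannot be the tail of an extra product of colour `i` and
    -- the head of one of colour `i'`
    obtain ⟨i, w, j⟩ := x'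
    obtain ⟨i', w', j'⟩ := y'
    simp only [Prod.mk.injEq] at hfg
    obtain ⟨rfl, rfl⟩ := hfg
    have hi := hHρ _ hx.1
    have hi' := hTρ _ hy.1
    rw [hT, hH] at hx hy
    rcases le_total (I.numIn w) (I.numOut w) with hw | hw
    · have := h.surplus w i hi hw
      omega
    · have := h.deficit w i' hi' hw
      omega
  · intro i hi
    have hi' : i < F.length := by simpa [L] using hi
    have h1 : (F[i].1, F[i].2.1) ∈ T ∪ H :=
      (hmemT _).1 (List.mem_map.2 ⟨F[i], List.getElem_mem _, rfl⟩)
    simp only [List.getD_eq_getElem?_getD, List.getElem?_map, List.getElem?_eq_getElem hi',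
      Option.map_some, Option.getD_some]
    rcases Finset.mem_union.1 h1 with h2 | h2
    · exact hTρ _ h2
    · exact hHρ _ h2
  · intro i _
    have hlen : L.length = F.length := by simp [L]
    have hκ' : ∀ f : Fin L.length, (F.map Prod.fst).getD f 0 = (F[(f : ℕ)]'(hlen ▸ f.2)).1 :=
      fun f => by
        rw [List.getD_eq_getElem?_getD, List.getElem?_map,
          List.getElem?_eq_getElem (by rw [← hlen]; exact f.2)]
        rfl
    have hget : ∀ f : Fin L.length, L.get f = (F[(f : ℕ)]'(hlen ▸ f.2)).2 := fun f => by
      simp [L]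
    refine ⟨fun f hf g hg hfg => ?_, fun f hf g hg hfg => ?_, ?_⟩
    · simp only [Set.mem_ofPred_eq, hκ', hget] at hf hg hfg
      have := (List.Nodup.getElem_inj_iff hndT (i := (f : ℕ)) (j := (g : ℕ))
        (hi := by simpa [L] using f.2) (hj := by simpa [L] using g.2)).1
        (by simp only [List.getElem_map]; rw [hf, hg, hfg])
      exact Fin.ext this
    · simp only [Set.mem_ofPred_eq, hκ', hget] at hf hg hfg
      have := (List.Nodup.getElem_inj_iff hndH (i := (f : ℕ)) (j := (g : ℕ))
        (hi := by simpa [L] using f.2) (hj := by simpa [L] using g.2)).1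
        (by simp only [List.getElem_map]; rw [hf, hg, hfg])
      exact Fin.ext this
    · ext u
      have h1 := (hmemT (i, u)).trans (hmemH (i, u)).symm
      simp only [List.mem_map, Prod.mk.injEq] at h1
      simp only [Set.mem_image, Set.mem_ofPred_eq, hκ', hget]
      constructor
      · rintro ⟨f, hf, rfl⟩
        obtain ⟨g, hg, h2, h3⟩ := h1.1 ⟨_, List.getElem_mem (hlen ▸ f.2), hf, rfl⟩
        obtain ⟨j, hj, rfl⟩ := List.mem_iff_getElem.1 hg
        exact ⟨⟨j, by rw [hlen]; exact hj⟩, h2, h3⟩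
      · rintro ⟨f, hf, rfl⟩
        obtain ⟨g, hg, h2, h3⟩ := h1.2 ⟨_, List.getElem_mem (hlen ▸ f.2), hf, rfl⟩
        obtain ⟨j, hj, rfl⟩ := List.mem_iff_getElem.1 hg
        exact ⟨⟨j, by rw [hlen]; exact hj⟩, h2, h3⟩
  · intro p
    have hp : (p : ℕ) < (List.ofFn (fun p => (κ p, ((tl p).2, (hd p).2)))).length := by simp
    change κ p = (F.map Prod.fst).getD p 0
    rw [List.getD_eq_getElem?_getD, List.getElem?_map, hF, List.getElem?_append_left hp,
      List.getElem?_eq_getElem hp]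
    simp

end Realloc

namespace Realloc

variable {m n : ℕ} (I : Realloc m n)

/-! ### Products of size zero -/

theorem rounds_size_zero (a : ℕ) (d : ℝ≥0∞) : rounds 0 a d = 0 := by
  rcases eq_or_ne d 0 with rfl | hd
  · rcases Nat.eq_zero_or_pos a with rfl | ha
    · exact rounds_zero _ _
    · simp [rounds, ENNReal.div_zero (show (a : ℝ≥0∞) ≠ 0 by exact_mod_cast ha.ne')]
  · exact rounds_of_floor_top _ (by simp [ENNReal.div_zero hd])

theorem rhoMax_size_zero : I.rhoMax 0 = 1 := by
  simp [rhoMax, rounds_size_zero]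

theorem isApprox_of_size_zero (hsize : ∀ p, I.size p = 0) {φ : Fin m → ℕ} (hφ : ∀ p, φ p < 1) :
    I.IsApprox 2 φ := by
  refine ⟨⟨fun _ _ => by simp [hsize], fun _ _ => by simp [hsize], fun _ _ => by simp [hsize]⟩,
    fun ψ _ => I.completion_le_two_mul hφ fun hm => ?_⟩
  have h1 := I.transit_lt_completion ψ ⟨0, hm⟩
  have h2 := I.transit_pos ⟨0, hm⟩
  omega

/-- A balanced colouring with `ρ` colours, used as a schedule, is 2-approximate. -/
theorem Balanced.isApprox {I : Realloc m n} {k : ℝ≥0} {κ : Fin m → ℕ}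
    (h : I.Balanced (I.rhoMax k) κ) (hsize : ∀ p, I.size p = k) (hin : ∀ w, I.dIn w = ⊤) :
    I.IsApprox 2 κ := by
  rcases eq_zero_or_pos k with rfl | hk
  · exact I.isApprox_of_size_zero hsize fun p => I.rhoMax_size_zero ▸ h.lt p
  · exact I.isApprox_of_uniformOutput hk hsize hin h.uniformOutput

/-- The number of rounds, up to the maximum with `1`, in terms of the capacity `q`, i.e. the integral
capacity truncated at the number `a` of products. -/
theorem max_one_rounds {k : ℝ≥0} {a q : ℕ} {d : ℝ≥0∞} (hqa : q ≤ a)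
    (hq : 0 < a → (k : ℝ≥0∞) ≤ d) (htop : d = ⊤ → q = a) (hle : (q : ℝ≥0∞) * k ≤ d)
    (hlt : d ≠ ⊤ → q < a → d < ((q + 1 : ℕ) : ℝ≥0∞) * k) :
    max 1 (rounds k a d) = max 1 ((a + q - 1) / q) := by
  rcases Nat.eq_zero_or_pos a with rfl | ha
  · obtain rfl : q = 0 := by omega
    simp [rounds_zero]
  have hq1 : (a + a - 1) / a = 1 := by
    refine (Nat.div_eq_iff ha).2 ⟨by omega, by omega⟩
  rcases eq_zero_or_pos k with rfl | hk
  · have : q = a := by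
      by_contra h
      rcases eq_or_ne d ⊤ with hd | hd
      · exact h (htop hd)
      · simpa using hlt hd (by omega)
    subst this
    simp [rounds_size_zero, hq1]
  rcases eq_or_ne d ⊤ with hd | hd
  · obtain rfl := htop hd
    rw [rounds_of_floor_top _ (by simp [hd, ENNReal.top_div]), hq1]
    rfl
  have hfl : ⌊d / k⌋ₑ ≠ ⊤ := by
    simpa using ENNReal.div_ne_top hd (by exact_mod_cast hk.ne')
  obtain ⟨f, hf⟩ := ENat.ne_top_iff_exists.mp hfl
  have h1 := le_floor_div hk d
  rw [← hf] at h1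
  simp only [Nat.cast_le] at h1
  have hf1 : 1 ≤ f := (h1 1).2 (by simpa using hq ha)
  have hqf : q ≤ f := (h1 q).2 hle
  rcases hqa.lt_or_eq with h | rfl
  · have : f = q := by
      have h2 := (not_congr (h1 (q + 1))).2 (not_le.2 (hlt hd h))
      omega
    subst this
    congr 1
    refine eq_of_forall_ge_iff fun N => ?_
    rw [rounds_le_iff hf.symm hf1, ← Nat.lt_succ_iff (m := (a + f - 1) / f),
      Nat.div_lt_iff_lt_mul hf1, Nat.succ_mul]
    omega
  · rw [hq1]
    have : rounds k q d ≤ 1 := (rounds_le_iff hf.symm hf1 _ _).2 (by omega)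
    omega

/-! ### Reversal of time -/

/-- The instance in which every product travels from its sink to its source. -/
def rev : Realloc m n where
  size := I.size
  src := I.tgt
  tgt := I.src
  transit := I.transit
  cap := I.cap
  dOut := I.dIn
  dIn := I.dOut
  src_ne_tgt p := (I.src_ne_tgt p).symm
  transit_pos := I.transit_pos
  size_le_dOut := I.size_le_dIn
  size_le_dIn := I.size_le_dOut
  initial_le_cap := I.final_le_cap
  final_le_cap := I.initial_le_cap

variable {I}

/-- Running a feasible schedule of the reversed instance backwards gives a feasible schedule. -/
theorem Feasible.of_rev {φ ψ : Fin m → ℕ} {T : ℕ} (h : I.rev.Feasible φ)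
    (hψ : ∀ p, ψ p + φ p + I.transit p = T) : I.Feasible ψ := by
  refine ⟨fun θ w => ?_, fun θ w => ?_, fun θ w => ?_⟩
  · refine le_trans (Finset.sum_le_sum_of_subset fun p hp => ?_) (h.carry_in (T - θ) w)
    have h1 := (Finset.mem_filter.1 hp).2
    have h2 := hψ p
    exact Finset.mem_filter.2 ⟨Finset.mem_univ _, h1.1, by simp only [rev]; omega⟩
  · refine le_trans (Finset.sum_le_sum_of_subset fun p hp => ?_) (h.carry_out (T - θ) w)
    have h1 := (Finset.mem_filter.1 hp).2
    have h2 := hψ p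
    exact Finset.mem_filter.2 ⟨Finset.mem_univ _, h1.1, by omega⟩
  · rw [add_comm]
    rcases le_or_gt θ T with hθ | hθ
    · refine le_trans (add_le_add (Finset.sum_le_sum_of_subset fun p hp => ?_)
        (Finset.sum_le_sum_of_subset fun p hp => ?_)) (h.storage (T - θ) w)
      · have h1 := (Finset.mem_filter.1 hp).2
        have h2 := hψ p
        exact Finset.mem_filter.2 ⟨Finset.mem_univ _, h1.1, by omega⟩
      · have h1 := (Finset.mem_filter.1 hp).2
        have h2 := hψ p
        exact Finset.mem_filter.2 ⟨Finset.mem_univ _, h1.1, by simp only [rev]; omega⟩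
    · -- after the last arrival only the final products are stored
      rw [Finset.sum_eq_zero (s := Finset.univ.filter fun p => I.src p = w ∧ θ ≤ ψ p), add_zero]
      · refine le_trans (Finset.sum_le_sum_of_subset fun p => ?_) (I.final_le_cap w)
        simp only [Finset.mem_filter, Finset.mem_univ, true_and]
        exact fun h => h.1
      · intro p hp
        simp only [Finset.mem_filter, Finset.mem_univ, true_and] at hp
        have := hψ p
        omega

/-- The schedule that runs a 2-approximate schedule of the reversed instance backwards, so that the
first departure is at time `0` or later, is 2-approximate. -/
theorem IsApprox.of_rev {φ ψ : Fin m → ℕ} (h : I.rev.IsApprox 2 φ)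
    (hψ : ∀ p, ψ p + φ p + I.transit p = I.rev.completion φ) : I.IsApprox 2 ψ := by
  refine ⟨h.1.of_rev hψ, fun χ hχ => ?_⟩
  have h1 : I.completion ψ ≤ I.rev.completion φ :=
    Finset.sup_le fun p _ => by have := hψ p; omega
  have h2 : ∀ p, χ p + I.transit p ≤ I.completion χ := I.transit_lt_completion χ
  have h3 := h.2 (fun p => I.completion χ - (χ p + I.transit p))
    (Feasible.of_rev (I := I.rev) (φ := χ) (T := I.completion χ) hχ fun p => by
      have := h2 p
      simp only [rev]
      omega)
  have h4 : I.rev.completion (fun p => I.completion χ - (χ p + I.transit p)) ≤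
      I.completion χ := Finset.sup_le fun p _ => by
    have := h2 p
    simp only [rev]
    omega
  omega

end Realloc

/-! ### Rooted spanning trees given by parent pointers -/

namespace Rounding

/-- `Path par r a l`: following the parent pointers from `a` one reaches `r` after visiting exactly
the nodes of the list `l` (which contains `a` unless `a = r`, and does not contain `r`). -/
def Path (par : ℕ → ℕ) (r : ℕ) : ℕ → List ℕ → Prop
  | a, [] => a = r
  | a, b :: l => b = a ∧ a ≠ r ∧ Path par r (par a) l

variable {par par' parc tl hd : ℕ → ℕ} {r a b N : ℕ}

theorem Path.unique {l l' : List ℕ} (h : Path par r a l) (h' : Path par r a l') : l = l' := by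
  induction l generalizing a l' with
  | nil =>
    cases l' with
    | nil => rfl
    | cons b l' => exact absurd h h'.2.1
  | cons b l ih =>
    cases l' with
    | nil => exact absurd h' h.2.1
    | cons b' l' => rw [h.1, h'.1, ih h.2.2 h'.2.2]

theorem Path.congr {l : List ℕ} (h : Path par r a l) (hpar : ∀ x, x ≠ r → par' x = par x) :
    Path par' r a l := by
  induction l generalizing a with
  | nil => exact h
  | cons b l ih =>
    obtain ⟨rfl, h1, h2⟩ := h
    exact ⟨rfl, h1, by rw [hpar _ h1]; exact ih h2⟩

theorem Path.ne_root {l : List ℕ} (h : Path par r a l) : ∀ x ∈ l, x ≠ r := by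
  induction l generalizing a with
  | nil => simp
  | cons b l ih =>
    obtain ⟨rfl, h1, h2⟩ := h
    simpa using ⟨h1, ih h2⟩

/-- The nodes on a path have shorter and shorter paths to the root. -/
theorem Path.suffix {l : List ℕ} (h : Path par r a l) :
    ∀ x ∈ l, ∃ l', Path par r x l' ∧ l'.length ≤ l.length := by
  induction l generalizing a with
  | nil => simp
  | cons b l ih =>
    intro x hx
    rcases List.mem_cons.1 hx with rfl | hx
    · exact ⟨x :: l, by obtain ⟨rfl, h1, h2⟩ := h; exact ⟨rfl, h1, h2⟩, le_rfl⟩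
    · obtain ⟨l', h1, h2⟩ := ih h.2.2 x hx
      exact ⟨l', h1, h2.trans (by simp)⟩

theorem Path.nodup {l : List ℕ} (h : Path par r a l) : l.Nodup := by
  induction l generalizing a with
  | nil => simp
  | cons b l ih =>
    refine List.nodup_cons.2 ⟨fun hb => ?_, ih h.2.2⟩
    obtain ⟨l', h1, h2⟩ := Path.suffix h.2.2 b hb
    obtain ⟨rfl, h3, h4⟩ := h
    have := Path.unique h1 (l' := b :: l) ⟨rfl, h3, h4⟩
    simp [this] at h2

theorem Path.par_ne {l : List ℕ} (h : Path par r a l) (ha : a ≠ r) : par a ≠ a := by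
  intro h1
  cases l with
  | nil => exact ha h
  | cons b l =>
    obtain ⟨rfl, h2, h3⟩ := h
    rw [h1] at h3
    have := Path.unique h3 (l' := b :: l) ⟨rfl, h2, by rwa [h1]⟩
    simp at this

theorem Path.mem_lt {l : List ℕ} (hpar : ∀ x < N, x ≠ r → par x < N) (ha : a < N)
    (h : Path par r a l) : ∀ x ∈ l, x < N := by
  induction l generalizing a with
  | nil => simp
  | cons b l ih =>
    obtain ⟨rfl, h1, h2⟩ := h
    simpa using ⟨ha, ih (hpar _ ha h1) h2⟩

theorem Path.length_le {l : List ℕ} (hpar : ∀ x < N, x ≠ r → par x < N) (ha : a < N)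
    (h : Path par r a l) : l.length ≤ N := by
  have := Finset.card_le_card (s := l.toFinset) (t := Finset.range N) fun x hx => by
    simpa using h.mem_lt hpar ha x (by simpa using hx)
  rwa [List.toFinset_card_of_nodup h.nodup, Finset.card_range] at this

/-- If only the pointer of the root is changed and the old root reaches `b`, then all nodes reach
`b`. -/
theorem Path.redirect {l l₀ : List ℕ} (hpar : ∀ x, x ≠ r → par' x = par x)
    (h₀ : Path par' b r l₀) (h : Path par r a l) : ∃ l', Path par' b a l' := by
  induction l generalizing a with
  | nil => exact ⟨l₀, by rw [show a = r from h]; exact h₀⟩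
  | cons x l ih =>
    obtain ⟨rfl, h1, h2⟩ := h
    by_cases hx : x = b
    · exact ⟨[], hx⟩
    · obtain ⟨l', h'⟩ := ih h2
      exact ⟨x :: l', rfl, hx, by rwa [hpar x h1]⟩

/-- If only the pointer of the root is changed, then a node whose path passes `b` still reaches `b`.
-/
theorem Path.until_first {l : List ℕ} (hpar : ∀ x, x ≠ r → par' x = par x) (h : Path par r a l)
    (hb : b ∈ l) : ∃ l', Path par' b a l' := by
  induction l generalizing a with
  | nil => simp at hb
  | cons x l ih =>
    obtain ⟨rfl, h1, h2⟩ := h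
    by_cases hx : x = b
    · exact ⟨[], hx⟩
    · obtain ⟨l', h'⟩ := ih h2 ((List.mem_cons.1 hb).resolve_left (Ne.symm hx))
      exact ⟨x :: l', rfl, hx, by rwa [hpar x h1]⟩

/-- A spanning tree on the nodes `0, …, N - 1` with root `r`: the node `a ≠ r` is joined to its
parent `par a` by the arc `parc a`, which belongs to `A` and may have either direction. -/
structure Spanning (N : ℕ) (tl hd : ℕ → ℕ) (A : Finset ℕ) (par parc : ℕ → ℕ) (r : ℕ) : Prop where
  root_lt : r < N
  par_lt : ∀ a < N, a ≠ r → par a < N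
  path : ∀ a < N, ∃ l, Path par r a l
  arc : ∀ a < N, a ≠ r → (tl (parc a) = a ∧ hd (parc a) = par a) ∨
    (hd (parc a) = a ∧ tl (parc a) = par a)
  inj : ∀ a < N, ∀ b < N, a ≠ r → b ≠ r → parc a = parc b → a = b
  mem : ∀ a < N, a ≠ r → parc a ∈ A

/-- The arcs of the spanning tree. -/
def TreeArc (N : ℕ) (parc : ℕ → ℕ) (r e : ℕ) : Prop := ∃ a < N, a ≠ r ∧ parc a = e

variable {A : Finset ℕ}

/-- Moving the root to one of its children. -/
theorem Spanning.flip (h : Spanning N tl hd A par parc r) (hb : b < N) (hbr : b ≠ r)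
    (hpar : par b = r) :
    Spanning N tl hd A (Function.update par r b) (Function.update parc r (parc b)) b := by
  refine ⟨hb, fun a ha hab => ?_, fun a ha => ?_, fun a ha hab => ?_, fun a ha x hx hab hxb => ?_,
    fun a ha hab => ?_⟩
  · rw [Function.update_apply]
    split_ifs with h1
    · exact hb
    · exact h.par_lt a ha h1
  · obtain ⟨l, hl⟩ := h.path a ha
    exact Path.redirect (fun x hx => Function.update_of_ne hx _ _) (l₀ := [r])
      ⟨rfl, hbr.symm, by simp [Path]⟩ hl
  · rcases eq_or_ne a r with rfl | h1
    · simp only [Function.update_self]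
      rcases h.arc b hb hbr with h2 | h2
      · exact Or.inr ⟨h2.2.trans hpar, h2.1⟩
      · exact Or.inl ⟨h2.2.trans hpar, h2.1⟩
    · simp only [Function.update_of_ne h1]
      exact h.arc a ha h1
  · rcases eq_or_ne a r with rfl | h1 <;> rcases eq_or_ne x a with rfl | h2
    · exact fun _ => rfl
    · simp only [Function.update_self, Function.update_of_ne h2]
      exact fun h3 => absurd (h.inj b hb x hx hbr h2 h3).symm hxb
    · exact fun _ => rfl
    · simp only [Function.update_of_ne h1]
      rcases eq_or_ne x r with rfl | h3
      · simp only [Function.update_self]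
        exact fun h3 => absurd (h.inj a ha b hb h1 hbr h3) hab
      · simp only [Function.update_of_ne h3]
        exact h.inj a ha x hx h1 h3
  · rcases eq_or_ne a r with rfl | h1
    · simp only [Function.update_self]
      exact h.mem b hb hbr
    · simp only [Function.update_of_ne h1]
      exact h.mem a ha h1

theorem treeArc_flip (hr : r < N) (hb : b < N) (hbr : b ≠ r) (e : ℕ) :
    TreeArc N (Function.update parc r (parc b)) b e ↔ TreeArc N parc r e := by
  constructor
  · rintro ⟨a, ha, hab, rfl⟩
    rcases eq_or_ne a r with rfl | h1
    · exact ⟨b, hb, hbr, by simp⟩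
    · exact ⟨a, ha, h1, by simp [h1]⟩
  · rintro ⟨a, ha, har, rfl⟩
    rcases eq_or_ne a b with rfl | h1
    · exact ⟨r, hr, hbr.symm, by simp⟩
    · exact ⟨a, ha, h1, by simp [har]⟩

/-- Adding the arc `e` from `u` to the root `v` closes a cycle; deleting the pointer of any node `b`
of the cycle gives a spanning tree with root `b`. -/
theorem Spanning.exchange {u v e : ℕ} {l : List ℕ} (h : Spanning N tl hd A par parc v) (hu : u < N)
    (huv : u ≠ v) (htl : tl e = u) (hhd : hd e = v) (he : e ∉ A) (hl : Path par v u l)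
    (hb : b ∈ v :: l) :
    Spanning N tl hd (insert e A) (Function.update par v u) (Function.update parc v e) b := by
  have hb' : b < N := by
    rcases List.mem_cons.1 hb with rfl | hb
    · exact h.root_lt
    · exact hl.mem_lt h.par_lt hu _ hb
  have hpar : ∀ x, x ≠ v → Function.update par v u x = par x := fun x hx =>
    Function.update_of_ne hx _ _
  refine ⟨hb', fun a ha hab => ?_, fun a ha => ?_, fun a ha hab => ?_, fun a ha x hx hab hxb => ?_,
    fun a ha hab => ?_⟩
  · rw [Function.update_apply]
    split_ifs with h1
    · exact hu
    · exact h.par_lt a ha h1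
  · obtain ⟨l', hl'⟩ := h.path a ha
    -- the old root `v` reaches `b` along the cycle, which it enters at `u`
    have h₀ : ∃ l₀, Path (Function.update par v u) b v l₀ := by
      by_cases hbv : v = b
      · exact ⟨[], hbv⟩
      · obtain ⟨l₀, h₀⟩ := hl.until_first hpar ((List.mem_cons.1 hb).resolve_left (Ne.symm hbv))
        exact ⟨v :: l₀, rfl, hbv, by rwa [Function.update_self]⟩
    obtain ⟨l₀, h₀⟩ := h₀
    exact Path.redirect hpar h₀ hl'
  · rcases eq_or_ne a v with rfl | h1
    · simp only [Function.update_self]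
      exact Or.inr ⟨hhd, htl⟩
    · simp only [Function.update_of_ne h1]
      exact h.arc a ha h1
  · rcases eq_or_ne a v with rfl | h1 <;> rcases eq_or_ne x a with rfl | h2
    · exact fun _ => rfl
    · simp only [Function.update_self, Function.update_of_ne h2]
      exact fun h3 => absurd (h.mem x hx h2) (h3 ▸ he)
    · exact fun _ => rfl
    · simp only [Function.update_of_ne h1]
      rcases eq_or_ne x v with rfl | h3
      · simp only [Function.update_self]
        exact fun h3 => absurd (h.mem a ha h1) (h3 ▸ he)
      · simp only [Function.update_of_ne h3]
        exact h.inj a ha x hx h1 h3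
  · rcases eq_or_ne a v with rfl | h1
    · simp
    · simp only [Function.update_of_ne h1]
      exact Finset.mem_insert_of_mem (h.mem a ha h1)

/-- After the exchange, the only new non-tree arc is the one of `b`. -/
theorem treeArc_exchange {v e : ℕ} (hv : v < N) {f : ℕ} (hf : f ∈ insert e A)
    (h : ¬ TreeArc N (Function.update parc v e) b f) :
    f = Function.update parc v e b ∨ (f ∈ A ∧ ¬ TreeArc N parc v f) := by
  by_contra hcon
  push Not at hcon
  obtain ⟨h1, h2⟩ := hcon
  have h3 : f = e ∨ TreeArc N parc v f := by
    rcases Finset.mem_insert.1 hf with h | h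
    · exact Or.inl h
    · exact Or.inr (h2 h)
  refine h ?_
  rcases h3 with rfl | ⟨a, ha, hav, rfl⟩
  · refine ⟨v, hv, fun hvb => h1 (by simp [hvb]), by simp⟩
  · refine ⟨a, ha, fun hab => h1 (by simp [← hab, hav]), by simp [hav]⟩

/-! ### Fractional circulations -/

/-- Inflow minus outflow of the node `z`. -/
def net (tl hd : ℕ → ℕ) (A : Finset ℕ) (x : ℕ → ℕ) (z : ℕ) : ℤ :=
  ∑ e ∈ A, ((if hd e = z then (x e : ℤ) else 0) - if tl e = z then (x e : ℤ) else 0)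

theorem net_update {x : ℕ → ℕ} {f y : ℕ} (hf : f ∈ A) (z : ℕ) :
    net tl hd A (Function.update x f y) z = net tl hd A x z +
      ((if hd f = z then (1 : ℤ) else 0) - if tl f = z then 1 else 0) * ((y : ℤ) - x f) := by
  unfold net
  rw [← Finset.add_sum_erase A _ hf, ← Finset.add_sum_erase A _ hf]
  have : ∀ e ∈ A.erase f, Function.update x f y e = x e := fun e he =>
    Function.update_of_ne (Finset.ne_of_mem_erase he) _ _
  rw [Finset.sum_congr rfl fun e he => by rw [this e he]]
  simp only [Function.update_self]
  split_ifs <;> ring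

/-- Pushing `δ` units along the tree arc of `a`, from the parent of `a` to `a`. -/
def pushStep (hd parc : ℕ → ℕ) (δ : ℕ) (x : ℕ → ℕ) (a : ℕ) : ℕ → ℕ :=
  Function.update x (parc a) (if hd (parc a) = a then x (parc a) + δ else x (parc a) - δ)

/-- The amount that can be pushed along the tree arc of `a`. -/
def slack (hd parc ub x : ℕ → ℕ) (a : ℕ) : ℕ :=
  if hd (parc a) = a then ub (parc a) - x (parc a) else x (parc a)

/-- One step of the search for a node with smallest slack. -/
def scanStep (hd parc ub x : ℕ → ℕ) (s : ℕ × ℕ) (a : ℕ) : ℕ × ℕ :=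
  if slack hd parc ub x a < s.1 then (slack hd parc ub x a, a) else s

variable {ub x : ℕ → ℕ} {δ : ℕ}

theorem scan_spec (l : List ℕ) (s : ℕ × ℕ) :
    (l.foldl (scanStep hd parc ub x) s).1 ≤ s.1 ∧
    (∀ a ∈ l, (l.foldl (scanStep hd parc ub x) s).1 ≤ slack hd parc ub x a) ∧
    (l.foldl (scanStep hd parc ub x) s = s ∨ ∃ a ∈ l,
      l.foldl (scanStep hd parc ub x) s = (slack hd parc ub x a, a)) := by
  induction l generalizing s with
  | nil => simp
  | cons a l ih =>
    obtain ⟨h1, h2, h3⟩ := ih (scanStep hd parc ub x s a)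
    have h4 : (scanStep hd parc ub x s a).1 ≤ s.1 ∧
        (scanStep hd parc ub x s a).1 ≤ slack hd parc ub x a := by
      unfold scanStep
      split_ifs with h <;> simp <;> omega
    rw [List.foldl_cons]
    refine ⟨h1.trans h4.1, ?_, ?_⟩
    · simpa using ⟨h1.trans h4.2, h2⟩
    · rcases h3 with h3 | ⟨y, hy, h3⟩
      · rw [h3]
        by_cases h : slack hd parc ub x a < s.1
        · exact Or.inr ⟨a, by simp, by simp [scanStep, h]⟩
        · exact Or.inl (by simp [scanStep, h])
      · exact Or.inr ⟨y, by simp [hy], h3⟩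

theorem push_of_notMem (l : List ℕ) {f : ℕ} (hf : ∀ a ∈ l, parc a ≠ f) :
    l.foldl (pushStep hd parc δ) x f = x f := by
  induction l generalizing x with
  | nil => rfl
  | cons a l ih =>
    rw [List.foldl_cons, ih fun b hb => hf b (by simp [hb])]
    exact Function.update_of_ne (Ne.symm (hf a (by simp))) _ _

theorem push_of_mem (l : List ℕ) (hl : (l.map parc).Nodup) (ha : a ∈ l) :
    l.foldl (pushStep hd parc δ) x (parc a) =
      if hd (parc a) = a then x (parc a) + δ else x (parc a) - δ := by
  induction l generalizing x with
  | nil => simp at ha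
  | cons b l ih =>
    rw [List.map_cons, List.nodup_cons] at hl
    rw [List.foldl_cons]
    rcases List.mem_cons.1 ha with rfl | ha
    · rw [push_of_notMem l fun c hc h => hl.1 (List.mem_map.2 ⟨c, hc, h⟩)]
      simp [pushStep]
    · rw [ih hl.2 ha]
      have : parc a ≠ parc b := fun h => hl.1 (List.mem_map.2 ⟨a, ha, h⟩)
      simp [pushStep, this]

theorem net_pushStep {p : ℕ} (hA : parc a ∈ A) (hap : a ≠ p)
    (harc : (tl (parc a) = a ∧ hd (parc a) = p) ∨ (hd (parc a) = a ∧ tl (parc a) = p))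
    (hδ : hd (parc a) ≠ a → δ ≤ x (parc a)) (z : ℕ) :
    net tl hd A (pushStep hd parc δ x a) z =
      net tl hd A x z + δ * ((if a = z then 1 else 0) - if p = z then 1 else 0) := by
  rw [pushStep, net_update hA]
  rcases harc with ⟨h1, h2⟩ | ⟨h1, h2⟩
  · have h3 : hd (parc a) ≠ a := by rw [h2]; exact hap.symm
    rw [if_neg h3, h1, h2, Nat.cast_sub (hδ h3)]
    ring
  · rw [if_pos h1, h1, h2]
    push_cast
    ring

/-- Pushing along a path only changes the balances of its end nodes. -/
theorem net_push {l : List ℕ} (hl : Path par r a l) (hinj : (l.map parc).Nodup)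
    (hA : ∀ y ∈ l, parc y ∈ A) (hne : ∀ y ∈ l, y ≠ par y)
    (harc : ∀ y ∈ l, (tl (parc y) = y ∧ hd (parc y) = par y) ∨
      (hd (parc y) = y ∧ tl (parc y) = par y))
    (hδ : ∀ y ∈ l, hd (parc y) ≠ y → δ ≤ x (parc y)) (z : ℕ) :
    net tl hd A (l.foldl (pushStep hd parc δ) x) z =
      net tl hd A x z + δ * ((if a = z then 1 else 0) - if r = z then 1 else 0) := by
  induction l generalizing a x with
  | nil =>
    rw [show a = r from hl]
    simp
  | cons y l ih =>
    obtain ⟨rfl, h1, h2⟩ := hl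
    rw [List.map_cons, List.nodup_cons] at hinj
    rw [List.foldl_cons, ih h2 hinj.2 (fun y hy => hA y (by simp [hy]))
      (fun y hy => hne y (by simp [hy])) (fun y hy => harc y (by simp [hy])),
      net_pushStep (hA y (by simp)) (hne y (by simp)) (harc y (by simp)) (hδ y (by simp))]
    · ring
    · intro b hb hb'
      have : parc b ≠ parc y := fun h => hinj.1 (List.mem_map.2 ⟨b, hb, h⟩)
      rw [pushStep, Function.update_of_ne this]
      exact hδ b (by simp [hb]) hb'

/-- The invariant of the rounding procedure: `x` is a circulation up to the prescribed balances
`bal`, respects the upper bounds `ub` on all arcs `A`, and on the arcs of `D` (those processed so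
far) that do not belong to the spanning tree it attains its lower or its upper bound. -/
structure Rounded (N : ℕ) (tl hd : ℕ → ℕ) (A D : Finset ℕ) (ub : ℕ → ℕ) (bal : ℕ → ℤ)
    (x par parc : ℕ → ℕ) (r : ℕ) : Prop where
  tree : Spanning N tl hd D par parc r
  sub : D ⊆ A
  le : ∀ e ∈ A, x e ≤ ub e
  int : ∀ e ∈ D, ¬ TreeArc N parc r e → x e = 0 ∨ x e = ub e
  net_eq : ∀ z, net tl hd A x z = bal z

variable {D : Finset ℕ} {bal : ℕ → ℤ}

theorem Rounded.flip (h : Rounded N tl hd A D ub bal x par parc r) (hb : b < N) (hbr : b ≠ r)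
    (hpar : par b = r) :
    Rounded N tl hd A D ub bal x (Function.update par r b) (Function.update parc r (parc b)) b :=
  ⟨h.tree.flip hb hbr hpar, h.sub, h.le,
    fun e he he' => h.int e he fun h' => he' ((treeArc_flip h.tree.root_lt hb hbr e).2 h'),
    h.net_eq⟩

/-- One arc `e` from `u` to the root `v` is processed: flow is pushed around the cycle that it
closes, until an arc attains one of its bounds and can be removed from the cycle. -/
theorem Rounded.insert {u v e : ℕ} {l : List ℕ} (h : Rounded N tl hd A D ub bal x par parc v)
    (hu : u < N) (huv : u ≠ v) (htl : tl e = u) (hhd : hd e = v) (he : e ∉ D) (heA : e ∈ A)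
    (hl : Path par v u l) (s : ℕ × ℕ)
    (hs : s = l.foldl (scanStep hd (Function.update parc v e) ub x) (ub e - x e, v)) :
    Rounded N tl hd A (insert e D) ub bal
      (l.foldl (pushStep hd (Function.update parc v e) s.1) (Function.update x e (x e + s.1)))
      (Function.update par v u) (Function.update parc v e) s.2 := by
  have hlv : ∀ a ∈ l, a ≠ v := hl.ne_root
  have hlN : ∀ a ∈ l, a < N := hl.mem_lt h.tree.par_lt hu
  have hparc : ∀ a ∈ l, Function.update parc v e a = parc a := fun a ha =>
    Function.update_of_ne (hlv a ha) _ _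
  have hlD : ∀ a ∈ l, parc a ∈ D := fun a ha => h.tree.mem a (hlN a ha) (hlv a ha)
  have hle : ∀ a ∈ l, parc a ≠ e := fun a ha h' => he (h' ▸ hlD a ha)
  have hnd : ((v :: l).map (Function.update parc v e)).Nodup := by
    rw [List.map_cons, List.nodup_cons, List.map_congr_left hparc]
    refine ⟨?_, ?_⟩
    · simp only [Function.update_self, List.mem_map, not_exists, not_and]
      exact hle
    · exact List.Nodup.map_on (fun a ha b hb hab => h.tree.inj a (hlN a ha) b (hlN b hb) (hlv a ha)
        (hlv b hb) hab) hl.nodup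
  have hnd' : (l.map parc).Nodup := by
    rw [List.map_cons, List.nodup_cons, List.map_congr_left hparc] at hnd
    exact hnd.2
  have hresv : slack hd (Function.update parc v e) ub x v = ub e - x e := by
    simp [slack, hhd]
  obtain ⟨h1, h2, h3⟩ := scan_spec (hd := hd) (parc := Function.update parc v e) (ub := ub) (x := x)
    l (ub e - x e, v)
  rw [← hs] at h1 h2 h3
  have hs2 : s.2 ∈ v :: l ∧ s.1 = slack hd (Function.update parc v e) ub x s.2 := by
    rcases h3 with h3 | ⟨a, ha, h3⟩
    · rw [h3]
      exact ⟨by simp, hresv.symm⟩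
    · rw [h3]
      exact ⟨by simp [ha], rfl⟩
  have hres : ∀ a ∈ v :: l, s.1 ≤ slack hd (Function.update parc v e) ub x a := by
    intro a ha
    rcases List.mem_cons.1 ha with rfl | ha
    · rw [hresv]; exact h1
    · exact h2 a ha
  -- pushing along `e` is the same as pushing along the tree arc of `v`
  have hfold : l.foldl (pushStep hd (Function.update parc v e) s.1)
      (Function.update x e (x e + s.1)) =
      (v :: l).foldl (pushStep hd (Function.update parc v e) s.1) x := by
    simp [pushStep, hhd]
  have hon : ∀ a ∈ v :: l, (v :: l).foldl (pushStep hd (Function.update parc v e) s.1) x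
      (Function.update parc v e a) = if hd (Function.update parc v e a) = a then
        x (Function.update parc v e a) + s.1 else x (Function.update parc v e a) - s.1 :=
    fun a ha => push_of_mem _ hnd ha
  have hoff : ∀ f, (∀ a ∈ v :: l, Function.update parc v e a ≠ f) →
      (v :: l).foldl (pushStep hd (Function.update parc v e) s.1) x f = x f :=
    fun f hf => push_of_notMem _ hf
  have hmemA : ∀ a ∈ v :: l, Function.update parc v e a ∈ A := by
    intro a ha
    rcases List.mem_cons.1 ha with rfl | ha
    · simpa using heA
    · rw [hparc a ha]
      exact h.sub (hlD a ha)
  refine ⟨h.tree.exchange hu huv htl hhd he hl hs2.1, ?_, ?_, ?_, ?_⟩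
  · exact Finset.insert_subset heA h.sub
  · intro f hf
    rw [hfold]
    by_cases hcyc : ∃ a ∈ v :: l, Function.update parc v e a = f
    · obtain ⟨a, ha, rfl⟩ := hcyc
      rw [hon a ha]
      have h4 := h.le _ (hmemA a ha)
      have h5 := hres a ha
      rw [slack] at h5
      split_ifs with h6
      · rw [if_pos h6] at h5
        omega
      · omega
    · push Not at hcyc
      rw [hoff f hcyc]
      exact h.le f hf
  · intro f hf hft
    rw [hfold]
    by_cases hcyc : ∃ a ∈ v :: l, Function.update parc v e a = f
    · obtain ⟨a, ha, rfl⟩ := hcyc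
      -- an arc of the cycle outside the new tree is the one with smallest slack
      rcases treeArc_exchange h.tree.root_lt hf hft with h4 | ⟨h4, h5⟩
      · rw [h4, hon _ hs2.1]
        have h5 := hs2.2
        have h6 := h.le _ (hmemA _ hs2.1)
        rw [slack] at h5
        split_ifs with h7
        · rw [if_pos h7] at h5
          omega
        · rw [if_neg h7] at h5
          omega
      · rcases List.mem_cons.1 ha with rfl | ha
        · simp only [Function.update_self] at h4
          exact absurd h4 he
        · exact absurd ⟨a, hlN a ha, hlv a ha, (hparc a ha).symm⟩ h5
    · have h6 : f ≠ Function.update parc v e s.2 := fun h' => hcyc ⟨s.2, hs2.1, h'.symm⟩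
      push Not at hcyc
      rw [hoff f hcyc]
      obtain ⟨h4, h5⟩ := (treeArc_exchange h.tree.root_lt hf hft).resolve_left h6
      exact h.int f h4 h5
  · intro z
    rw [net_push (r := v) (par := par) (a := u) hl (by rw [List.map_congr_left hparc]; exact hnd')
      (fun y hy => hmemA y (by simp [hy]))
      (fun y hy => ?_) (fun y hy => ?_) (fun y hy hy' => ?_), net_update heA, htl, hhd, h.net_eq]
    · push_cast
      ring
    · obtain ⟨l', hl'⟩ := h.tree.path y (hlN y hy)
      exact (hl'.par_ne (hlv y hy)).symm
    · rw [hparc y hy]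
      exact h.tree.arc y (hlN y hy) (hlv y hy)
    · have h4 := h2 y hy
      rw [slack, if_neg hy'] at h4
      rw [hparc y hy] at h4 ⊢
      rwa [Function.update_of_ne (hle y hy)]

/-- If all arcs are processed and all balances are multiples of `c`, then so are the values on all
arcs: a leaf of the tree of arcs with other values would have a wrong balance. -/
theorem Rounded.dvd {c : ℕ} (h : Rounded N tl hd A A ub bal x par parc r)
    (hub : ∀ e ∈ A, ub e = 0 ∨ ub e = c) (hbal : ∀ z, (c : ℤ) ∣ bal z) :
    ∀ e ∈ A, c ∣ x e := by
  have hnt : ∀ e ∈ A, ¬ TreeArc N parc r e → c ∣ x e := fun e he het => by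
    rcases h.int e he het with h1 | h1 <;> rcases hub e he with h2 | h2 <;> rw [h1]
    · simp
    · simp
    · simp [h2]
    · simp [h2]
  -- the nodes are treated by decreasing distance from the root
  have key : ∀ j a l, a < N → a ≠ r → Path par r a l → N ≤ l.length + j → c ∣ x (parc a) := by
    intro j
    induction j with
    | zero =>
      intro a l ha har hl hN
      -- together with the root, the path would have more than `N` nodes
      exfalso
      have h1 := Finset.card_le_card (s := (r :: l).toFinset) (t := Finset.range N) fun y hy => by
        simp only [List.mem_toFinset, List.mem_cons] at hy
        rw [Finset.mem_range]
        rcases hy with rfl | hy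
        · exact h.tree.root_lt
        · exact hl.mem_lt h.tree.par_lt ha y hy
      rw [List.toFinset_card_of_nodup (List.nodup_cons.2 ⟨fun h' => hl.ne_root r h' rfl, hl.nodup⟩),
        Finset.card_range, List.length_cons] at h1
      omega
    | succ j ih =>
      intro a l ha har hl hN
      have h1 := h.net_eq a
      have hA := h.tree.mem a ha har
      have hne := hl.par_ne har
      rw [net, ← Finset.add_sum_erase A _ hA] at h1
      have h2 : (c : ℤ) ∣ ∑ e ∈ A.erase (parc a),
          ((if hd e = a then (x e : ℤ) else 0) - if tl e = a then (x e : ℤ) else 0) := by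
        refine Finset.dvd_sum fun e he => ?_
        obtain ⟨he1, he2⟩ := Finset.mem_erase.1 he
        have h3 : (hd e = a ∨ tl e = a) → c ∣ x e := by
          intro h3
          by_cases het : TreeArc N parc r e
          · obtain ⟨a', ha', har', rfl⟩ := het
            have h4 : a' ≠ a := fun h' => he1 (by rw [h'])
            have h5 : par a' = a := by
              rcases h.tree.arc a' ha' har' with ⟨h5, h6⟩ | ⟨h5, h6⟩ <;> rw [h5, h6] at h3
              · exact h3.resolve_right h4
              · exact h3.resolve_left h4
            refine ih a' (a' :: l) ha' har' ⟨rfl, har', by rwa [h5]⟩ ?_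
            rw [List.length_cons]
            omega
          · exact hnt e he2 het
        refine dvd_sub ?_ ?_
        · split_ifs with h4
          · exact_mod_cast h3 (Or.inl h4)
          · simp
        · split_ifs with h4
          · exact_mod_cast h3 (Or.inr h4)
          · simp
      -- all arcs at `a` but the one to its parent are known to be divisible
      have h3 := (Int.dvd_add_left h2).1 (h1 ▸ hbal a)
      rcases h.tree.arc a ha har with ⟨h5, h6⟩ | ⟨h5, h6⟩
      · rw [if_neg (by rw [h6]; exact hne), if_pos h5, zero_sub, dvd_neg] at h3
        exact_mod_cast h3
      · rw [if_pos h5, if_neg (by rw [h6]; exact hne), sub_zero] at h3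
        exact_mod_cast h3
  intro e he
  by_cases het : TreeArc N parc r e
  · obtain ⟨a, ha, har, rfl⟩ := het
    obtain ⟨l, hl⟩ := h.tree.path a ha
    exact key N a l ha har hl (by omega)
  · exact hnt e he het

end Rounding

namespace Rounding

/-! ### Halving a colour class -/

/-- The number of products in `G` at the warehouse `w`, where `s` is the map to sources or the map
to sinks. -/
def count (s : ℕ → ℕ) (G : Finset ℕ) (w : ℕ) : ℕ := (G.filter fun p => s p = w).card

/-- The products `G` are a fair share for `c` of `ρ` colours, where `s p`, `d p` are the source and
the sink of `p`, and `o w`, `r w` the numbers of all products leaving and entering `w`: they can be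
expected to split further into `c` classes each of which is balanced. -/
structure Share (n : ℕ) (s d o r : ℕ → ℕ) (ρ c : ℕ) (G : Finset ℕ) : Prop where
  out_ge : ∀ w < n, c * (o w / ρ) ≤ count s G w
  out_le : ∀ w < n, count s G w ≤ c * (o w / ρ + 1)
  in_ge : ∀ w < n, c * (r w / ρ) ≤ count d G w
  in_le : ∀ w < n, count d G w ≤ c * (r w / ρ + 1)
  surplus : ∀ w < n, r w ≤ o w → count d G w ≤ count s G w
  deficit : ∀ w < n, o w ≤ r w → count s G w ≤ count d G w

theorem round_ge {c c₁ o o₁ L : ℤ} (hc : 0 < c) (hc₁ : 0 ≤ c₁) (h : |c * o₁ - c₁ * o| < c)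
    (hL : c * L ≤ o) : c₁ * L ≤ o₁ := by
  by_contra hcon
  push Not at hcon
  have h1 : c * (o₁ + 1) ≤ c * (c₁ * L) := mul_le_mul_of_nonneg_left hcon hc.le
  have h2 : c₁ * (c * L) ≤ c₁ * o := mul_le_mul_of_nonneg_left hL hc₁
  have h3 := (abs_lt.1 h).1
  nlinarith

theorem round_le {c c₁ o o₁ U : ℤ} (hc : 0 < c) (hc₁ : 0 ≤ c₁) (h : |c * o₁ - c₁ * o| < c)
    (hU : o ≤ c * U) : o₁ ≤ c₁ * U := by
  by_contra hcon
  push Not at hcon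
  have h1 : c * (c₁ * U + 1) ≤ c * o₁ := mul_le_mul_of_nonneg_left hcon hc.le
  have h2 : c₁ * o ≤ c₁ * (c * U) := mul_le_mul_of_nonneg_left hU hc₁
  have h3 := (abs_lt.1 h).2
  nlinarith

variable {n : ℕ} {s d o r : ℕ → ℕ} {ρ c c₁ : ℕ} {G G₁ : Finset ℕ}

/-- A set `G₁` that contains about `c₁/c` of the products of `G`, in each of the three ways to count
them at a warehouse, is a fair share for `c₁` colours: integral bounds survive rounding. -/
theorem Share.half (h : Share n s d o r ρ c G) (hc : 0 < c)
    (hout : ∀ w < n, |(c : ℤ) * count s G₁ w - c₁ * count s G w| < c)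
    (hin : ∀ w < n, |(c : ℤ) * count d G₁ w - c₁ * count d G w| < c)
    (hdiff : ∀ w < n, |(c : ℤ) * (count s G₁ w - count d G₁ w) -
      c₁ * (count s G w - count d G w)| < c) : Share n s d o r ρ c₁ G₁ := by
  have hc' : (0 : ℤ) < c := by exact_mod_cast hc
  have hc₁ : (0 : ℤ) ≤ c₁ := by positivity
  refine ⟨fun w hw => ?_, fun w hw => ?_, fun w hw => ?_, fun w hw => ?_, fun w hw hw' => ?_,
    fun w hw hw' => ?_⟩
  · have := round_ge hc' hc₁ (hout w hw) (L := (o w / ρ : ℕ)) (by exact_mod_cast h.out_ge w hw)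
    exact_mod_cast this
  · have := round_le hc' hc₁ (hout w hw) (U := (o w / ρ + 1 : ℕ)) (by exact_mod_cast h.out_le w hw)
    exact_mod_cast this
  · have := round_ge hc' hc₁ (hin w hw) (L := (r w / ρ : ℕ)) (by exact_mod_cast h.in_ge w hw)
    exact_mod_cast this
  · have := round_le hc' hc₁ (hin w hw) (U := (r w / ρ + 1 : ℕ)) (by exact_mod_cast h.in_le w hw)
    exact_mod_cast this
  · have h1 := h.surplus w hw hw'
    have := round_ge hc' hc₁ (hdiff w hw) (L := 0) (by omega)
    omega
  · have h1 := h.deficit w hw hw'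
    have := round_le hc' hc₁ (hdiff w hw) (U := 0) (by omega)
    omega

theorem count_add_count_sdiff (hG : G₁ ⊆ G) (w : ℕ) :
    count s G₁ w + count s (G \ G₁) w = count s G w := by
  unfold count
  rw [← Finset.card_union_of_disjoint
    (Finset.disjoint_filter_filter Finset.disjoint_sdiff), ← Finset.filter_union,
    Finset.union_sdiff_of_subset hG]

/-- Rounding the `c₁/c`-th part of a fair share for `c` colours splits it into fair shares for `c₁`
and for `c - c₁` colours. -/
theorem Share.split (h : Share n s d o r ρ c G) (hc : 0 < c) (hc₁ : c₁ ≤ c) (hG : G₁ ⊆ G)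
    (hout : ∀ w < n, |(c : ℤ) * count s G₁ w - c₁ * count s G w| < c)
    (hin : ∀ w < n, |(c : ℤ) * count d G₁ w - c₁ * count d G w| < c)
    (hdiff : ∀ w < n, |(c : ℤ) * (count s G₁ w - count d G₁ w) -
      c₁ * (count s G w - count d G w)| < c) :
    Share n s d o r ρ c₁ G₁ ∧ Share n s d o r ρ (c - c₁) (G \ G₁) := by
  refine ⟨h.half hc hout hin hdiff, h.half hc (fun w hw => ?_) (fun w hw => ?_) (fun w hw => ?_)⟩
  · have h1 := hout w hw
    have h2 : ((count s G₁ w : ℤ) + count s (G \ G₁) w) = count s G w := by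
      exact_mod_cast count_add_count_sdiff hG w
    rw [← abs_neg] at h1
    convert h1 using 2
    rw [← h2]
    push_cast [hc₁]
    ring
  · have h1 := hin w hw
    have h2 : ((count d G₁ w : ℤ) + count d (G \ G₁) w) = count d G w := by
      exact_mod_cast count_add_count_sdiff hG w
    rw [← abs_neg] at h1
    convert h1 using 2
    rw [← h2]
    push_cast [hc₁]
    ring
  · have h1 := hdiff w hw
    have h2 : ((count s G₁ w : ℤ) + count s (G \ G₁) w) = count s G w := by
      exact_mod_cast count_add_count_sdiff hG w
    have h3 : ((count d G₁ w : ℤ) + count d (G \ G₁) w) = count d G w := by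
      exact_mod_cast count_add_count_sdiff hG w
    rw [← abs_neg] at h1
    convert h1 using 2
    rw [← h2, ← h3]
    push_cast [hc₁]
    ring

/-! ### The network of a colour class -/

/-- The network: the nodes `w`, `n + w`, `n + n + w` for `w < n` represent the products entering
`w`, the products leaving `w`, and the whole warehouse; `n + n + n` is an auxiliary node.  The arcs
`w`, `n + w`, `n + n + w` carry the products entering `w`, the products leaving `w`, and the
difference of these two numbers; the arc `n + n + n + p` carries the product `p`. -/
structure Network (m n : ℕ) (s d tl hd : ℕ → ℕ) : Prop where
  tl_in : ∀ w < n, tl w = w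
  hd_in : ∀ w < n, hd w = n + n + w
  tl_out : ∀ w < n, tl (n + w) = n + n + w
  hd_out : ∀ w < n, hd (n + w) = n + w
  tl_mid : ∀ w < n, tl (n + n + w) = n + n + n
  hd_mid : ∀ w < n, hd (n + n + w) = n + n + w
  tl_prod : ∀ p < m, tl (n + n + n + p) = n + s p
  hd_prod : ∀ p < m, hd (n + n + n + p) = d p
  s_lt : ∀ p < m, s p < n
  d_lt : ∀ p < m, d p < n

/-- The arcs needed for the set `G` of products. -/
def arcs (n : ℕ) (G : Finset ℕ) : Finset ℕ :=
  Finset.range (n + n + n) ∪ G.image fun p => n + n + n + p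

theorem mem_arcs_prod {p : ℕ} : n + n + n + p ∈ arcs n G ↔ p ∈ G := by
  simp [arcs]

theorem sum_arcs (g : ℕ → ℤ) :
    ∑ e ∈ arcs n G, g e = ∑ w ∈ Finset.range n, (g w + g (n + w) + g (n + n + w)) +
      ∑ p ∈ G, g (n + n + n + p) := by
  rw [arcs, Finset.sum_union, Finset.sum_range_add, Finset.sum_range_add, Finset.sum_image]
  · rw [← Finset.sum_add_distrib, ← Finset.sum_add_distrib]
  · intro a _ b _ h
    simpa using h
  · rw [Finset.disjoint_left]
    intro e he he'
    obtain ⟨p, -, rfl⟩ := Finset.mem_image.1 he'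
    simp at he

variable {m : ℕ} {tl hd x x' ub : ℕ → ℕ}

theorem Network.net_in (h : Network m n s d tl hd) (hG : ∀ p ∈ G, p < m) {w : ℕ} (hw : w < n) :
    net tl hd (arcs n G) x w = -(x w : ℤ) + ∑ p ∈ G with d p = w, (x (n + n + n + p) : ℤ) := by
  rw [net, sum_arcs, Finset.sum_eq_single_of_mem w (Finset.mem_range.2 hw), Finset.sum_filter]
  · congr 1
    · rw [h.hd_in w hw, h.tl_in w hw, h.hd_out w hw, h.tl_out w hw, h.hd_mid w hw, h.tl_mid w hw]
      repeat rw [if_neg (by omega)]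
      simp
      repeat rw [if_neg (by omega)]
      simp
    · refine Finset.sum_congr rfl fun p hp => ?_
      rw [h.hd_prod p (hG p hp), h.tl_prod p (hG p hp), if_neg (c := n + s p = w) (by omega),
        sub_zero]
  · intro v hv hvw
    rw [Finset.mem_range] at hv
    rw [h.hd_in v hv, h.tl_in v hv, h.hd_out v hv, h.tl_out v hv, h.hd_mid v hv, h.tl_mid v hv]
    repeat rw [if_neg (by omega)]
    simp

theorem Network.net_out (h : Network m n s d tl hd) (hG : ∀ p ∈ G, p < m) {w : ℕ} (hw : w < n) :
    net tl hd (arcs n G) x (n + w) =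
      (x (n + w) : ℤ) - ∑ p ∈ G with s p = w, (x (n + n + n + p) : ℤ) := by
  rw [net, sum_arcs, Finset.sum_eq_single_of_mem w (Finset.mem_range.2 hw), Finset.sum_filter,
    sub_eq_add_neg (x (n + w) : ℤ), ← Finset.sum_neg_distrib]
  · congr 1
    · rw [h.hd_in w hw, h.tl_in w hw, h.hd_out w hw, h.tl_out w hw, h.hd_mid w hw, h.tl_mid w hw,
        if_pos (c := n + w = n + w) rfl, if_neg (c := n + n + w = n + w) (by omega),
        if_neg (c := n + n + w = n + w) (by omega),
        if_neg (c := n + n + w = n + w) (by omega), if_neg (c := n + n + n = n + w) (by omega),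
        if_neg (c := w = n + w) (by omega)]
      simp
    · refine Finset.sum_congr rfl fun p hp => ?_
      have := h.d_lt p (hG p hp)
      rw [h.hd_prod p (hG p hp), h.tl_prod p (hG p hp), if_neg (c := d p = n + w) (by omega)]
      simp
  · intro v hv hvw
    rw [Finset.mem_range] at hv
    rw [h.hd_in v hv, h.tl_in v hv, h.hd_out v hv, h.tl_out v hv, h.hd_mid v hv, h.tl_mid v hv]
    repeat rw [if_neg (by omega)]
    simp

theorem Network.net_mid (h : Network m n s d tl hd) (hG : ∀ p ∈ G, p < m) {w : ℕ} (hw : w < n) :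
    net tl hd (arcs n G) x (n + n + w) =
      (x w : ℤ) - x (n + w) + x (n + n + w) := by
  rw [net, sum_arcs, Finset.sum_eq_single_of_mem w (Finset.mem_range.2 hw), Finset.sum_eq_zero,
    add_zero]
  · rw [h.hd_in w hw, h.tl_in w hw, h.hd_out w hw, h.tl_out w hw, h.hd_mid w hw, h.tl_mid w hw,
      if_pos rfl, if_pos rfl, if_pos rfl, if_neg (c := w = n + n + w) (by omega),
      if_neg (c := n + w = n + n + w) (by omega), if_neg (c := n + n + n = n + n + w) (by omega)]
    ring
  · intro p hp
    have := h.d_lt p (hG p hp)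
    have := h.s_lt p (hG p hp)
    rw [h.hd_prod p (hG p hp), h.tl_prod p (hG p hp)]
    repeat rw [if_neg (by omega)]
    simp
  · intro v hv hvw
    rw [Finset.mem_range] at hv
    rw [h.hd_in v hv, h.tl_in v hv, h.hd_out v hv, h.tl_out v hv, h.hd_mid v hv, h.tl_mid v hv]
    repeat rw [if_neg (by omega)]
    simp

theorem Network.net_root (h : Network m n s d tl hd) (hG : ∀ p ∈ G, p < m) {z : ℕ}
    (hz : n + n + n ≤ z) :
    net tl hd (arcs n G) x z =
      if z = n + n + n then -∑ w ∈ Finset.range n, (x (n + n + w) : ℤ) else 0 := by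
  rw [net, sum_arcs, Finset.sum_eq_zero (s := G), add_zero]
  · have h1 : ∀ w ∈ Finset.range n, (((if hd w = z then (x w : ℤ) else 0) -
        if tl w = z then (x w : ℤ) else 0) + ((if hd (n + w) = z then (x (n + w) : ℤ) else 0) -
        if tl (n + w) = z then (x (n + w) : ℤ) else 0) +
        ((if hd (n + n + w) = z then (x (n + n + w) : ℤ) else 0) -
        if tl (n + n + w) = z then (x (n + n + w) : ℤ) else 0)) =
        if z = n + n + n then -(x (n + n + w) : ℤ) else 0 := by
      intro w hw
      rw [Finset.mem_range] at hw
      rw [h.hd_in w hw, h.tl_in w hw, h.hd_out w hw, h.tl_out w hw, h.hd_mid w hw, h.tl_mid w hw,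
        if_neg (c := n + n + w = z) (by omega), if_neg (c := n + n + w = z) (by omega),
        if_neg (c := n + n + w = z) (by omega), if_neg (c := n + w = z) (by omega),
        if_neg (c := w = z) (by omega)]
      by_cases hz' : z = n + n + n
      · rw [if_pos hz'.symm, if_pos hz']
        ring
      · rw [if_neg (Ne.symm hz'), if_neg hz']
        ring
    rw [Finset.sum_congr rfl h1]
    split_ifs
    · rw [Finset.sum_neg_distrib]
    · simp
  · intro p hp
    have := h.d_lt p (hG p hp)
    have := h.s_lt p (hG p hp)
    rw [h.hd_prod p (hG p hp), h.tl_prod p (hG p hp)]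
    repeat rw [if_neg (by omega)]
    simp

/-- The initial values: the fraction `c₁/c` of every product in `G` is selected, and the arcs of the
warehouses carry the fractional parts of the resulting sums.  All values are multiplied by `c`. -/
structure Initial (n : ℕ) (s d : ℕ → ℕ) (c c₁ : ℕ) (G : Finset ℕ) (x ub : ℕ → ℕ) : Prop where
  prod : ∀ p ∈ G, x (n + n + n + p) = c₁ ∧ ub (n + n + n + p) = c
  x_in : ∀ w < n, x w = c₁ * count d G w % c
  x_out : ∀ w < n, x (n + w) = c₁ * count s G w % c
  x_mid : ∀ w < n, x (n + n + w) =
    if x w ≤ x (n + w) then x (n + w) - x w else x (n + w) + c - x w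
  ub_eq : ∀ e < n + n + n, ub e = if x e = 0 then 0 else c

theorem Initial.lt (h : Initial n s d c c₁ G x ub) (hc : 0 < c) {e : ℕ} (he : e < n + n + n) :
    x e < c := by
  have h1 : ∀ w < n, x w < c := fun w hw => by
    rw [h.x_in w hw]; exact Nat.mod_lt _ hc
  have h2 : ∀ w < n, x (n + w) < c := fun w hw => by
    rw [h.x_out w hw]; exact Nat.mod_lt _ hc
  rcases lt_or_ge e n with h3 | h3
  · exact h1 e h3
  rcases lt_or_ge e (n + n) with h4 | h4
  · have := h2 (e - n) (by omega)
    rwa [Nat.add_sub_cancel' h3] at this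
  · have h5 := h.x_mid (e - (n + n)) (by omega)
    have h6 := h1 (e - (n + n)) (by omega)
    have h7 := h2 (e - (n + n)) (by omega)
    rw [Nat.add_sub_cancel' h4] at h5
    rw [h5]
    split_ifs <;> omega

theorem dvd_sub_mod (a c : ℕ) : (c : ℤ) ∣ (a : ℤ) - (a % c : ℕ) := by
  rw [Int.natCast_mod]
  exact Int.dvd_self_sub_emod

theorem sum_count (s : ℕ → ℕ) (hs : ∀ p ∈ G, s p < n) :
    ∑ w ∈ Finset.range n, count s G w = G.card :=
  (Finset.card_eq_sum_card_fiberwise fun p hp => by simpa using hs p hp).symm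

theorem Initial.dvd_bal (h : Initial n s d c c₁ G x ub) (hN : Network m n s d tl hd)
    (hG : ∀ p ∈ G, p < m) (hc : 0 < c) (z : ℕ) : (c : ℤ) ∣ net tl hd (arcs n G) x z := by
  have hin : ∀ w < n, (c : ℤ) ∣ c₁ * count d G w - x w := fun w hw => by
    rw [h.x_in w hw]
    exact_mod_cast dvd_sub_mod (c₁ * count d G w) c
  have hout : ∀ w < n, (c : ℤ) ∣ c₁ * count s G w - x (n + w) := fun w hw => by
    rw [h.x_out w hw]
    exact_mod_cast dvd_sub_mod (c₁ * count s G w) c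
  have hmid : ∀ w < n, (c : ℤ) ∣ (x w : ℤ) - x (n + w) + x (n + n + w) := fun w hw => by
    have h1 := h.x_mid w hw
    split_ifs at h1
    · rw [h1]
      have : (x w : ℤ) - x (n + w) + (x (n + w) - x w : ℕ) = 0 := by omega
      rw [this]
      exact dvd_zero _
    · have h2 := h.lt hc (e := w) (by omega)
      have : (x w : ℤ) - x (n + w) + x (n + n + w) = c := by omega
      rw [this]
  have hsum : (c : ℤ) ∣ ∑ w ∈ Finset.range n, (x (n + n + w) : ℤ) := by
    have h1 : (c : ℤ) ∣ ∑ w ∈ Finset.range n, ((x (n + n + w) : ℤ) -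
        (c₁ * count s G w - c₁ * count d G w)) := by
      refine Finset.dvd_sum fun w hw => ?_
      rw [Finset.mem_range] at hw
      have h2 := dvd_add (dvd_sub (hmid w hw) (hout w hw)) (hin w hw)
      convert h2 using 1
      ring
    have h2 : ∑ w ∈ Finset.range n, (count s G w : ℤ) = ∑ w ∈ Finset.range n, (count d G w : ℤ) := by
      have h3 := sum_count (n := n) s fun p hp => hN.s_lt p (hG p hp)
      have h4 := sum_count (n := n) d fun p hp => hN.d_lt p (hG p hp)
      exact_mod_cast h3.trans h4.symm
    rw [Finset.sum_sub_distrib, Finset.sum_sub_distrib, ← Finset.mul_sum, ← Finset.mul_sum, h2,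
      sub_self, sub_zero] at h1
    exact h1
  rcases lt_or_ge z n with h1 | h1
  · rw [hN.net_in hG h1, Finset.sum_congr rfl fun p hp => by
      rw [(h.prod p (Finset.mem_filter.1 hp).1).1], Finset.sum_const, nsmul_eq_mul]
    refine (hin z h1).trans (dvd_of_eq ?_)
    unfold count
    ring
  rcases lt_or_ge z (n + n) with h2 | h2
  · obtain ⟨w, rfl⟩ := Nat.exists_eq_add_of_le h1
    have hw : w < n := by omega
    rw [hN.net_out hG hw, Finset.sum_congr rfl fun p hp => by
      rw [(h.prod p (Finset.mem_filter.1 hp).1).1], Finset.sum_const, nsmul_eq_mul, ← dvd_neg]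
    refine (hout w hw).trans (dvd_of_eq ?_)
    unfold count
    ring
  rcases lt_or_ge z (n + n + n) with h3 | h3
  · obtain ⟨w, rfl⟩ := Nat.exists_eq_add_of_le h2
    rw [hN.net_mid hG (by omega)]
    exact hmid w (by omega)
  · rw [hN.net_root hG h3]
    split_ifs
    · exact (dvd_neg).2 hsum
    · exact dvd_zero _

/-- After rounding, the products whose arc carries `c` form a fair share for `c₁` colours and the
others, whose arc carries `0`, one for `c - c₁` colours. -/
theorem Initial.share (h : Initial n s d c c₁ G x ub) (hN : Network m n s d tl hd)
    (hG : ∀ p ∈ G, p < m) (hc : 0 < c) (hc₁ : c₁ ≤ c) {par parc : ℕ → ℕ} {root : ℕ}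
    (hR : Rounded (n + n + n + 1) tl hd (arcs n G) (arcs n G) ub (net tl hd (arcs n G) x) x' par
      parc root) (hS : Share n s d o r ρ c G) :
    Share n s d o r ρ c₁ (G.filter fun p => x' (n + n + n + p) ≠ 0) ∧
      Share n s d o r ρ (c - c₁) (G.filter fun p => x' (n + n + n + p) = 0) := by
  have hub : ∀ e ∈ arcs n G, ub e = 0 ∨ ub e = c := by
    intro e he
    rcases Finset.mem_union.1 he with he | he
    · rw [h.ub_eq e (Finset.mem_range.1 he)]
      split_ifs <;> simp
    · obtain ⟨p, hp, rfl⟩ := Finset.mem_image.1 he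
      exact Or.inr (h.prod p hp).2
  have hval : ∀ e ∈ arcs n G, x' e = 0 ∨ x' e = c := by
    intro e he
    obtain ⟨j, hj⟩ := hR.dvd hub (fun z => h.dvd_bal hN hG hc z) e he
    have h1 : x' e ≤ c := (hR.le e he).trans (by rcases hub e he with h | h <;> omega)
    rcases Nat.eq_zero_or_pos j with rfl | h2
    · exact Or.inl (by simpa using hj)
    · have := Nat.le_mul_of_pos_right c h2
      exact Or.inr (by omega)
  -- on the arcs of the warehouses, rounding changes the value by less than one unit, i.e. by less
  -- than `c`; here it matters that arcs with value `0` have the upper bound `0`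
  have hslack : ∀ e < n + n + n, |(x' e : ℤ) - x e| < c := by
    intro e he
    have h1 : e ∈ arcs n G := Finset.mem_union_left _ (Finset.mem_range.2 he)
    have h2 := h.lt hc he
    have h3 := h.ub_eq e he
    have h4 := hR.le e h1
    rw [abs_lt]
    rcases hval e h1 with h5 | h5
    · constructor <;> omega
    · split_ifs at h3
      · constructor <;> omega
      · constructor <;> omega
  have hcount : ∀ f : ℕ → ℕ, ∀ w, ∑ p ∈ G with f p = w, (x' (n + n + n + p) : ℤ) =
      c * count f (G.filter fun p => x' (n + n + n + p) ≠ 0) w := by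
    intro f w
    have h1 : ∀ p ∈ G.filter (fun p => f p = w), (x' (n + n + n + p) : ℤ) =
        if x' (n + n + n + p) ≠ 0 then (c : ℤ) else 0 := by
      intro p hp
      rcases hval _ (mem_arcs_prod.2 (Finset.mem_filter.1 hp).1) with h2 | h2 <;> rw [h2]
      · simp
      · simp [hc.ne']
    rw [Finset.sum_congr rfl h1, ← Finset.sum_filter, Finset.sum_const, nsmul_eq_mul, mul_comm,
      count, Finset.filter_filter, Finset.filter_filter]
    simp only [and_comm]
  have hcount₀ : ∀ f : ℕ → ℕ, ∀ w, ∑ p ∈ G with f p = w, (x (n + n + n + p) : ℤ) =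
      c₁ * count f G w := by
    intro f w
    rw [Finset.sum_congr rfl fun p hp => by rw [(h.prod p (Finset.mem_filter.1 hp).1).1],
      Finset.sum_const, nsmul_eq_mul, count]
    ring
  have hin : ∀ w < n, (c : ℤ) * count d (G.filter fun p => x' (n + n + n + p) ≠ 0) w -
      c₁ * count d G w = x' w - x w := by
    intro w hw
    have h1 := hR.net_eq w
    rw [hN.net_in hG hw, hN.net_in hG hw, hcount, hcount₀] at h1
    linarith
  have hout : ∀ w < n, (c : ℤ) * count s (G.filter fun p => x' (n + n + n + p) ≠ 0) w -
      c₁ * count s G w = x' (n + w) - x (n + w) := by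
    intro w hw
    have h1 := hR.net_eq (n + w)
    rw [hN.net_out hG hw, hN.net_out hG hw, hcount, hcount₀] at h1
    linarith
  have hsplit := hS.split hc hc₁ (Finset.filter_subset (fun p => x' (n + n + n + p) ≠ 0) G)
    (fun w hw => by rw [hout w hw]; exact hslack _ (by omega))
    (fun w hw => by rw [hin w hw]; exact hslack _ (by omega))
    (fun w hw => by
      have h1 := hR.net_eq (n + n + w)
      rw [hN.net_mid hG hw, hN.net_mid hG hw] at h1
      have h2 := hslack (n + n + w) (by omega)
      rw [← abs_neg] at h2 ⊢
      convert h2 using 2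
      linarith [hin w hw, hout w hw])
  refine ⟨hsplit.1, ?_⟩
  convert hsplit.2 using 1
  ext p
  simp only [Finset.mem_filter, Finset.mem_sdiff]
  tauto

/-- The tree with which the rounding procedure starts consists of the arcs of the warehouses. -/
theorem Initial.rounded (h : Initial n s d c c₁ G x ub) (hN : Network m n s d tl hd)
    (hc : 0 < c) (hc₁ : c₁ ≤ c) {par parc : ℕ → ℕ}
    (hpar_in : ∀ w < n, par w = n + n + w) (hpar_out : ∀ w < n, par (n + w) = n + n + w)
    (hpar_mid : ∀ w < n, par (n + n + w) = n + n + n) (hparc : ∀ e < n + n + n, parc e = e) :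
    Rounded (n + n + n + 1) tl hd (arcs n G) (Finset.range (n + n + n)) ub
      (net tl hd (arcs n G) x) x par parc (n + n + n) := by
  have hcases : ∀ a < n + n + n + 1, a ≠ n + n + n → a < n + n + n ∧
      (par a = n + n + n ∧ tl a = par a ∧ hd a = a ∨
        (n + n ≤ par a ∧ par a < n + n + n ∧ par (par a) = n + n + n) ∧
          (tl a = a ∧ hd a = par a ∨ hd a = a ∧ tl a = par a)) := by
    intro a ha har
    refine ⟨by omega, ?_⟩
    rcases lt_or_ge a n with h1 | h1
    · rw [hpar_in a h1, hN.tl_in a h1, hN.hd_in a h1, hpar_mid a h1]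
      exact Or.inr ⟨⟨by omega, by omega, rfl⟩, Or.inl ⟨rfl, rfl⟩⟩
    rcases lt_or_ge a (n + n) with h2 | h2
    · obtain ⟨w, rfl⟩ := Nat.exists_eq_add_of_le h1
      have hw : w < n := by omega
      rw [hpar_out w hw, hN.tl_out w hw, hN.hd_out w hw, hpar_mid w hw]
      exact Or.inr ⟨⟨by omega, by omega, rfl⟩, Or.inr ⟨rfl, rfl⟩⟩
    · obtain ⟨w, rfl⟩ := Nat.exists_eq_add_of_le h2
      have hw : w < n := by omega
      rw [hpar_mid w hw, hN.tl_mid w hw, hN.hd_mid w hw]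
      exact Or.inl ⟨rfl, rfl, rfl⟩
  refine ⟨⟨by omega, ?_, ?_, ?_, ?_, ?_⟩, Finset.subset_union_left, ?_, ?_, fun _ => rfl⟩
  · intro a ha har
    rcases (hcases a ha har).2 with h1 | h1 <;> omega
  · intro a ha
    by_cases har : a = n + n + n
    · exact ⟨[], har⟩
    rcases (hcases a ha har).2 with h1 | h1
    · exact ⟨[a], rfl, har, h1.1⟩
    · exact ⟨[a, par a], rfl, har, rfl, by omega, h1.1.2.2⟩
  · intro a ha har
    obtain ⟨h1, h2⟩ := hcases a ha har
    rw [hparc a h1]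
    tauto
  · intro a ha b hb har hbr hab
    rwa [hparc a (hcases a ha har).1, hparc b (hcases b hb hbr).1] at hab
  · intro a ha har
    have h1 := (hcases a ha har).1
    rw [hparc a h1]
    exact Finset.mem_range.2 h1
  · intro e he
    rcases Finset.mem_union.1 he with he | he
    · have h1 := h.lt hc (Finset.mem_range.1 he)
      rw [h.ub_eq e (Finset.mem_range.1 he)]
      split_ifs <;> omega
    · obtain ⟨p, hp, rfl⟩ := Finset.mem_image.1 he
      rw [(h.prod p hp).1, (h.prod p hp).2]
      exact hc₁
  · intro e he het
    rw [Finset.mem_range] at he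
    exact absurd ⟨e, by omega, by omega, hparc e he⟩ het

end Rounding

namespace RAM

/-! ### Reasoning about programs -/

/-- Started with memory `σ`, the program `c` halts within `T` time units, with a memory that
satisfies `Q`. -/
def Runs (c : Prog) (σ : Store) (T : ℕ) (Q : Store → Prop) : Prop :=
  ∃ σ' t, Exec c σ σ' t ∧ t ≤ T ∧ Q σ'

variable {c d : Prog} {b : Test} {σ σ' : Store} {T T₁ T₂ : ℕ} {Q R : Store → Prop}

theorem Runs.mono (h : Runs c σ T₁ R) (hT : T₁ ≤ T) (hQ : ∀ σ', R σ' → Q σ') : Runs c σ T Q := by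
  obtain ⟨σ', t, h1, h2, h3⟩ := h
  exact ⟨σ', t, h1, h2.trans hT, hQ σ' h3⟩

theorem Runs.seq (h : Runs c σ T₁ R) (hd : ∀ σ', R σ' → Runs d σ' T₂ Q) :
    Runs (.seq c d) σ (T₁ + T₂) Q := by
  obtain ⟨σ', t, h1, h2, h3⟩ := h
  obtain ⟨σ'', t', h1', h2', h3'⟩ := hd σ' h3
  exact ⟨σ'', t + t', .seq h1 h1', by omega, h3'⟩

theorem Runs.ite_true (hb : b.Holds σ) (h : Runs c σ T Q) : Runs (.ite b c d) σ (b.cost + T) Q := by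
  obtain ⟨σ', t, h1, h2, h3⟩ := h
  exact ⟨σ', _, .ite_true hb h1, by omega, h3⟩

theorem Runs.ite_false (hb : ¬ b.Holds σ) (h : Runs d σ T Q) :
    Runs (.ite b c d) σ (b.cost + T) Q := by
  obtain ⟨σ', t, h1, h2, h3⟩ := h
  exact ⟨σ', _, .ite_false hb h1, by omega, h3⟩

theorem Runs.loop_exit (hb : ¬ b.Holds σ) (h : Q σ) : Runs (.loop b c) σ b.cost Q :=
  ⟨σ, _, .loop_false hb, le_rfl, h⟩

theorem Runs.loop_step (hb : b.Holds σ) (h : Runs c σ T₁ R)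
    (hl : ∀ σ', R σ' → Runs (.loop b c) σ' T₂ Q) : Runs (.loop b c) σ (b.cost + T₁ + T₂) Q := by
  obtain ⟨σ', t, h1, h2, h3⟩ := h
  obtain ⟨σ'', t', h1', h2', h3'⟩ := hl σ' h3
  exact ⟨σ'', _, .loop_true hb h1 h1', by omega, h3'⟩

/-- The integer arrays that a program may change. -/
def Prog.writes : Prog → List ℕ
  | .setNat a _ _ => [a]
  | .seq c d => c.writes ++ d.writes
  | .ite _ c d => c.writes ++ d.writes
  | .loop _ c => c.writes
  | _ => []

/-- The real arrays that a program may change. -/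
def Prog.writesReal : Prog → List ℕ
  | .setReal a _ _ => [a]
  | .seq c d => c.writesReal ++ d.writesReal
  | .ite _ c d => c.writesReal ++ d.writesReal
  | .loop _ c => c.writesReal
  | _ => []

/-- The memories `σ` and `σ'` agree except for the arrays that `c` may change. -/
structure Keeps (c : Prog) (σ σ' : Store) : Prop where
  nat : ∀ a ∉ c.writes, σ'.nat a = σ.nat a
  real : ∀ a ∉ c.writesReal, σ'.real a = σ.real a

theorem Keeps.refl (c : Prog) (σ : Store) : Keeps c σ σ := ⟨fun _ _ => rfl, fun _ _ => rfl⟩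

theorem Keeps.trans {c : Prog} {σ σ' σ'' : Store} (h : Keeps c σ σ') (h' : Keeps c σ' σ'') :
    Keeps c σ σ'' :=
  ⟨fun a ha => (h'.nat a ha).trans (h.nat a ha), fun a ha => (h'.real a ha).trans (h.real a ha)⟩

theorem Keeps.mono {c d : Prog} {σ σ' : Store} (h : Keeps c σ σ') (h₁ : c.writes ⊆ d.writes)
    (h₂ : c.writesReal ⊆ d.writesReal) : Keeps d σ σ' :=
  ⟨fun a ha => h.nat a fun h' => ha (h₁ h'), fun a ha => h.real a fun h' => ha (h₂ h')⟩

theorem Exec.keeps {c : Prog} {σ σ' : Store} {t : ℕ} (h : Exec c σ σ' t) : Keeps c σ σ' := by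
  induction h with
  | skip σ => exact Keeps.refl _ _
  | setNat a i e σ =>
    refine ⟨fun a' ha => ?_, fun _ _ => rfl⟩
    have : a' ≠ a := by simpa [Prog.writes] using ha
    simp [Store.setNat, this]
  | setReal a i e σ =>
    refine ⟨fun _ _ => rfl, fun a' ha => ?_⟩
    have : a' ≠ a := by simpa [Prog.writesReal] using ha
    simp [Store.setReal, this]
  | seq _ _ ih₁ ih₂ =>
    exact (ih₁.mono (List.subset_append_left _ _) (List.subset_append_left _ _)).trans
      (ih₂.mono (List.subset_append_right _ _) (List.subset_append_right _ _))
  | ite_true _ _ ih =>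
    exact ih.mono (List.subset_append_left _ _) (List.subset_append_left _ _)
  | ite_false _ _ ih =>
    exact ih.mono (List.subset_append_right _ _) (List.subset_append_right _ _)
  | loop_false _ => exact Keeps.refl _ _
  | loop_true _ _ _ ih₁ ih₂ =>
    exact Keeps.trans ⟨ih₁.nat, ih₁.real⟩ ih₂

theorem Runs.keeps (h : Runs c σ T Q) : Runs c σ T fun σ' => Keeps c σ σ' ∧ Q σ' := by
  obtain ⟨σ', t, h1, h2, h3⟩ := h
  exact ⟨σ', t, h1, h2, h1.keeps, h3⟩

/-- A loop that consumes a list, with one iteration per element. -/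
theorem Runs.loop_list {α : Type*} {Inv : List α → Store → Prop} (T : ℕ) (l : List α)
    (h : Inv l σ)
    (hstep : ∀ a l τ, Keeps c σ τ → Inv (a :: l) τ → b.Holds τ ∧ Runs c τ T (Inv l))
    (hexit : ∀ τ, Keeps c σ τ → Inv [] τ → ¬ b.Holds τ ∧ Q τ) :
    Runs (.loop b c) σ (l.length * (b.cost + T) + b.cost) Q := by
  have key : ∀ τ, Keeps c σ τ → Inv l τ →
      Runs (.loop b c) τ (l.length * (b.cost + T) + b.cost) Q := by
    clear h
    induction l with
    | nil =>
      intro τ hτ h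
      obtain ⟨h1, h2⟩ := hexit τ hτ h
      exact (Runs.loop_exit h1 h2).mono (by simp) fun _ h => h
    | cons a l ih =>
      intro τ hτ h
      obtain ⟨h1, h2⟩ := hstep a l τ hτ h
      refine (Runs.loop_step h1 h2.keeps fun σ' h' => ih σ' (hτ.trans h'.1) h'.2).mono ?_
        fun _ h => h
      rw [List.length_cons]
      ring_nf
      exact le_rfl
  exact key σ (Keeps.refl c σ) h

/-- A loop with a counter that runs from `0` to `N`. -/
theorem Runs.loop_up {Inv : ℕ → Store → Prop} (T N : ℕ) (h : Inv 0 σ)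
    (hstep : ∀ i < N, ∀ τ, Keeps c σ τ → Inv i τ → b.Holds τ ∧ Runs c τ T (Inv (i + 1)))
    (hexit : ∀ τ, Keeps c σ τ → Inv N τ → ¬ b.Holds τ ∧ Q τ) :
    Runs (.loop b c) σ (N * (b.cost + T) + b.cost) Q := by
  have := Runs.loop_list (b := b) (c := c) (σ := σ) (Q := Q)
    (Inv := fun (l : List ℕ) τ => l.length ≤ N ∧ Inv (N - l.length) τ) T (List.range N)
    (by simpa using h) (fun a l τ hτ h => ?_) fun τ hτ h => hexit τ hτ (by simpa using h.2)
  · simpa using this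
  · obtain ⟨h1, h2⟩ := h
    rw [List.length_cons] at h1 h2
    obtain ⟨h3, h4⟩ := hstep _ (by omega) τ hτ h2
    refine ⟨h3, h4.mono le_rfl fun σ' h => ⟨by omega, ?_⟩⟩
    rwa [show N - (l.length + 1) + 1 = N - l.length by omega] at h

/-- A loop with a counter that runs from `N` down to `0`. -/
theorem Runs.loop_down {Inv : ℕ → Store → Prop} (T N : ℕ) (h : Inv N σ)
    (hstep : ∀ i < N, ∀ τ, Keeps c σ τ → Inv (i + 1) τ → b.Holds τ ∧ Runs c τ T (Inv i))
    (hexit : ∀ τ, Keeps c σ τ → Inv 0 τ → ¬ b.Holds τ ∧ Q τ) :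
    Runs (.loop b c) σ (N * (b.cost + T) + b.cost) Q :=
  Runs.loop_up (Inv := fun i => Inv (N - i)) T N h
    (fun i hi τ hτ h => by
      rw [show N - i = N - (i + 1) + 1 by omega] at h
      exact hstep _ (by omega) τ hτ h)
    fun τ hτ h => hexit τ hτ (by rwa [Nat.sub_self] at h)

/-- Programs without loops. -/
def Prog.isFlat : Prog → Bool
  | .seq c d => c.isFlat && d.isFlat
  | .ite _ c d => c.isFlat && d.isFlat
  | .loop _ _ => false
  | _ => true

/-- The effect of a program without loops (loops are ignored). -/
def Prog.run : Prog → Store → Store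
  | .skip, σ => σ
  | .setNat a i e, σ => σ.setNat a (i.eval σ) (e.eval σ)
  | .setReal a i e, σ => σ.setReal a (i.eval σ) (e.eval σ)
  | .seq c d, σ => d.run (c.run σ)
  | .ite b c d, σ => open Classical in if b.Holds σ then c.run σ else d.run σ
  | .loop _ _, σ => σ

/-- The largest number of time units that a program without loops may need. -/
def Prog.bound : Prog → ℕ
  | .skip => 1
  | .setNat _ i e => i.cost + e.cost + 1
  | .setReal _ i e => i.cost + e.cost + 1
  | .seq c d => c.bound + d.bound
  | .ite b c d => b.cost + max c.bound d.bound
  | .loop _ _ => 0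

theorem Runs.flat (hc : c.isFlat = true) (hT : c.bound ≤ T) (h : Q (c.run σ)) : Runs c σ T Q := by
  suffices h' : ∃ t ≤ c.bound, Exec c σ (c.run σ) t by
    obtain ⟨t, h1, h2⟩ := h'
    exact ⟨_, t, h2, h1.trans hT, h⟩
  clear hT h
  induction c generalizing σ with
  | skip => exact ⟨1, le_rfl, .skip σ⟩
  | setNat a i e => exact ⟨_, le_rfl, .setNat a i e σ⟩
  | setReal a i e => exact ⟨_, le_rfl, .setReal a i e σ⟩
  | seq c d ihc ihd =>
    rw [Prog.isFlat, Bool.and_eq_true] at hc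
    obtain ⟨t, h1, h2⟩ := ihc (σ := σ) hc.1
    obtain ⟨t', h1', h2'⟩ := ihd (σ := c.run σ) hc.2
    exact ⟨t + t', Nat.add_le_add h1 h1', .seq h2 h2'⟩
  | ite b c d ihc ihd =>
    rw [Prog.isFlat, Bool.and_eq_true] at hc
    by_cases hb : b.Holds σ
    · obtain ⟨t, h1, h2⟩ := ihc (σ := σ) hc.1
      refine ⟨b.cost + t, Nat.add_le_add_left (h1.trans (le_max_left _ _)) _, ?_⟩
      rw [Prog.run, if_pos hb]
      exact .ite_true hb h2
    · obtain ⟨t, h1, h2⟩ := ihd (σ := σ) hc.2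
      refine ⟨b.cost + t, Nat.add_le_add_left (h1.trans (le_max_right _ _)) _, ?_⟩
      rw [Prog.run, if_neg hb]
      exact .ite_false hb h2
  | loop b c => simp [Prog.isFlat] at hc

@[simp] theorem nat_setNat_self (σ : Store) (a i v : ℕ) :
    (σ.setNat a i v).nat a = Function.update (σ.nat a) i v := by
  simp [Store.setNat]

@[simp] theorem nat_setNat_of_ne (σ : Store) {a a' : ℕ} (i v : ℕ) (h : a' ≠ a) :
    (σ.setNat a i v).nat a' = σ.nat a' := by
  simp [Store.setNat, h]

@[simp] theorem real_setNat (σ : Store) (a i v : ℕ) : (σ.setNat a i v).real = σ.real := rfl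

@[simp] theorem nat_setReal (σ : Store) (a i : ℕ) (v : ℝ) : (σ.setReal a i v).nat = σ.nat := rfl

@[simp] theorem real_setReal_self (σ : Store) (a i : ℕ) (v : ℝ) :
    (σ.setReal a i v).real a = Function.update (σ.real a) i v := by
  simp [Store.setReal]

@[simp] theorem real_setReal_of_ne (σ : Store) {a a' : ℕ} (i : ℕ) (v : ℝ) (h : a' ≠ a) :
    (σ.setReal a i v).real a' = σ.real a' := by
  simp [Store.setReal, h]

/-- The scalar variable number `a`, stored in entry `0` of the array `a`. -/
abbrev var (a : ℕ) : NExpr := .get a (.lit 0)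

/-- Assignment to a scalar variable. -/
abbrev set (a : ℕ) (e : NExpr) : Prog := .setNat a (.lit 0) e

/-- Sequential composition of a list of programs. -/
def block : List Prog → Prog
  | [] => .skip
  | [c] => c
  | c :: d :: l => .seq c (block (d :: l))

end RAM

namespace RAM

/-! ### The program for rounding along a cycle

The memory of the program: `nKey` is the output array; it holds the first colour of the class of
each product.  `nFlag` holds the infinite capacities, `nTl` and `nHd` the tails and heads of the
arcs, `nX` and `nUb` their values and upper bounds, `nPar` and `nParc` the spanning tree, `nStk` a
path in it, `nCnt` the numbers of products leaving the warehouses.  The colour class that begins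
with the colour `lo` ends before the entry `lo` of `nEn`, and its products form a linked list with
the first entry in `nHead` and the successors in `nNxt`.  The names that begin with `v` are scalar
variables, kept in entry `0` of arrays of their own. -/

notation "nKey" => (7 : ℕ)
notation "nFlag" => (8 : ℕ)
notation "nTl" => (9 : ℕ)
notation "nHd" => (10 : ℕ)
notation "nX" => (11 : ℕ)
notation "nUb" => (12 : ℕ)
notation "nPar" => (13 : ℕ)
notation "nParc" => (14 : ℕ)
notation "nStk" => (15 : ℕ)
notation "nCnt" => (16 : ℕ)
notation "nEn" => (17 : ℕ)
notation "nHead" => (18 : ℕ)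
notation "nNxt" => (19 : ℕ)
notation "vMode" => (20 : ℕ)
notation "vI" => (21 : ℕ)
notation "vN" => (22 : ℕ)
notation "vN2" => (23 : ℕ)
notation "vN3" => (24 : ℕ)
notation "vM" => (25 : ℕ)
notation "vRho" => (26 : ℕ)
notation "vLo" => (27 : ℕ)
notation "vC" => (28 : ℕ)
notation "vC1" => (29 : ℕ)
notation "vRoot" => (30 : ℕ)
notation "vH" => (31 : ℕ)
notation "vE" => (32 : ℕ)
notation "vU" => (33 : ℕ)
notation "vV" => (34 : ℕ)
notation "vJ" => (35 : ℕ)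
notation "vA" => (36 : ℕ)
notation "vB" => (37 : ℕ)
notation "vT" => (38 : ℕ)
notation "vF" => (39 : ℕ)
notation "vR" => (40 : ℕ)
notation "vP" => (41 : ℕ)
notation "vH1" => (42 : ℕ)
notation "vH2" => (43 : ℕ)
notation "vMid" => (44 : ℕ)

/-- Record in the array `nStk` the path from `vV` to the root; its length is `vJ`. -/
def climb : Prog := .seq
  (block [set vJ (.lit 0), set vA (var vV), .setNat nStk (.lit 0) (var vV)])
  (.loop (.not (.natEq (var vA) (var vRoot))) (block [
    set vA (.get nPar (var vA)), set vJ (.add (var vJ) (.lit 1)),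
    .setNat nStk (var vJ) (var vA)]))

/-- Move the root along the recorded path. -/
def evert : Prog :=
  .loop (.natLt (.lit 0) (var vJ)) (block [
    set vJ (.sub (var vJ) (.lit 1)), set vB (.get nStk (var vJ)),
    .setNat nPar (var vRoot) (var vB), .setNat nParc (var vRoot) (.get nParc (var vB)),
    set vRoot (var vB)])

/-- Close the cycle with the arc `vE` from `vU` to the root `vV` and find a node `vB` of the cycle
with smallest slack `vT`. -/
def scan : Prog := .seq
  (block [.setNat nPar (var vV) (var vU), .setNat nParc (var vV) (var vE),
    set vT (.sub (.get nUb (var vE)) (.get nX (var vE))), set vB (var vV), set vA (var vU)])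
  (.loop (.not (.natEq (var vA) (var vV))) (block [
    set vF (.get nParc (var vA)),
    .ite (.natEq (.get nHd (var vF)) (var vA))
      (set vR (.sub (.get nUb (var vF)) (.get nX (var vF)))) (set vR (.get nX (var vF))),
    .ite (.natLt (var vR) (var vT)) (block [set vT (var vR), set vB (var vA)]) .skip,
    set vA (.get nPar (var vA))]))

/-- Push `vT` units around the cycle and open it at the node `vB`. -/
def push : Prog := .seq
  (block [.setNat nX (var vE) (.add (.get nX (var vE)) (var vT)), set vA (var vU),
    set vRoot (var vB)])
  (.loop (.not (.natEq (var vA) (var vV))) (block [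
    set vF (.get nParc (var vA)),
    .ite (.natEq (.get nHd (var vF)) (var vA))
      (.setNat nX (var vF) (.add (.get nX (var vF)) (var vT)))
      (.setNat nX (var vF) (.sub (.get nX (var vF)) (var vT))),
    set vA (.get nPar (var vA))]))

/-- Process the arc of the product number `vH - 1`. -/
def insertArc : Prog := .seq
  (block [set vE (.add (var vN3) (.sub (var vH) (.lit 1))),
    set vU (.get nTl (var vE)), set vV (.get nHd (var vE))])
  (.seq climb (.seq evert (.seq scan push)))

open Rounding

theorem climb_runs {N r v : ℕ} {σ : Store} {par : ℕ → ℕ} {l : List ℕ} (hpar : σ.nat nPar = par)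
    (hr : σ.nat vRoot 0 = r) (hv : σ.nat vV 0 = v) (hl : Path par r v l) (hN : l.length ≤ N) :
    Runs climb σ (30 * N + 30) fun σ' =>
      σ'.nat vJ 0 = l.length ∧ l = (List.range l.length).map (σ'.nat nStk) ∧
      σ'.nat nStk l.length = r ∧
      ∀ i < l.length, par (σ'.nat nStk i) = σ'.nat nStk (i + 1) := by
  let Inv : List ℕ → Store → Prop := fun rest σ' =>
    Path par r (σ'.nat vA 0) rest ∧
    l = (List.range (σ'.nat vJ 0)).map (σ'.nat nStk) ++ rest ∧
    σ'.nat nStk (σ'.nat vJ 0) = σ'.nat vA 0 ∧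
    ∀ i < σ'.nat vJ 0, par (σ'.nat nStk i) = σ'.nat nStk (i + 1)
  unfold climb
  refine Runs.mono (Runs.seq (Runs.flat (T := 15) (Q := fun σ' => σ'.nat nPar = par ∧
    σ'.nat vRoot 0 = r ∧ Inv l σ') rfl (by decide) ?_)
    (fun τ h => Runs.loop_list (Inv := Inv) 17 l h.2.2 ?_ ?_)) ?_ (fun _ h => h)
  · simp [Inv, block, Prog.run, NExpr.eval, hpar, hr, hv, hl]
  · rintro a rest τ' hk ⟨⟨rfl, h2, h2'⟩, h3, h4, h5⟩
    have hp : τ'.nat nPar = par := by rw [hk.nat _ (by decide), h.1]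
    have hr' : τ'.nat vRoot 0 = r := by rw [hk.nat _ (by decide), h.2.1]
    refine ⟨by simpa [Test.Holds, NExpr.eval, hr'] using h2, Runs.flat rfl (by decide) ?_⟩
    refine ⟨?_, ?_, ?_, ?_⟩
    · simpa [block, Prog.run, NExpr.eval, hp] using h2'
    all_goals simp [block, Prog.run, NExpr.eval, hp]
    all_goals clear h hk hp hr'
    all_goals generalize τ'.nat nStk = stk at *
    all_goals generalize τ'.nat vJ 0 = j at *
    · rw [h3, List.range_succ, List.map_append, List.append_assoc]
      congr 1
      · refine List.map_congr_left fun i hi => ?_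
        rw [List.mem_range] at hi
        rw [Function.update_of_ne (by omega)]
      · simp [h4]
    · intro i hi
      rw [Function.update_of_ne (by omega)]
      rcases hi.lt_or_eq with h6 | rfl
      · rw [Function.update_of_ne (by omega), h5 i h6]
      · rw [h4, Function.update_self]
  · rintro τ' hk ⟨h2, h3, h4, h5⟩
    change τ'.nat vA 0 = r at h2
    have hr' : τ'.nat vRoot 0 = r := by rw [hk.nat _ (by decide), h.2.1]
    refine ⟨by simpa [Test.Holds, NExpr.eval, hr'] using h2, ?_⟩
    simp at h3
    have h6 : l.length = τ'.nat vJ 0 := by rw [h3]; simp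
    rw [h6]
    exact ⟨rfl, h3, h4.trans h2, h5⟩
  · simp [Test.cost, NExpr.cost]
    omega

variable {N : ℕ} {tl hd ub x : ℕ → ℕ} {A D : Finset ℕ} {bal : ℕ → ℤ}

theorem evert_runs {σ : Store} {stk : ℕ → ℕ} {j : ℕ} (hstk : σ.nat nStk = stk)
    (hj : σ.nat vJ 0 = j) (hjN : j ≤ N) (hr : σ.nat vRoot 0 = stk j)
    (hinj : ∀ i ≤ j, ∀ i' ≤ j, stk i = stk i' → i = i') (hlt : ∀ i ≤ j, stk i < N)
    (hpar : ∀ i < j, σ.nat nPar (stk i) = stk (i + 1))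
    (hR : Rounded N tl hd A D ub bal x (σ.nat nPar) (σ.nat nParc) (stk j)) :
    Runs evert σ (40 * N + 40) fun σ' =>
      Rounded N tl hd A D ub bal x (σ'.nat nPar) (σ'.nat nParc) (stk 0) ∧
      σ'.nat vRoot 0 = stk 0 := by
  let Inv : ℕ → Store → Prop := fun i τ => τ.nat vJ 0 = i ∧ τ.nat vRoot 0 = stk i ∧
    (∀ i' < i, τ.nat nPar (stk i') = stk (i' + 1)) ∧
    Rounded N tl hd A D ub bal x (τ.nat nPar) (τ.nat nParc) (stk i)
  unfold evert
  refine Runs.mono (Runs.loop_down (Inv := Inv) 30 j ⟨hj, hr, hpar, hR⟩ ?_ ?_) ?_ (fun _ h => h)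
  · rintro i hi τ hk ⟨h1, h2, h3, h4⟩
    have hs : τ.nat nStk = stk := by rw [hk.nat _ (by decide), hstk]
    refine ⟨by simp [Test.Holds, NExpr.eval, h1], Runs.flat rfl (by decide) ?_⟩
    have hne : stk i ≠ stk (i + 1) := fun h => by
      have := hinj i (by omega) (i + 1) (by omega) h
      omega
    refine ⟨?_, ?_, ?_, ?_⟩
    · simp [block, Prog.run, NExpr.eval, h1]
    · simp [block, Prog.run, NExpr.eval, h1, hs]
    · intro i' hi'
      have : stk i' ≠ stk (i + 1) := fun h => by
        have := hinj i' (by omega) (i + 1) (by omega) h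
        omega
      simp [block, Prog.run, NExpr.eval, h1, hs, h2, this, h3 i' (by omega)]
    · simpa [block, Prog.run, NExpr.eval, h1, hs, h2] using
        h4.flip (hlt i (by omega)) hne (h3 i (by omega))
  · rintro τ hk ⟨h1, h2, h3, h4⟩
    exact ⟨by simp [Test.Holds, NExpr.eval, h1], h4, h2⟩
  · simp [Test.cost, NExpr.cost]
    omega

theorem scan_runs {σ : Store} {par parc : ℕ → ℕ} {u v e : ℕ} {l : List ℕ}
    (hpar : σ.nat nPar = par) (hparc : σ.nat nParc = parc) (hhd : σ.nat nHd = hd)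
    (hub : σ.nat nUb = ub) (hx : σ.nat nX = x) (hu : σ.nat vU 0 = u) (hv : σ.nat vV 0 = v)
    (he : σ.nat vE 0 = e) (hl : Path par v u l) (hN : l.length ≤ N) :
    Runs scan σ (80 * N + 80) fun σ' => σ'.nat nPar = Function.update par v u ∧
      σ'.nat nParc = Function.update parc v e ∧ (σ'.nat vT 0, σ'.nat vB 0) =
        l.foldl (scanStep hd (Function.update parc v e) ub x) (ub e - x e, v) := by
  let Inv : List ℕ → Store → Prop := fun rest τ => Path par v (τ.nat vA 0) rest ∧
    rest.foldl (scanStep hd (Function.update parc v e) ub x) (τ.nat vT 0, τ.nat vB 0) =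
      l.foldl (scanStep hd (Function.update parc v e) ub x) (ub e - x e, v)
  unfold scan
  refine Runs.mono (Runs.seq (Runs.flat (T := 35) (Q := fun τ =>
    (τ.nat nPar = Function.update par v u ∧ τ.nat nParc = Function.update parc v e ∧
    τ.nat nHd = hd ∧ τ.nat nUb = ub ∧ τ.nat nX = x ∧ τ.nat vV 0 = v) ∧ Inv l τ) rfl (by decide) ?_)
    (fun τ h => Runs.loop_list (Inv := Inv) 50 l h.2 ?_ ?_)) ?_ (fun _ h => h)
  · simp [Inv, block, Prog.run, NExpr.eval, hpar, hparc, hhd, hub, hx, hu, hv, he, hl]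
  · rintro a rest τ' hk ⟨⟨rfl, h2, h2'⟩, h3⟩
    obtain ⟨⟨hp, hpc, hh, hb, hxx, hvv⟩, -⟩ := h
    rw [← hk.nat _ (by decide)] at hp hpc hh hb hxx hvv
    refine ⟨by simpa [Test.Holds, NExpr.eval, hvv] using h2, Runs.flat rfl (by decide) ?_⟩
    rw [List.foldl_cons] at h3
    rw [← Function.update_of_ne h2 u par] at h2'
    simp only [Inv]
    generalize Function.update par v u = par' at *
    generalize Function.update parc v e = parc' at *
    refine ⟨?_, Eq.trans (congrArg (fun s => rest.foldl _ s) ?_) h3⟩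
    · by_cases hc₁ : hd (parc' (τ'.nat vA 0)) = τ'.nat vA 0 <;>
      by_cases hc₂ : slack hd parc' ub x (τ'.nat vA 0) < τ'.nat vT 0 <;>
      simp only [slack, hc₁, if_true, if_false] at hc₂ <;>
      simpa [block, Prog.run, NExpr.eval, Test.Holds, hp, hpc, hh, hb, hxx, hc₁, hc₂] using h2'
    · by_cases hc₁ : hd (parc' (τ'.nat vA 0)) = τ'.nat vA 0 <;>
      by_cases hc₂ : slack hd parc' ub x (τ'.nat vA 0) < τ'.nat vT 0 <;>
      simp only [scanStep, hc₂, if_true, if_false] <;>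
      simp only [slack, hc₁, if_true, if_false] at hc₂ ⊢ <;>
      simp [block, Prog.run, NExpr.eval, Test.Holds, hp, hpc, hh, hb, hxx, hc₁, hc₂]
  · rintro τ' hk ⟨h2, h3⟩
    obtain ⟨⟨hp, hpc, hh, hb, hxx, hvv⟩, -⟩ := h
    rw [← hk.nat _ (by decide)] at hp hpc hh hb hxx hvv
    change τ'.nat vA 0 = v at h2
    exact ⟨by simpa [Test.Holds, NExpr.eval, hvv] using h2, hp, hpc, h3⟩
  · simp [Test.cost, NExpr.cost]
    omega

theorem push_runs {σ : Store} {par parc : ℕ → ℕ} {u v e b δ : ℕ} {l : List ℕ}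
    (hpar : σ.nat nPar = par) (hparc : σ.nat nParc = parc) (hhd : σ.nat nHd = hd)
    (hx : σ.nat nX = x) (hu : σ.nat vU 0 = u) (hv : σ.nat vV 0 = v)
    (he : σ.nat vE 0 = e) (hb : σ.nat vB 0 = b) (hδ : σ.nat vT 0 = δ) (hl : Path par v u l)
    (hN : l.length ≤ N) :
    Runs push σ (80 * N + 80) fun σ' => σ'.nat vRoot 0 = b ∧
      σ'.nat nX = l.foldl (pushStep hd parc δ) (Function.update x e (x e + δ)) := by
  let Inv : List ℕ → Store → Prop := fun rest τ => Path par v (τ.nat vA 0) rest ∧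
    rest.foldl (pushStep hd parc δ) (τ.nat nX) =
      l.foldl (pushStep hd parc δ) (Function.update x e (x e + δ))
  unfold push
  refine Runs.mono (Runs.seq (Runs.flat (T := 35) (Q := fun τ =>
    (τ.nat nPar = par ∧ τ.nat nParc = parc ∧
    τ.nat nHd = hd ∧ τ.nat vV 0 = v ∧ τ.nat vT 0 = δ ∧ τ.nat vRoot 0 = b) ∧ Inv l τ) rfl (by decide)
    ?_) (fun τ h => Runs.loop_list (Inv := Inv) 50 l h.2 ?_ ?_)) ?_ (fun _ h => h)
  · simp [Inv, block, Prog.run, NExpr.eval, hpar, hparc, hhd, hx, hu, hv, he, hb, hδ, hl]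
  · rintro a rest τ' hk ⟨⟨rfl, h2, h2'⟩, h3⟩
    obtain ⟨⟨hp, hpc, hh, hvv, hδ', -⟩, -⟩ := h
    rw [← hk.nat _ (by decide)] at hp hpc hh hvv hδ'
    refine ⟨by simpa [Test.Holds, NExpr.eval, hvv] using h2, Runs.flat rfl (by decide) ?_⟩
    rw [List.foldl_cons] at h3
    refine ⟨?_, Eq.trans (congrArg (fun s => rest.foldl _ s) ?_) h3⟩
    · by_cases hc₁ : hd (parc (τ'.nat vA 0)) = τ'.nat vA 0 <;>
      simpa [block, Prog.run, NExpr.eval, Test.Holds, hp, hpc, hh, hc₁, h2] using h2'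
    · by_cases hc₁ : hd (parc (τ'.nat vA 0)) = τ'.nat vA 0 <;>
      simp [block, Prog.run, NExpr.eval, Test.Holds, hp, hpc, hh, hc₁, hδ', pushStep]
  · rintro τ' hk ⟨h2, h3⟩
    obtain ⟨⟨hp, hpc, hh, hvv, hδ', hroot⟩, -⟩ := h
    rw [← hk.nat _ (by decide)] at hp hpc hh hvv hδ' hroot
    change τ'.nat vA 0 = v at h2
    exact ⟨by simpa [Test.Holds, NExpr.eval, hvv] using h2, hroot, h3⟩
  · simp [Test.cost, NExpr.cost]
    omega

/-- Processing an arc takes time linear in the number of nodes. -/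
theorem insertArc_runs {σ : Store} {p e : ℕ} (htl : σ.nat nTl = tl) (hhd : σ.nat nHd = hd)
    (hub : σ.nat nUb = ub) (hp : σ.nat vH 0 = p + 1) (hn3 : σ.nat vN3 0 + p = e)
    (htle : tl e < N) (hhde : hd e < N) (hne : tl e ≠ hd e) (heD : e ∉ D) (heA : e ∈ A)
    (hR : Rounded N tl hd A D ub bal (σ.nat nX) (σ.nat nPar) (σ.nat nParc) (σ.nat vRoot 0)) :
    Runs insertArc σ (500 * N) fun σ' =>
      Rounded N tl hd A (insert e D) ub bal (σ'.nat nX) (σ'.nat nPar) (σ'.nat nParc)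
        (σ'.nat vRoot 0) := by
  obtain ⟨l, hl⟩ := hR.tree.path (hd e) hhde
  have hlN : l.length ≤ N := hl.length_le hR.tree.par_lt hhde
  unfold insertArc
  refine Runs.mono (Runs.seq (Runs.flat (T := 20) (Q := fun τ => τ.nat vE 0 = e ∧
    τ.nat vU 0 = tl e ∧ τ.nat vV 0 = hd e ∧ τ.nat nTl = tl ∧ τ.nat nHd = hd ∧ τ.nat nUb = ub ∧
    τ.nat vRoot 0 = σ.nat vRoot 0 ∧ τ.nat nPar = σ.nat nPar ∧ τ.nat nParc = σ.nat nParc ∧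
    τ.nat nX = σ.nat nX) rfl (by decide) ?_) fun τ₁ h₁ => ?_) ?_ (fun _ h => h)
    (T₁ := 20 + ((30 * N + 30) + ((40 * N + 40) + ((80 * N + 80) + (80 * N + 80)))))
  · simp [block, Prog.run, NExpr.eval, htl, hhd, hub, hp, hn3]
  · obtain ⟨h1e, h1u, h1v, h1tl, h1hd, h1ub, h1r, h1p, h1pc, h1x⟩ := h₁
    refine Runs.seq (climb_runs h1p h1r h1v hl hlN).keeps ?_
    rintro τ₂ ⟨k₂, hj, hmap, hlast, hpar⟩
    have hnd := hl.nodup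
    have hmem : ∀ i < l.length, τ₂.nat nStk i ∈ l := fun i hi => by
      rw [hmap]
      exact List.mem_map.2 ⟨i, List.mem_range.2 (by simpa using hi), rfl⟩
    have hinj : ∀ i < l.length, ∀ i' < l.length, τ₂.nat nStk i = τ₂.nat nStk i' → i = i' :=
      fun i hi i' hi' h => by
        rw [hmap] at hnd
        exact List.inj_on_of_nodup_map hnd (List.mem_range.2 hi) (List.mem_range.2 hi') h
    have hroot : ∀ i < l.length, τ₂.nat nStk i ≠ τ₂.nat nStk l.length := fun i hi => by
      rw [hlast]
      exact hl.ne_root _ (hmem i hi)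
    have hfst : τ₂.nat nStk 0 = hd e := by
      rcases Nat.eq_zero_or_pos l.length with h | h
      · rw [h] at hlast
        rw [hlast]
        obtain rfl := List.length_eq_zero_iff.1 h
        exact Eq.symm hl
      · cases l with
        | nil => simp at h
        | cons y l =>
          rw [List.length_cons, List.range_succ_eq_map, List.map_cons] at hmap
          rw [← (List.cons.inj hmap).1, hl.1]
    refine Runs.seq (evert_runs (N := N) (tl := tl) (hd := hd) (A := A) (D := D) (ub := ub)
      (bal := bal) (x := σ.nat nX) rfl hj hlN ?_ ?_ ?_ ?_ ?_).keeps ?_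
    · rw [hlast, k₂.nat _ (by decide), h1r]
    · intro i hi i' hi' h
      rcases hi.lt_or_eq with h1 | rfl <;> rcases hi'.lt_or_eq with h2 | rfl
      · exact hinj i h1 i' h2 h
      · exact absurd h (hroot i h1)
      · exact absurd h.symm (hroot i' h2)
      · rfl
    · intro i hi
      rcases hi.lt_or_eq with h1 | rfl
      · exact hl.mem_lt hR.tree.par_lt hhde _ (hmem i h1)
      · rw [hlast]
        exact hR.tree.root_lt
    · rw [k₂.nat _ (by decide), h1p]
      exact hpar
    · rw [k₂.nat _ (by decide), k₂.nat _ (by decide), h1p, h1pc, hlast]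
      exact hR
    rintro τ₃ ⟨k₃, hR₃, hr₃⟩
    rw [hfst] at hR₃ hr₃
    obtain ⟨l', hl'⟩ := hR₃.tree.path (tl e) htle
    have hl'N : l'.length ≤ N := hl'.length_le hR₃.tree.par_lt htle
    refine Runs.seq (scan_runs (N := N) (hd := hd) (ub := ub) (x := σ.nat nX) (u := tl e)
      (v := hd e) (e := e) (l := l') rfl rfl ?_ ?_ ?_ ?_ ?_ ?_ hl' hl'N).keeps ?_
    · rw [k₃.nat _ (by decide), k₂.nat _ (by decide), h1hd]
    · rw [k₃.nat _ (by decide), k₂.nat _ (by decide), h1ub]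
    · rw [k₃.nat _ (by decide), k₂.nat _ (by decide), h1x]
    · rw [k₃.nat _ (by decide), k₂.nat _ (by decide), h1u]
    · rw [k₃.nat _ (by decide), k₂.nat _ (by decide), h1v]
    · rw [k₃.nat _ (by decide), k₂.nat _ (by decide), h1e]
    rintro τ₄ ⟨k₄, hp₄, hpc₄, hs₄⟩
    have hres := hR₃.insert htle hne rfl rfl heD heA hl' _ hs₄
    refine (push_runs (N := N) (hd := hd) (x := σ.nat nX) (u := tl e) (v := hd e) (e := e) (l := l')
      rfl rfl ?_ ?_ ?_ ?_ ?_ rfl rfl ?_ hl'N).keeps.mono le_rfl ?_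
    · rw [k₄.nat _ (by decide), k₃.nat _ (by decide), k₂.nat _ (by decide), h1hd]
    · rw [k₄.nat _ (by decide), k₃.nat _ (by decide), k₂.nat _ (by decide), h1x]
    · rw [k₄.nat _ (by decide), k₃.nat _ (by decide), k₂.nat _ (by decide), h1u]
    · rw [k₄.nat _ (by decide), k₃.nat _ (by decide), k₂.nat _ (by decide), h1v]
    · rw [k₄.nat _ (by decide), k₃.nat _ (by decide), k₂.nat _ (by decide), h1e]
    · rw [hp₄]
      exact hl'.congr fun y hy => Function.update_of_ne hy _ _
    rintro τ₅ ⟨k₅, hr₅, hx₅⟩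
    rw [hr₅, hx₅, k₅.nat _ (by decide), k₅.nat _ (by decide), hp₄, hpc₄]
    exact hres
  · have := hR.tree.root_lt
    omega

end RAM

namespace RAM

open Rounding

/-! ### The program for halving a colour class -/

/-- Reset the tree to its initial state. -/
def initTree : Prog := .seq (set vI (.lit 0)) (.loop (.natLt (var vI) (var vN)) (block [
  .setNat nPar (var vI) (.add (var vN2) (var vI)),
  .setNat nPar (.add (var vN) (var vI)) (.add (var vN2) (var vI)),
  .setNat nPar (.add (var vN2) (var vI)) (var vN3),
  .setNat nParc (var vI) (var vI),
  .setNat nParc (.add (var vN) (var vI)) (.add (var vN) (var vI)),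
  .setNat nParc (.add (var vN2) (var vI)) (.add (var vN2) (var vI)),
  .setNat nX (var vI) (.lit 0),
  .setNat nX (.add (var vN) (var vI)) (.lit 0),
  set vI (.add (var vI) (.lit 1))]))

/-- Add `vC1` modulo `vC` to the value of the arc `e`. -/
def addMod (e : NExpr) : Prog :=
  .ite (.natLt (.add (.get nX e) (var vC1)) (var vC))
    (.setNat nX e (.add (.get nX e) (var vC1)))
    (.setNat nX e (.sub (.add (.get nX e) (var vC1)) (var vC)))

/-- Give each arc of a product in the list `vLo` the value `vC1`, and the arcs of the warehouses
what is needed modulo `vC`. -/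
def accumulate : Prog := .seq (set vH (.get nHead (var vLo)))
  (.loop (.natLt (.lit 0) (var vH)) (block [
    set vE (.add (var vN3) (.sub (var vH) (.lit 1))),
    .setNat nX (var vE) (var vC1), .setNat nUb (var vE) (var vC),
    addMod (.get nTl (var vE)), addMod (.get nHd (var vE)),
    set vH (.get nNxt (.sub (var vH) (.lit 1)))]))

/-- The bound for the value of the arc `e` of a warehouse. -/
def setUb (e : NExpr) : Prog :=
  .ite (.natEq (.get nX e) (.lit 0)) (.setNat nUb e (.lit 0)) (.setNat nUb e (var vC))

/-- Compute the remaining values and bounds for the arcs of the warehouses. -/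
def balance : Prog := .seq (set vI (.lit 0)) (.loop (.natLt (var vI) (var vN)) (block [
  .ite (.natLt (.get nX (.add (var vN) (var vI))) (.get nX (var vI)))
    (.setNat nX (.add (var vN2) (var vI))
      (.sub (.add (.get nX (.add (var vN) (var vI))) (var vC)) (.get nX (var vI))))
    (.setNat nX (.add (var vN2) (var vI))
      (.sub (.get nX (.add (var vN) (var vI))) (.get nX (var vI)))),
  setUb (var vI), setUb (.add (var vN) (var vI)), setUb (.add (var vN2) (var vI)),
  set vI (.add (var vI) (.lit 1))]))

/-- Process the arcs of all products in the list `vLo`. -/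
def insertAll : Prog := .seq (block [set vRoot (var vN3), set vH (.get nHead (var vLo))])
  (.loop (.natLt (.lit 0) (var vH))
    (.seq insertArc (set vH (.get nNxt (.sub (var vH) (.lit 1))))))

/-- Split the list `vLo` according to the values of the arcs. -/
def partition : Prog := .seq (block [set vMid (.add (var vLo) (var vC1)), set vH1 (.lit 0),
    set vH2 (.lit 0), set vH (.get nHead (var vLo))])
  (.seq (.loop (.natLt (.lit 0) (var vH)) (block [
    set vP (.sub (var vH) (.lit 1)), set vH (.get nNxt (var vP)),
    .ite (.natEq (.get nX (.add (var vN3) (var vP))) (.lit 0))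
      (block [.setNat nNxt (var vP) (var vH2), set vH2 (.add (var vP) (.lit 1)),
        .setNat nKey (var vP) (var vMid)])
      (block [.setNat nNxt (var vP) (var vH1), set vH1 (.add (var vP) (.lit 1))])]))
  (block [.setNat nHead (var vLo) (var vH1), .setNat nHead (var vMid) (var vH2),
    .setNat nEn (var vMid) (.get nEn (var vLo)), .setNat nEn (var vLo) (var vMid)]))

/-- Halve the colour class `vLo`, which stands for the colours from `vLo` up to the entry number
`vLo` of `nEn`. -/
def split : Prog := .seq
  (block [set vC (.sub (.get nEn (var vLo)) (var vLo)), set vC1 (.half (var vC))])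
  (.seq initTree (.seq accumulate (.seq balance (.seq insertAll partition))))

/-- `l` is the linked list with first entry `h` and successor function `nxt`, where the entry `p`
is encoded as `p + 1` and `0` is the end of the list. -/
def Chain (nxt : ℕ → ℕ) : ℕ → List ℕ → Prop
  | h, [] => h = 0
  | h, p :: l => h = p + 1 ∧ Chain nxt (nxt p) l

theorem Chain.congr {nxt nxt' : ℕ → ℕ} {h : ℕ} {l : List ℕ} (hl : Chain nxt h l)
    (he : ∀ p ∈ l, nxt' p = nxt p) : Chain nxt' h l := by
  induction l generalizing h with
  | nil => exact hl
  | cons p l ih =>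
    refine ⟨hl.1, ?_⟩
    rw [he p (by simp)]
    exact ih hl.2 fun q hq => he q (by simp [hq])

/-- The constants of the program and the network of an instance. -/
structure Ready (m n : ℕ) (s d : ℕ → ℕ) (σ : Store) : Prop where
  n1 : σ.nat vN 0 = n
  n2 : σ.nat vN2 0 = n + n
  n3 : σ.nat vN3 0 = n + n + n
  net : Network m n s d (σ.nat nTl) (σ.nat nHd)

theorem Ready.congr {m n : ℕ} {s d : ℕ → ℕ} {σ τ : Store} (h : Ready m n s d σ)
    (hk : ∀ a ∈ [vN, vN2, vN3, nTl, nHd], τ.nat a = σ.nat a) : Ready m n s d τ := by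
  obtain ⟨h1, h2, h3, h4⟩ := h
  refine ⟨?_, ?_, ?_, ?_⟩
  · rwa [hk vN (by decide)]
  · rwa [hk vN2 (by decide)]
  · rwa [hk vN3 (by decide)]
  · rwa [hk nTl (by decide), hk nHd (by decide)]

variable {m n : ℕ} {s d : ℕ → ℕ}

theorem initTree_runs {σ : Store} (h : Ready m n s d σ) :
    Runs initTree σ (90 * n + 10) fun τ =>
      ∀ w < n, τ.nat nPar w = n + n + w ∧ τ.nat nPar (n + w) = n + n + w ∧
        τ.nat nPar (n + n + w) = n + n + n ∧ τ.nat nParc w = w ∧ τ.nat nParc (n + w) = n + w ∧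
        τ.nat nParc (n + n + w) = n + n + w ∧ τ.nat nX w = 0 ∧ τ.nat nX (n + w) = 0 := by
  let Inv : ℕ → Store → Prop := fun i τ => τ.nat vI 0 = i ∧
      ∀ w < i, τ.nat nPar w = n + n + w ∧ τ.nat nPar (n + w) = n + n + w ∧
        τ.nat nPar (n + n + w) = n + n + n ∧ τ.nat nParc w = w ∧ τ.nat nParc (n + w) = n + w ∧
        τ.nat nParc (n + n + w) = n + n + w ∧ τ.nat nX w = 0 ∧ τ.nat nX (n + w) = 0
  unfold initTree
  refine Runs.mono (Runs.seq (Runs.flat (T := 3) (Q := fun τ => Ready m n s d τ ∧ Inv 0 τ) rfl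
    (by decide) ?_) (fun τ h => Runs.loop_up (Inv := Inv) 80 n h.2 ?_ ?_)) ?_ (fun _ h => h)
  · refine ⟨h.congr (by simp [Prog.run]), ?_⟩
    simp [Inv, Prog.run, NExpr.eval]
  · rintro i hi τ' hk ⟨h1, h2⟩
    have hr : Ready m n s d τ' := h.1.congr fun a ha => hk.nat a (by revert a; decide)
    refine ⟨by simpa [Test.Holds, NExpr.eval, h1, hr.n1] using hi, Runs.flat rfl (by decide) ?_⟩
    refine ⟨by simp [block, Prog.run, NExpr.eval, h1], fun w hw => ?_⟩
    simp only [block, Prog.run, NExpr.eval, h1, hr.n1, hr.n2, hr.n3, nat_setNat_self, ne_eq,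
      Nat.reduceEqDiff, not_false_eq_true, nat_setNat_of_ne,
      Function.update_apply]
    have h3 : w < i → _ := h2 w
    refine ⟨?_, ?_, ?_, ?_, ?_, ?_, ?_, ?_⟩ <;> split_ifs <;> omega
  · rintro τ' hk ⟨h1, h2⟩
    have hr : Ready m n s d τ' := h.1.congr fun a ha => hk.nat a (by revert a; decide)
    exact ⟨by simp [Test.Holds, NExpr.eval, h1, hr.n1], h2⟩
  · simp [Test.cost, NExpr.cost]
    omega

theorem run_addMod (e : NExpr) (σ : Store) : (addMod e).run σ =
    σ.setNat nX (e.eval σ) (if σ.nat nX (e.eval σ) + σ.nat vC1 0 < σ.nat vC 0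
      then σ.nat nX (e.eval σ) + σ.nat vC1 0
      else σ.nat nX (e.eval σ) + σ.nat vC1 0 - σ.nat vC 0) := by
  by_cases h : σ.nat nX (e.eval σ) + σ.nat vC1 0 < σ.nat vC 0 <;>
    simp [addMod, Prog.run, NExpr.eval, Test.Holds, h]

theorem add_mod_of_lt {a c c₁ : ℕ} (h : c₁ < c) :
    (if a % c + c₁ < c then a % c + c₁ else a % c + c₁ - c) = (a + c₁) % c := by
  rw [Nat.add_mod_eq_ite, Nat.mod_eq_of_lt h]
  split_ifs <;> omega

theorem count_insert {f : ℕ → ℕ} {S : Finset ℕ} {p : ℕ} (hp : p ∉ S) (w : ℕ) :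
    count f (insert p S) w = count f S w + if f p = w then 1 else 0 := by
  unfold count
  rw [Finset.filter_insert]
  split_ifs
  · rw [Finset.card_insert_of_notMem (by simp [hp])]
  · rfl

theorem mul_count_insert_mod {f : ℕ → ℕ} {S : Finset ℕ} {p c c₁ : ℕ} (hp : p ∉ S) (hc : c₁ < c)
    (w : ℕ) : c₁ * count f (insert p S) w % c = if f p = w then
      (if c₁ * count f S w % c + c₁ < c then c₁ * count f S w % c + c₁
        else c₁ * count f S w % c + c₁ - c) else c₁ * count f S w % c := by
  rw [count_insert hp]
  split_ifs with h1 h2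
  · rw [mul_add, mul_one, ← add_mod_of_lt hc, if_pos h2]
  · rw [mul_add, mul_one, ← add_mod_of_lt hc, if_neg h2]
  · rfl

theorem accumulate_runs {σ : Store} {lo c c₁ : ℕ} {l : List ℕ} (h : Ready m n s d σ)
    (hlo : σ.nat vLo 0 = lo) (hC : σ.nat vC 0 = c) (hC₁ : σ.nat vC1 0 = c₁) (hc : c₁ < c)
    (hl : Chain (σ.nat nNxt) (σ.nat nHead lo) l) (hnd : l.Nodup) (hm : ∀ p ∈ l, p < m)
    (hx : ∀ w < n, σ.nat nX w = 0 ∧ σ.nat nX (n + w) = 0) :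
    Runs accumulate σ (90 * l.length + 20) fun τ =>
      (∀ p ∈ l, τ.nat nX (n + n + n + p) = c₁ ∧ τ.nat nUb (n + n + n + p) = c) ∧
      ∀ w < n, τ.nat nX w = c₁ * count d l.toFinset w % c ∧
        τ.nat nX (n + w) = c₁ * count s l.toFinset w % c := by
  let Inv : List ℕ → Store → Prop := fun rest τ => Chain (σ.nat nNxt) (τ.nat vH 0) rest ∧
    ∃ pre, l = pre ++ rest ∧
      (∀ p ∈ pre, τ.nat nX (n + n + n + p) = c₁ ∧ τ.nat nUb (n + n + n + p) = c) ∧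
      ∀ w < n, τ.nat nX w = c₁ * count d pre.toFinset w % c ∧
        τ.nat nX (n + w) = c₁ * count s pre.toFinset w % c
  unfold accumulate
  refine Runs.mono (Runs.seq (Runs.flat (T := 10) (Q := fun τ => (Ready m n s d τ ∧
    τ.nat vC 0 = c ∧ τ.nat vC1 0 = c₁ ∧ τ.nat nNxt = σ.nat nNxt) ∧ Inv l τ) rfl
    (by decide) ?_) (fun τ h => Runs.loop_list (Inv := Inv) 85 l h.2 ?_ ?_)) ?_ (fun _ h => h)
  · refine ⟨⟨h.congr (by simp [Prog.run]), ?_⟩, ?_⟩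
    · simp [Prog.run, hC, hC₁]
    · simp only [Inv]
      refine ⟨by simpa [Prog.run, NExpr.eval, hlo] using hl, [], rfl, by simp, ?_⟩
      simpa [Prog.run, NExpr.eval, count] using hx
  · rintro p rest τ' hk ⟨⟨h1, h2⟩, pre, hpre, h3, h4⟩
    obtain ⟨⟨hr, hC, hC₁, hN⟩, -⟩ := h
    rw [← hk.nat _ (by decide)] at hC hC₁ hN
    replace hr : Ready m n s d τ' := hr.congr fun a ha => hk.nat a (by revert a; decide)
    refine ⟨by simp [Test.Holds, NExpr.eval, h1], Runs.flat rfl (by decide) ?_⟩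
    have hpm : p < m := hm p (by simp [hpre])
    have hpp : p ∉ pre.toFinset := by
      rw [hpre] at hnd
      have := List.disjoint_of_nodup_append hnd
      intro h
      exact this (List.mem_toFinset.1 h) (by simp)
    have hs := hr.net.s_lt p hpm
    have hd := hr.net.d_lt p hpm
    refine ⟨by simpa [block, Prog.run, run_addMod, NExpr.eval, h1, hN] using h2, pre ++ [p],
      by simp [hpre], ?_, ?_⟩
    · intro q hq
      have h5 : q ≠ p → q ∈ pre := fun h => by simpa [h] using hq
      simp only [block, Prog.run, NExpr.eval, run_addMod, h1, hr.n3, hC, hC₁, nat_setNat_self, ne_eq,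
        Nat.reduceEqDiff, not_false_eq_true, nat_setNat_of_ne, Nat.add_sub_cancel, Function.update_self,
        hr.net.tl_prod p hpm, hr.net.hd_prod p hpm]
      rw [Function.update_of_ne (by omega), Function.update_of_ne (by omega), Function.update_apply,
        Function.update_apply]
      by_cases h6 : q = p
      · simp [h6]
      · simpa [h6] using h3 q (h5 h6)
    · intro w hw
      obtain ⟨h5, h6⟩ := h4 w hw
      simp only [block, Prog.run, NExpr.eval, run_addMod, h1, hr.n3, hC, hC₁, nat_setNat_self, ne_eq,
        Nat.reduceEqDiff, not_false_eq_true, nat_setNat_of_ne, Nat.add_sub_cancel, Function.update_self,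
        hr.net.tl_prod p hpm, hr.net.hd_prod p hpm, List.toFinset_append, List.toFinset_cons,
        List.toFinset_nil, insert_empty_eq]
      rw [Finset.union_comm, ← Finset.insert_eq, mul_count_insert_mod hpp hc,
        mul_count_insert_mod hpp hc, ← h5, ← h6]
      constructor
      · rw [Function.update_apply]
        by_cases h7 : d p = w
        · subst h7
          rw [if_pos rfl, if_pos rfl, Function.update_of_ne (by omega),
            Function.update_of_ne (by omega)]
        · rw [if_neg (Ne.symm h7), if_neg h7, Function.update_of_ne (by omega),
            Function.update_of_ne (by omega)]
      · rw [Function.update_of_ne (by omega), Function.update_apply]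
        by_cases h7 : s p = w
        · subst h7
          rw [if_pos rfl, if_pos rfl, Function.update_of_ne (by omega)]
        · rw [if_neg (by omega), if_neg h7, Function.update_of_ne (by omega)]
  · rintro τ' hk ⟨h1, pre, hpre, h3, h4⟩
    change τ'.nat vH 0 = 0 at h1
    rw [List.append_nil] at hpre
    subst hpre
    exact ⟨by simp [Test.Holds, NExpr.eval, h1], h3, h4⟩
  · simp [Test.cost, NExpr.cost]
    omega

theorem run_setUb (e : NExpr) (σ : Store) : (setUb e).run σ =
    σ.setNat nUb (e.eval σ) (if σ.nat nX (e.eval σ) = 0 then 0 else σ.nat vC 0) := by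
  by_cases h : σ.nat nX (e.eval σ) = 0 <;> simp [setUb, Prog.run, NExpr.eval, Test.Holds, h]

theorem balance_runs {σ : Store} {c c₁ : ℕ} {G : Finset ℕ} (h : Ready m n s d σ)
    (hC : σ.nat vC 0 = c)
    (hp : ∀ p ∈ G, σ.nat nX (n + n + n + p) = c₁ ∧ σ.nat nUb (n + n + n + p) = c)
    (hx : ∀ w < n, σ.nat nX w = c₁ * count d G w % c ∧ σ.nat nX (n + w) = c₁ * count s G w % c) :
    Runs balance σ (150 * n + 20) fun τ => Initial n s d c c₁ G (τ.nat nX) (τ.nat nUb) := by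
  let Inv : ℕ → Store → Prop := fun i τ => τ.nat vI 0 = i ∧
    (∀ e, e < n + n ∨ n + n + n ≤ e → τ.nat nX e = σ.nat nX e) ∧
    (∀ w < i, τ.nat nX (n + n + w) = if τ.nat nX w ≤ τ.nat nX (n + w)
      then τ.nat nX (n + w) - τ.nat nX w else τ.nat nX (n + w) + c - τ.nat nX w) ∧
    (∀ w < i, τ.nat nUb w = (if τ.nat nX w = 0 then 0 else c) ∧
      τ.nat nUb (n + w) = (if τ.nat nX (n + w) = 0 then 0 else c) ∧
      τ.nat nUb (n + n + w) = (if τ.nat nX (n + n + w) = 0 then 0 else c)) ∧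
    ∀ e ≥ n + n + n, τ.nat nUb e = σ.nat nUb e
  unfold balance
  refine Runs.mono (Runs.seq (Runs.flat (T := 3) (Q := fun τ => (Ready m n s d τ ∧
    τ.nat vC 0 = c) ∧ Inv 0 τ) rfl (by decide) ?_)
    (fun τ h => Runs.loop_up (Inv := Inv) 140 n h.2 ?_ ?_)) ?_ (fun _ h => h)
  · refine ⟨⟨h.congr (by simp [Prog.run]), by simp [Prog.run, hC]⟩, ?_⟩
    simp [Inv, Prog.run, NExpr.eval]
  · rintro i hi τ' hk ⟨h1, h2, h3, h4, h5⟩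
    obtain ⟨⟨hr, hC⟩, -⟩ := h
    rw [← hk.nat _ (by decide)] at hC
    replace hr : Ready m n s d τ' := hr.congr fun a ha => hk.nat a (by revert a; decide)
    refine ⟨by simpa [Test.Holds, NExpr.eval, h1, hr.n1] using hi, Runs.flat rfl (by decide) ?_⟩
    have hX : ∀ (b : Prop) [Decidable b] (t : Store) (j u v : ℕ),
        (if b then t.setNat nX j u else t.setNat nX j v) = t.setNat nX j (if b then u else v) :=
      fun b _ t j u v => by split_ifs <;> rfl
    simp only [Inv, block, Prog.run, run_setUb, NExpr.eval, Test.Holds, h1, hr.n1, hr.n2, hC, hX,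
      nat_setNat_self, ne_eq, Nat.reduceEqDiff, not_false_eq_true, nat_setNat_of_ne]
    generalize hX' : Function.update (τ'.nat nX) (n + n + i) _ = X'
    have h6 : ∀ e ≠ n + n + i, X' e = τ'.nat nX e := fun e he => by
      rw [← hX', Function.update_of_ne he]
    refine ⟨by simp, fun e he => ?_, fun w hw => ?_, fun w hw => ?_, fun e he => ?_⟩
    · rw [h6 e (by omega), h2 e he]
    · rw [h6 w (by omega), h6 (n + w) (by omega)]
      by_cases h7 : w = i
      · subst h7
        rw [← hX', Function.update_self]
        split_ifs <;> omega
      · rw [h6 _ (by omega)]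
        exact h3 w (by omega)
    · by_cases h7 : w = i
      · subst h7
        refine ⟨?_, ?_, ?_⟩
        · rw [Function.update_of_ne (by omega), Function.update_of_ne (by omega),
            Function.update_self]
        · rw [Function.update_of_ne (by omega), Function.update_self]
        · rw [Function.update_self]
      · obtain ⟨h8, h9, h10⟩ := h4 w (by omega)
        rw [h6 w (by omega), h6 (n + w) (by omega), h6 (n + n + w) (by omega)]
        refine ⟨?_, ?_, ?_⟩ <;>
          rwa [Function.update_of_ne (by omega), Function.update_of_ne (by omega),
            Function.update_of_ne (by omega)]
    · rw [Function.update_of_ne (by omega), Function.update_of_ne (by omega),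
        Function.update_of_ne (by omega), h5 e he]
  · rintro τ' hk ⟨h1, h2, h3, h4, h5⟩
    obtain ⟨⟨hr, hC⟩, -⟩ := h
    replace hr : Ready m n s d τ' := hr.congr fun a ha => hk.nat a (by revert a; decide)
    refine ⟨by simp [Test.Holds, NExpr.eval, h1, hr.n1], ⟨fun p hp' => ?_, fun w hw => ?_,
      fun w hw => ?_, h3, fun e he => ?_⟩⟩
    · rw [h2 _ (by omega), h5 _ (by omega)]
      exact hp p hp'
    · rw [h2 _ (by omega)]
      exact (hx w hw).1
    · rw [h2 _ (by omega)]
      exact (hx w hw).2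
    · rcases lt_or_ge e n with h6 | h6
      · exact (h4 e h6).1
      rcases lt_or_ge e (n + n) with h7 | h7
      · obtain ⟨w, rfl⟩ := Nat.exists_eq_add_of_le h6
        exact (h4 w (by omega)).2.1
      · obtain ⟨w, rfl⟩ := Nat.exists_eq_add_of_le h7
        exact (h4 w (by omega)).2.2
  · simp [Test.cost, NExpr.cost]
    omega

theorem arcs_insert (n p : ℕ) (S : Finset ℕ) :
    arcs n (insert p S) = insert (n + n + n + p) (arcs n S) := by
  ext e
  simp [arcs]

theorem insertAll_runs {σ : Store} {lo : ℕ} {l : List ℕ} {ub : ℕ → ℕ} {bal : ℕ → ℤ}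
    (h : Ready m n s d σ) (hlo : σ.nat vLo 0 = lo) (hl : Chain (σ.nat nNxt) (σ.nat nHead lo) l)
    (hnd : l.Nodup) (hm : ∀ p ∈ l, p < m) (hub : σ.nat nUb = ub)
    (hR : Rounded (n + n + n + 1) (σ.nat nTl) (σ.nat nHd) (arcs n l.toFinset) (arcs n ∅) ub bal
      (σ.nat nX) (σ.nat nPar) (σ.nat nParc) (n + n + n)) :
    Runs insertAll σ (l.length * (500 * (n + n + n + 1) + 20) + 20) fun τ => ∃ par parc r,
      Rounded (n + n + n + 1) (σ.nat nTl) (σ.nat nHd) (arcs n l.toFinset) (arcs n l.toFinset) ub bal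
        (τ.nat nX) par parc r := by
  let Inv : List ℕ → Store → Prop := fun rest τ => Chain (σ.nat nNxt) (τ.nat vH 0) rest ∧
    ∃ pre, l = pre ++ rest ∧
    Rounded (n + n + n + 1) (σ.nat nTl) (σ.nat nHd) (arcs n l.toFinset) (arcs n pre.toFinset) ub bal
      (τ.nat nX) (τ.nat nPar) (τ.nat nParc) (τ.nat vRoot 0)
  unfold insertAll
  refine Runs.mono (Runs.seq (Runs.flat (T := 10) (Q := fun τ => (Ready m n s d τ ∧
    τ.nat nNxt = σ.nat nNxt ∧ τ.nat nUb = ub ∧ τ.nat nTl = σ.nat nTl ∧ τ.nat nHd = σ.nat nHd) ∧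
    Inv l τ) rfl (by decide) ?_)
    (fun τ h => Runs.loop_list (Inv := Inv) (500 * (n + n + n + 1) + 10) l h.2 ?_ ?_)) ?_
    (fun _ h => h)
  · refine ⟨⟨h.congr (by simp [block, Prog.run]), by simp [block, Prog.run, hub]⟩, ?_⟩
    simp only [Inv]
    refine ⟨by simpa [block, Prog.run, NExpr.eval, hlo] using hl, [], rfl, ?_⟩
    simpa [block, Prog.run, NExpr.eval, h.n3] using hR
  · rintro p rest τ' hk ⟨⟨h1, h2⟩, pre, hpre, h3⟩
    obtain ⟨⟨hr, hN, hU, hT, hH⟩, -⟩ := h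
    rw [← hk.nat _ (by decide)] at hN hU hT hH
    replace hr : Ready m n s d τ' := hr.congr fun a ha => hk.nat a (by revert a; decide)
    refine ⟨by simp [Test.Holds, NExpr.eval, h1], ?_⟩
    have hpm : p < m := hm p (by simp [hpre])
    have hpp : p ∉ pre.toFinset := by
      rw [hpre] at hnd
      have := List.disjoint_of_nodup_append hnd
      intro h
      exact this (List.mem_toFinset.1 h) (by simp)
    have hs := hr.net.s_lt p hpm
    have hd := hr.net.d_lt p hpm
    have htl := hr.net.tl_prod p hpm
    have hhd := hr.net.hd_prod p hpm
    rw [hT] at htl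
    rw [hH] at hhd
    refine Runs.seq (insertArc_runs (p := p) (e := n + n + n + p) hT hH hU h1 (by rw [hr.n3])
      (by omega) (by omega) (by omega) (by rwa [mem_arcs_prod])
      (by rw [mem_arcs_prod]; simp [hpre]) h3).keeps ?_
    rintro τ'' ⟨hk', h4⟩
    have h5 : τ''.nat vH 0 = p + 1 := by rw [hk'.nat _ (by decide), h1]
    have h6 : τ''.nat nNxt = σ.nat nNxt := by rw [hk'.nat _ (by decide), hN]
    refine Runs.flat rfl (by decide) ⟨by simpa [Prog.run, NExpr.eval, h5, h6] using h2, pre ++ [p],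
      by simp [hpre], ?_⟩
    rw [List.toFinset_append, List.toFinset_cons, List.toFinset_nil, insert_empty_eq,
      Finset.union_comm, ← Finset.insert_eq, arcs_insert]
    simpa [Prog.run] using h4
  · rintro τ' hk ⟨h1, pre, hpre, h3⟩
    change τ'.nat vH 0 = 0 at h1
    rw [List.append_nil] at hpre
    subst hpre
    exact ⟨by simp [Test.Holds, NExpr.eval, h1], _, _, _, h3⟩
  · simp only [Test.cost, NExpr.cost]
    nlinarith

theorem partition_runs {σ : Store} {lo c₁ : ℕ} {l : List ℕ} {x : ℕ → ℕ} (h : Ready m n s d σ)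
    (hlo : σ.nat vLo 0 = lo) (hC₁ : σ.nat vC1 0 = c₁) (hc₁ : 0 < c₁)
    (hl : Chain (σ.nat nNxt) (σ.nat nHead lo) l) (hnd : l.Nodup) (hx : σ.nat nX = x) :
    Runs partition σ (90 * l.length + 80) fun τ =>
      Chain (τ.nat nNxt) (τ.nat nHead lo) (l.reverse.filter fun p => x (n + n + n + p) ≠ 0) ∧
      Chain (τ.nat nNxt) (τ.nat nHead (lo + c₁))
        (l.reverse.filter fun p => x (n + n + n + p) = 0) ∧
      (∀ i, i ≠ lo → i ≠ lo + c₁ → τ.nat nHead i = σ.nat nHead i ∧ τ.nat nEn i = σ.nat nEn i) ∧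
      τ.nat nEn lo = lo + c₁ ∧ τ.nat nEn (lo + c₁) = σ.nat nEn lo ∧
      (∀ p ∉ l, τ.nat nNxt p = σ.nat nNxt p) ∧
      ∀ p, τ.nat nKey p =
        if p ∈ l ∧ x (n + n + n + p) = 0 then lo + c₁ else σ.nat nKey p := by
  let Inv : List ℕ → Store → Prop := fun rest τ => Chain (τ.nat nNxt) (τ.nat vH 0) rest ∧
    ∃ pre, l = pre ++ rest ∧
    Chain (τ.nat nNxt) (τ.nat vH1 0) (pre.reverse.filter fun p => x (n + n + n + p) ≠ 0) ∧
    Chain (τ.nat nNxt) (τ.nat vH2 0) (pre.reverse.filter fun p => x (n + n + n + p) = 0) ∧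
    (∀ p ∉ pre, τ.nat nNxt p = σ.nat nNxt p) ∧
    ∀ p, τ.nat nKey p = if p ∈ pre ∧ x (n + n + n + p) = 0 then lo + c₁ else σ.nat nKey p
  unfold partition
  refine Runs.mono (Runs.seq (Runs.flat (T := 20) (Q := fun τ => (Ready m n s d τ ∧
    τ.nat nX = x ∧ τ.nat vLo 0 = lo ∧ τ.nat vMid 0 = lo + c₁ ∧ τ.nat nHead = σ.nat nHead ∧
    τ.nat nEn = σ.nat nEn) ∧ Inv l τ) rfl (by decide) ?_)
    (fun τ h => Runs.seq (Runs.loop_list (Inv := Inv) (Q := Inv [])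
      80 l h.2 ?_ ?_).keeps ?_) (T₂ := _ + 40)) ?_ (fun _ h => h)
  · refine ⟨⟨h.congr (by simp [block, Prog.run]), by simp [block, Prog.run, NExpr.eval, *]⟩, ?_⟩
    simp only [Inv]
    refine ⟨by simpa [block, Prog.run, NExpr.eval, hlo] using hl, [], rfl, ?_⟩
    simp [block, Prog.run, NExpr.eval, Chain]
  · rintro p rest τ' hk ⟨⟨h1, h2⟩, pre, hpre, h3, h4, h5, h6⟩
    obtain ⟨⟨hr, hX, -, hM, -⟩, -⟩ := h
    rw [← hk.nat _ (by decide)] at hX hM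
    replace hr : Ready m n s d τ' := hr.congr fun a ha => hk.nat a (by revert a; decide)
    refine ⟨by simp [Test.Holds, NExpr.eval, h1], Runs.flat rfl (by decide) ?_⟩
    rw [hpre] at hnd
    have hdis := List.disjoint_of_nodup_append hnd
    have hpp : p ∉ pre := fun h => hdis h (by simp)
    have hpr : p ∉ rest := (List.nodup_cons.1 hnd.of_append_right).1
    have hpf : ∀ f : ℕ → Bool, ∀ q ∈ pre.reverse.filter f, q ≠ p := fun f q hq h => by
      subst h
      exact hpp (by simpa using (List.mem_filter.1 hq).1)
    have hup : ∀ (f : ℕ → ℕ) v (l' : List ℕ) h', (∀ q ∈ l', q ≠ p) → Chain f h' l' →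
        Chain (Function.update f p v) h' l' :=
      fun f v l' h' hl' hch => hch.congr fun q hq => Function.update_of_ne (hl' q hq) _ _
    have hrest : ∀ q ∈ rest, q ≠ p := fun q hq h => hpr (h ▸ hq)
    by_cases h7 : x (n + n + n + p) = 0
    · simp only [Inv, block, Prog.run, NExpr.eval, Test.Holds, h1, hr.n3, hX, hM, nat_setNat_self,
        ne_eq, Nat.reduceEqDiff, not_false_eq_true, nat_setNat_of_ne, Nat.add_sub_cancel,
        Function.update_self, h7, if_true]
      refine ⟨hup _ _ _ _ hrest h2, pre ++ [p], by simp [hpre], ?_, ?_, ?_, ?_⟩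
      · simpa [List.filter_cons, h7] using hup _ _ _ _ (hpf _) h3
      · simpa [List.filter_cons, h7, Chain] using hup _ _ _ _ (hpf _) h4
      · intro q hq
        rw [List.mem_append, List.mem_singleton, not_or] at hq
        rw [Function.update_of_ne hq.2, h5 q hq.1]
      · intro q
        rw [Function.update_apply, h6]
        by_cases h8 : q = p
        · simp [h8, h7]
        · simp [h8]
    · simp only [Inv, block, Prog.run, NExpr.eval, Test.Holds, h1, hr.n3, hX, hM, nat_setNat_self,
        ne_eq, Nat.reduceEqDiff, not_false_eq_true, nat_setNat_of_ne, Nat.add_sub_cancel,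
        Function.update_self, h7, if_false]
      refine ⟨hup _ _ _ _ hrest h2, pre ++ [p], by simp [hpre], ?_, ?_, ?_, ?_⟩
      · simpa [List.filter_cons, h7, Chain] using hup _ _ _ _ (hpf _) h3
      · simpa [List.filter_cons, h7, Chain] using hup _ _ _ _ (hpf _) h4
      · intro q hq
        rw [List.mem_append, List.mem_singleton, not_or] at hq
        rw [Function.update_of_ne hq.2, h5 q hq.1]
      · intro q
        rw [h6]
        by_cases h8 : q = p
        · simp [h8, h7]
        · simp [h8]
  · rintro τ' hk h1
    have h2 : τ'.nat vH 0 = 0 := h1.1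
    exact ⟨by simp [Test.Holds, NExpr.eval, h2], h1⟩
  · rintro τ' ⟨hk, -, pre, hpre, h3, h4, h5, h6⟩
    rw [List.append_nil] at hpre
    subst hpre
    obtain ⟨⟨-, -, hL, hM, hH, hE⟩, -⟩ := h
    rw [← hk.nat _ (by decide)] at hL hM hH hE
    refine Runs.flat rfl (by decide) ?_
    have hne : lo ≠ lo + c₁ := by omega
    simp only [block, Prog.run, NExpr.eval, nat_setNat_self, ne_eq, Nat.reduceEqDiff,
      not_false_eq_true, nat_setNat_of_ne, hL, hM, hH, hE, Function.update_self]
    refine ⟨?_, h4, ?_, trivial, ?_, h5, h6⟩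
    · rw [Function.update_of_ne hne, Function.update_self]
      exact h3
    · intro i hi hi'
      simp [hi, hi']
    · rw [Function.update_of_ne hne.symm, Function.update_self]
  · simp [Test.cost, NExpr.cost]
    omega

/-- Halving a colour class with `g` products takes time `O(n (g + 1))`. -/
theorem split_runs {σ : Store} {o r : ℕ → ℕ} {ρ lo c : ℕ} {l : List ℕ} (h : Ready m n s d σ)
    (hlo : σ.nat vLo 0 = lo) (hen : σ.nat nEn lo = lo + c) (hc : 2 ≤ c)
    (hl : Chain (σ.nat nNxt) (σ.nat nHead lo) l) (hnd : l.Nodup) (hm : ∀ p ∈ l, p < m)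
    (hS : Share n s d o r ρ c l.toFinset) (hn : 0 < n) :
    Runs split σ (3000 * (n * (l.length + 1))) fun τ => ∃ l₁ l₂, (l₁ ++ l₂).Perm l ∧
      Chain (τ.nat nNxt) (τ.nat nHead lo) l₁ ∧ Chain (τ.nat nNxt) (τ.nat nHead (lo + c / 2)) l₂ ∧
      Share n s d o r ρ (c / 2) l₁.toFinset ∧ Share n s d o r ρ (c - c / 2) l₂.toFinset ∧
      (∀ i, i ≠ lo → i ≠ lo + c / 2 → τ.nat nHead i = σ.nat nHead i ∧ τ.nat nEn i = σ.nat nEn i) ∧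
      τ.nat nEn lo = lo + c / 2 ∧ τ.nat nEn (lo + c / 2) = lo + c ∧
      (∀ p ∉ l, τ.nat nNxt p = σ.nat nNxt p ∧ τ.nat nKey p = σ.nat nKey p) ∧
      (∀ p ∈ l₁, τ.nat nKey p = σ.nat nKey p) ∧ ∀ p ∈ l₂, τ.nat nKey p = lo + c / 2 := by
  unfold split
  refine Runs.mono (Runs.seq (Runs.flat (T := 20) (Q := fun τ => (Ready m n s d τ ∧
    τ.nat vC 0 = c ∧ τ.nat vC1 0 = c / 2 ∧ ∀ a ∈ [vLo, nEn, nNxt, nHead, nKey],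
      τ.nat a = σ.nat a)) rfl (by decide) ?_) ?_
    (T₂ := (90 * n + 10) + ((90 * l.length + 20) + ((150 * n + 20) +
      ((l.length * (500 * (n + n + n + 1) + 20) + 20) + (90 * l.length + 80)))))) ?_ fun _ h => h
  · refine ⟨h.congr (by simp [block, Prog.run]), ?_⟩
    simp [block, Prog.run, NExpr.eval, hlo, hen]
  · rintro τ₁ ⟨r₁, hC, hC₁, hk₁⟩
    refine Runs.seq (initTree_runs r₁).keeps ?_
    rintro τ₂ ⟨k₂, h₂⟩
    have r₂ : Ready m n s d τ₂ := r₁.congr fun a ha => k₂.nat a (by revert a; decide)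
    rw [← k₂.nat _ (by decide)] at hC hC₁
    have hk₂ : ∀ a ∈ [vLo, nEn, nNxt, nHead, nKey], τ₂.nat a = σ.nat a := fun a ha => by
      rw [← hk₁ a ha]; exact k₂.nat a (by revert a; decide)
    have hlo₂ : τ₂.nat vLo 0 = lo := by rw [hk₂ vLo (by decide), hlo]
    have hl₂ : Chain (τ₂.nat nNxt) (τ₂.nat nHead lo) l := by
      rwa [hk₂ nNxt (by decide), hk₂ nHead (by decide)]
    refine Runs.seq (accumulate_runs r₂ hlo₂ hC hC₁ (by omega) hl₂ hnd hm
      fun w hw => (h₂ w hw).2.2.2.2.2.2).keeps ?_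
    rintro τ₃ ⟨k₃, h₃, h₃'⟩
    have r₃ : Ready m n s d τ₃ := r₂.congr fun a ha => k₃.nat a (by revert a; decide)
    rw [← k₃.nat _ (by decide)] at hC hC₁
    have hk₃ : ∀ a ∈ [vLo, nEn, nNxt, nHead, nKey], τ₃.nat a = σ.nat a := fun a ha => by
      rw [← hk₂ a ha]; exact k₃.nat a (by revert a; decide)
    refine Runs.seq (balance_runs (G := l.toFinset) r₃ hC (fun p hp => h₃ p (by simpa using hp))
      h₃').keeps ?_
    rintro τ₄ ⟨k₄, h₄⟩
    have r₄ : Ready m n s d τ₄ := r₃.congr fun a ha => k₄.nat a (by revert a; decide)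
    rw [← k₄.nat _ (by decide)] at hC hC₁
    have hk₄ : ∀ a ∈ [vLo, nEn, nNxt, nHead, nKey], τ₄.nat a = σ.nat a := fun a ha => by
      rw [← hk₃ a ha]; exact k₄.nat a (by revert a; decide)
    have hlo₄ : τ₄.nat vLo 0 = lo := by rw [hk₄ vLo (by decide), hlo]
    have hl₄ : Chain (τ₄.nat nNxt) (τ₄.nat nHead lo) l := by
      rwa [hk₄ nNxt (by decide), hk₄ nHead (by decide)]
    have hpar : τ₄.nat nPar = τ₂.nat nPar := by
      rw [k₄.nat _ (by decide), k₃.nat _ (by decide)]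
    have hparc : τ₄.nat nParc = τ₂.nat nParc := by
      rw [k₄.nat _ (by decide), k₃.nat _ (by decide)]
    have hR := h₄.rounded r₄.net (by omega) (by omega) (par := τ₄.nat nPar) (parc := τ₄.nat nParc)
      (fun w hw => by rw [hpar]; exact (h₂ w hw).1)
      (fun w hw => by rw [hpar]; exact (h₂ w hw).2.1)
      (fun w hw => by rw [hpar]; exact (h₂ w hw).2.2.1)
      (fun e he => by
        rw [hparc]
        rcases lt_or_ge e n with h6 | h6
        · exact (h₂ e h6).2.2.2.1
        rcases lt_or_ge e (n + n) with h7 | h7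
        · obtain ⟨w, rfl⟩ := Nat.exists_eq_add_of_le h6
          exact (h₂ w (by omega)).2.2.2.2.1
        · obtain ⟨w, rfl⟩ := Nat.exists_eq_add_of_le h7
          exact (h₂ w (by omega)).2.2.2.2.2.1)
    refine Runs.seq (insertAll_runs r₄ hlo₄ hl₄ hnd hm rfl (by simpa [arcs] using hR)).keeps ?_
    rintro τ₅ ⟨k₅, par, parc, root, h₅⟩
    have r₅ : Ready m n s d τ₅ := r₄.congr fun a ha => k₅.nat a (by revert a; decide)
    rw [← k₅.nat _ (by decide)] at hC₁
    have hk₅ : ∀ a ∈ [vLo, nEn, nNxt, nHead, nKey], τ₅.nat a = σ.nat a := fun a ha => by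
      rw [← hk₄ a ha]; exact k₅.nat a (by revert a; decide)
    have hl₅ : Chain (τ₅.nat nNxt) (τ₅.nat nHead lo) l := by
      rwa [hk₅ nNxt (by decide), hk₅ nHead (by decide)]
    have hshare := h₄.share r₄.net (fun p hp => hm p (by simpa using hp)) (by omega) (by omega) h₅ hS
    refine Runs.mono (partition_runs r₅ (by rw [hk₅ vLo (by decide), hlo]) hC₁ (by omega) hl₅ hnd
      rfl) le_rfl ?_
    rintro τ₆ ⟨h6, h7, h8, h9, h10, h11, h12⟩
    rw [hk₅ nHead (by decide), hk₅ nEn (by decide)] at h8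
    rw [hk₅ nEn (by decide), hen] at h10
    rw [hk₅ nNxt (by decide)] at h11
    rw [hk₅ nKey (by decide)] at h12
    refine ⟨_, _, ?_, h6, h7, ?_, ?_, h8, h9, h10, fun p hp => ⟨h11 p hp, ?_⟩, fun p hp => ?_,
      fun p hp => ?_⟩
    · refine List.Perm.trans ?_ (List.reverse_perm l)
      have := List.filter_append_perm (fun p => decide (τ₅.nat nX (n + n + n + p) ≠ 0)) l.reverse
      simpa using this
    · convert hshare.1 using 1
      ext p
      simp
    · convert hshare.2 using 1
      ext p
      simp
    · rw [h12, if_neg fun h => hp h.1]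
    · rw [h12, if_neg]
      rintro ⟨-, h⟩
      simp [h] at hp
    · rw [h12, if_pos]
      simpa using hp
  · have : l.length * n ≥ l.length := Nat.le_mul_of_pos_right _ hn
    nlinarith

end RAM

namespace RAM

open Rounding

/-! ### The program for colouring all products -/

/-- Halve the colour classes until each of them stands for one colour only. -/
def colour : Prog := .loop (.natLt (var vLo) (var vRho))
  (.ite (.natEq (.get nEn (var vLo)) (.add (var vLo) (.lit 1))) (set vLo (.add (var vLo) (.lit 1)))
    split)

variable {m n : ℕ} {s d o r : ℕ → ℕ} {ρ R : ℕ}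

/-- The products in `l` are a fair share for the `c` colours from the current colour `lo` on. -/
structure Pending (m n : ℕ) (s d o r : ℕ → ℕ) (ρ R lo c : ℕ) (l : List ℕ) (σ : Store) : Prop where
  ready : Ready m n s d σ
  colours : σ.nat vRho 0 = R
  current : σ.nat vLo 0 = lo
  le : lo + c ≤ R
  last : σ.nat nEn lo = lo + c
  chain : Chain (σ.nat nNxt) (σ.nat nHead lo) l
  nodup : l.Nodup
  lt : ∀ p ∈ l, p < m
  share : Share n s d o r ρ c l.toFinset
  key : ∀ p ∈ l, σ.nat nKey p = lo

/-- The products in `l` have been coloured with the `c` colours from `lo` on. -/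
structure Coloured (m n : ℕ) (s d o r : ℕ → ℕ) (ρ R lo c : ℕ) (l : List ℕ) (σ τ : Store) :
    Prop where
  ready : Ready m n s d τ
  colours : τ.nat vRho 0 = R
  current : τ.nat vLo 0 = lo + c
  later : ∀ i ≥ lo + c, τ.nat nHead i = σ.nat nHead i ∧ τ.nat nEn i = σ.nat nEn i
  other : ∀ p ∉ l, τ.nat nNxt p = σ.nat nNxt p ∧ τ.nat nKey p = σ.nat nKey p
  key : ∀ p ∈ l, lo ≤ τ.nat nKey p ∧ τ.nat nKey p < lo + c
  share : ∀ i, lo ≤ i → i < lo + c →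
    Share n s d o r ρ 1 (l.toFinset.filter fun p => τ.nat nKey p = i)

/-- Colouring `g` products with `c` colours takes time `O(n (g log c + c))`: each of the `log c`
levels of the recursion costs `O(n g)`, and the `c - 1` halvings cost `O(n)` each in addition. -/
theorem colour_runs (hn : 0 < n) {c : ℕ} (hc : 0 < c) {lo : ℕ} {l : List ℕ} {σ : Store}
    (h : Pending m n s d o r ρ R lo c l σ) {T : ℕ} {Q : Store → Prop}
    (hT : ∀ τ, Coloured m n s d o r ρ R lo c l σ τ → Runs colour τ T Q) :
    Runs colour σ (4000 * (n * (l.length * Nat.clog 2 c + 2 * c - 1)) + T) Q := by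
  induction c using Nat.strong_induction_on generalizing lo l σ T with
  | _ c ih =>
  have hloop : (Test.natLt (var vLo) (var vRho)).Holds σ := by
    have := h.le
    simp only [Test.Holds, NExpr.eval, h.current, h.colours]
    omega
  rcases Nat.lt_or_ge c 2 with h1 | h1
  · obtain rfl : c = 1 := by omega
    refine Runs.mono (Runs.loop_step hloop (Runs.ite_true (T := 6) (Q := fun τ =>
      Coloured m n s d o r ρ R lo 1 l σ τ) ?_ (Runs.flat rfl (by decide) ?_)) hT) ?_ fun _ h => h
    · simp [Test.Holds, NExpr.eval, h.current, h.last]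
    · refine ⟨h.ready.congr (by simp [Prog.run]), ?_, ?_, ?_, ?_, ?_, ?_⟩
      · simp [Prog.run, h.colours]
      · simp [Prog.run, NExpr.eval, h.current]
      · simp [Prog.run]
      · simp [Prog.run]
      · intro p hp
        simp [Prog.run, h.key p hp]
      · intro i hi hi'
        obtain rfl : i = lo := by omega
        convert h.share using 1
        refine Finset.filter_true_of_mem fun p hp => ?_
        simpa [Prog.run] using h.key p (by simpa using hp)
    · simp [Test.cost, NExpr.cost]
      omega
  · refine Runs.mono (Runs.loop_step hloop (Runs.ite_false ?_ (split_runs h.ready h.current h.last h1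
      h.chain h.nodup h.lt h.share hn).keeps) ?_ (T₂ :=
        4000 * (n * (l.length * (Nat.clog 2 c - 1) + 2 * c - 2)) + T)) ?_ fun _ h => h
    · have := h.last
      simp only [Test.Holds, NExpr.eval, h.current]
      omega
    · rintro τ ⟨hk, l₁, l₂, hperm, hch₁, hch₂, hs₁, hs₂, hlater, hen₁, hen₂, hother, hkey₁, hkey₂⟩
      have hnd : (l₁ ++ l₂).Nodup := hperm.nodup_iff.2 h.nodup
      have hdis := List.disjoint_of_nodup_append hnd
      have hmem : ∀ p, p ∈ l ↔ p ∈ l₁ ∨ p ∈ l₂ := fun p => by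
        rw [← hperm.mem_iff, List.mem_append]
      have hlen : l₁.length + l₂.length = l.length := by
        rw [← hperm.length_eq, List.length_append]
      have hr : Ready m n s d τ := h.ready.congr fun a ha => hk.nat a (by revert a; decide)
      have hle := h.le
      have hlog : Nat.clog 2 c = Nat.clog 2 (c - c / 2) + 1 := by
        rw [Nat.clog_of_two_le (le_refl 2) h1]
        congr 2
        omega
      have hlog' : Nat.clog 2 (c / 2) ≤ Nat.clog 2 c - 1 := by
        rw [hlog]
        exact Nat.clog_mono_right 2 (by omega)
      have hpend : Pending m n s d o r ρ R lo (c / 2) l₁ τ :=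
        ⟨hr, by rw [hk.nat _ (by decide), h.colours], by rw [hk.nat _ (by decide), h.current],
          by omega, hen₁, hch₁, hnd.of_append_left, fun p hp => h.lt p ((hmem p).2 (Or.inl hp)), hs₁,
          fun p hp => by rw [hkey₁ p hp, h.key p ((hmem p).2 (Or.inl hp))]⟩
      -- the left half is coloured first; then the loop has arrived at the right half
      refine Runs.mono (ih (c / 2) (by omega) (by omega) hpend (T :=
        4000 * (n * (l₂.length * Nat.clog 2 (c - c / 2) + 2 * (c - c / 2) - 1)) + T) ?_) ?_
        fun _ h => h
      · intro τ₁ h₁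
        have hpend' : Pending m n s d o r ρ R (lo + c / 2) (c - c / 2) l₂ τ₁ := by
          refine ⟨h₁.ready, h₁.colours, h₁.current, by omega, ?_, ?_, hnd.of_append_right,
            fun p hp => h.lt p ((hmem p).2 (Or.inr hp)), hs₂, fun p hp => ?_⟩
          · rw [(h₁.later _ le_rfl).2, hen₂]
            omega
          · rw [(h₁.later _ le_rfl).1]
            exact hch₂.congr fun p hp => (h₁.other p fun h => hdis h hp).1
          · rw [(h₁.other p fun h => hdis h hp).2, hkey₂ p hp]
        refine ih (c - c / 2) (by omega) (by omega) hpend' fun τ₂ h₂ => hT τ₂ ?_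
        have hkey : ∀ p ∈ l₁, τ₂.nat nKey p = τ₁.nat nKey p := fun p hp =>
          (h₂.other p fun h => hdis hp h).2
        refine ⟨h₂.ready, h₂.colours, ?_, fun i hi => ?_, fun p hp => ?_, fun p hp => ?_,
          fun i hi hi' => ?_⟩
        · rw [h₂.current]
          omega
        · obtain ⟨a1, a2⟩ := h₂.later i (by omega)
          obtain ⟨b1, b2⟩ := h₁.later i (by omega)
          obtain ⟨c1, c2⟩ := hlater i (by omega) (by omega)
          exact ⟨a1.trans (b1.trans c1), a2.trans (b2.trans c2)⟩
        · obtain ⟨a1, a2⟩ := h₂.other p fun h => hp ((hmem p).2 (Or.inr h))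
          obtain ⟨b1, b2⟩ := h₁.other p fun h => hp ((hmem p).2 (Or.inl h))
          obtain ⟨c1, c2⟩ := hother p hp
          exact ⟨a1.trans (b1.trans c1), a2.trans (b2.trans c2)⟩
        · rcases (hmem p).1 hp with h3 | h3
          · have := h₁.key p h3
            rw [hkey p h3]
            omega
          · have := h₂.key p h3
            omega
        · rcases lt_or_ge i (lo + c / 2) with h3 | h3
          · convert h₁.share i hi h3 using 1
            ext p
            simp only [Finset.mem_filter, List.mem_toFinset]
            constructor
            · rintro ⟨h4, h5⟩
              rcases (hmem p).1 h4 with h6 | h6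
              · exact ⟨h6, by rw [← hkey p h6, h5]⟩
              · have := (h₂.key p h6).1
                omega
            · rintro ⟨h4, h5⟩
              exact ⟨(hmem p).2 (Or.inl h4), by rw [hkey p h4, h5]⟩
          · convert h₂.share i h3 (by omega) using 1
            ext p
            simp only [Finset.mem_filter, List.mem_toFinset]
            constructor
            · rintro ⟨h4, h5⟩
              rcases (hmem p).1 h4 with h6 | h6
              · have := (h₁.key p h6).2
                rw [← hkey p h6] at this
                omega
              · exact ⟨h6, h5⟩
            · rintro ⟨h4, h5⟩
              exact ⟨(hmem p).2 (Or.inr h4), h5⟩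
      · rw [← add_assoc, ← mul_add, ← mul_add]
        refine Nat.add_le_add_right (Nat.mul_le_mul_left _ (Nat.mul_le_mul_left _ ?_)) _
        have e1 := Nat.mul_le_mul_left l₁.length hlog'
        have e2 : Nat.clog 2 (c - c / 2) = Nat.clog 2 c - 1 := by omega
        rw [e2, ← hlen, add_mul]
        omega
    · have e1 : Nat.clog 2 c ≥ 1 := Nat.clog_pos (le_refl 2) h1
      have e2 : l.length * Nat.clog 2 c = l.length * (Nat.clog 2 c - 1) + l.length := by
        rw [← Nat.mul_succ]
        congr 1
        omega
      have e3 : l.length * Nat.clog 2 c + 2 * c - 1 =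
          (l.length * (Nat.clog 2 c - 1) + 2 * c - 2) + (l.length + 1) := by omega
      rw [e3, Nat.mul_add n (_ - 2)]
      simp only [Test.cost, NExpr.cost]
      have : n ≤ n * (l.length + 1) := Nat.le_mul_of_pos_right _ (by omega)
      omega

end RAM

namespace RAM

open Rounding

/-! ### The program for reading the instance -/

/-- Store the tail and the head of the arc of the product `vI`, reversed unless `vMode` is `0`. -/
def loadArc : Prog := .ite (.natEq (var vMode) (.lit 0))
  (block [.setNat nTl (.add (var vN3) (var vI)) (.add (var vN) (.get 1 (var vI))),
    .setNat nHd (.add (var vN3) (var vI)) (.get 2 (var vI))])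
  (block [.setNat nTl (.add (var vN3) (var vI)) (.add (var vN) (.get 2 (var vI))),
    .setNat nHd (.add (var vN3) (var vI)) (.get 1 (var vI))])

/-- Read the products, count those leaving each warehouse and put all of them into one list. -/
def loadProducts : Prog := .seq (set vI (.lit 0)) (.loop (.natLt (var vI) (var vM)) (block [
  loadArc, .setNat nCnt (.sub (.get nTl (.add (var vN3) (var vI))) (var vN))
    (.add (.get nCnt (.sub (.get nTl (.add (var vN3) (var vI))) (var vN))) (.lit 1)),
  .setNat nNxt (var vI) (var vI), set vI (.add (var vI) (.lit 1))]))

/-- Store the carry-out capacity of the warehouse `vI`, or its carry-in capacity unless `vMode` is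
`0`. -/
def loadCap : Prog := .ite (.natEq (var vMode) (.lit 0))
  (block [.setNat nFlag (var vI) (.get 4 (var vI)), .setReal 4 (var vI) (.get 1 (var vI))])
  (block [.setNat nFlag (var vI) (.get 5 (var vI)), .setReal 4 (var vI) (.get 2 (var vI))])

/-- Read the warehouses. -/
def loadWarehouses : Prog := .seq (set vI (.lit 0)) (.loop (.natLt (var vI) (var vN)) (block [
  .setNat nTl (var vI) (var vI), .setNat nHd (var vI) (.add (var vN2) (var vI)),
  .setNat nTl (.add (var vN) (var vI)) (.add (var vN2) (var vI)),
  .setNat nHd (.add (var vN) (var vI)) (.add (var vN) (var vI)),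
  .setNat nTl (.add (var vN2) (var vI)) (var vN3),
  .setNat nHd (.add (var vN2) (var vI)) (.add (var vN2) (var vI)),
  loadCap, set vI (.add (var vI) (.lit 1))]))

/-- The constants of the program. -/
structure Dims (m n : ℕ) (σ : Store) : Prop where
  m1 : σ.nat vM 0 = m
  n1 : σ.nat vN 0 = n
  n2 : σ.nat vN2 0 = n + n
  n3 : σ.nat vN3 0 = n + n + n

theorem Dims.congr {m n : ℕ} {σ τ : Store} (h : Dims m n σ)
    (hk : ∀ a ∈ [vM, vN, vN2, vN3], τ.nat a = σ.nat a) : Dims m n τ := by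
  obtain ⟨h1, h2, h3, h4⟩ := h
  refine ⟨?_, ?_, ?_, ?_⟩
  · rwa [hk vM (by decide)]
  · rwa [hk vN (by decide)]
  · rwa [hk vN2 (by decide)]
  · rwa [hk vN3 (by decide)]

/-- The direction chosen by `vMode`: the sources `s`, the sinks `d`, the flags `f` and the values
`D` of the relevant capacities. -/
structure Source (m n : ℕ) (s d f : ℕ → ℕ) (D : ℕ → ℝ) (σ : Store) : Prop where
  src : ∀ p < m, (if σ.nat vMode 0 = 0 then σ.nat 1 p else σ.nat 2 p) = s p
  tgt : ∀ p < m, (if σ.nat vMode 0 = 0 then σ.nat 2 p else σ.nat 1 p) = d p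
  flag : ∀ w < n, (if σ.nat vMode 0 = 0 then σ.nat 4 w else σ.nat 5 w) = f w
  cap : ∀ w < n, (if σ.nat vMode 0 = 0 then σ.real 1 w else σ.real 2 w) = D w
  src_lt : ∀ p < m, s p < n
  tgt_lt : ∀ p < m, d p < n

variable {m n : ℕ} {s d f : ℕ → ℕ} {D : ℕ → ℝ}

theorem Source.congr {σ τ : Store} (h : Source m n s d f D σ)
    (hk : ∀ a ∈ [vMode, 1, 2, 4, 5], τ.nat a = σ.nat a)
    (hk' : ∀ a ∈ [1, 2], τ.real a = σ.real a) : Source m n s d f D τ := by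
  obtain ⟨h1, h2, h3, h4, h5, h6⟩ := h
  refine ⟨?_, ?_, ?_, ?_, h5, h6⟩
  · rwa [hk vMode (by decide), hk 1 (by decide), hk 2 (by decide)]
  · rwa [hk vMode (by decide), hk 1 (by decide), hk 2 (by decide)]
  · rwa [hk vMode (by decide), hk 4 (by decide), hk 5 (by decide)]
  · rwa [hk vMode (by decide), hk' 1 (by decide), hk' 2 (by decide)]

theorem run_loadArc (σ : Store) : loadArc.run σ =
    (σ.setNat nTl (σ.nat vN3 0 + σ.nat vI 0) (σ.nat vN 0 +
      if σ.nat vMode 0 = 0 then σ.nat 1 (σ.nat vI 0) else σ.nat 2 (σ.nat vI 0))).setNat nHd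
      (σ.nat vN3 0 + σ.nat vI 0)
      (if σ.nat vMode 0 = 0 then σ.nat 2 (σ.nat vI 0) else σ.nat 1 (σ.nat vI 0)) := by
  by_cases h : σ.nat vMode 0 = 0 <;> simp [loadArc, block, Prog.run, NExpr.eval, Test.Holds, h]

theorem run_loadCap (σ : Store) : loadCap.run σ = (σ.setNat nFlag (σ.nat vI 0)
    (if σ.nat vMode 0 = 0 then σ.nat 4 (σ.nat vI 0) else σ.nat 5 (σ.nat vI 0))).setReal 4
      (σ.nat vI 0)
      (if σ.nat vMode 0 = 0 then σ.real 1 (σ.nat vI 0) else σ.real 2 (σ.nat vI 0)) := by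
  by_cases h : σ.nat vMode 0 = 0 <;>
    simp [loadCap, block, Prog.run, NExpr.eval, RExpr.eval, Test.Holds, h]

/-- The arcs of the warehouses and the capacities have been stored for the warehouses below `i`. -/
structure Warehouses (i n : ℕ) (f : ℕ → ℕ) (D : ℕ → ℝ) (σ : Store) : Prop where
  tl : ∀ w < i, σ.nat nTl w = w ∧ σ.nat nTl (n + w) = n + n + w ∧
    σ.nat nTl (n + n + w) = n + n + n
  hd : ∀ w < i, σ.nat nHd w = n + n + w ∧ σ.nat nHd (n + w) = n + w ∧
    σ.nat nHd (n + n + w) = n + n + w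
  flag : ∀ w < i, σ.nat nFlag w = f w
  cap : ∀ w < i, σ.real 4 w = D w

theorem loadWarehouses_runs {σ : Store} (h : Dims m n σ) (hs : Source m n s d f D σ) :
    Runs loadWarehouses σ (150 * n + 20) (Warehouses n n f D) := by
  let Inv : ℕ → Store → Prop := fun i τ => τ.nat vI 0 = i ∧ Warehouses i n f D τ
  unfold loadWarehouses
  refine Runs.mono (Runs.seq (Runs.flat (T := 3) (Q := fun τ => (Dims m n τ ∧
    Source m n s d f D τ) ∧ Inv 0 τ) rfl (by decide) ?_)
    (fun τ h => Runs.loop_up (Inv := Inv) 130 n h.2 ?_ ?_)) ?_ (fun _ h => h)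
  · refine ⟨⟨h.congr (by simp [Prog.run]), hs.congr (by simp [Prog.run]) (by simp [Prog.run])⟩, ?_⟩
    refine ⟨by simp [Prog.run, NExpr.eval], ?_, ?_, ?_, ?_⟩ <;> simp
  · rintro i hi τ' hk ⟨h1, h2, h3, h4, h5⟩
    obtain ⟨⟨hr, hs⟩, -⟩ := h
    replace hr : Dims m n τ' := hr.congr fun a ha => hk.nat a (by revert a; decide)
    replace hs : Source m n s d f D τ' := hs.congr (fun a ha => hk.nat a (by revert a; decide))
      fun a ha => hk.real a (by revert a; decide)
    refine ⟨by simpa [Test.Holds, NExpr.eval, h1, hr.n1] using hi, Runs.flat rfl (by decide) ?_⟩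
    refine ⟨by simp [block, Prog.run, NExpr.eval, run_loadCap, h1], ?_, ?_, ?_, ?_⟩ <;>
      intro w hw <;>
      simp only [block, Prog.run, NExpr.eval, run_loadCap, h1, hr.n1, hr.n2, hr.n3, nat_setNat_self,
        ne_eq, Nat.reduceEqDiff, not_false_eq_true, nat_setNat_of_ne, nat_setReal, real_setNat,
        real_setReal_self, hs.flag i hi, hs.cap i hi]
    · have h6 : w < i → _ := h2 w
      simp only [Function.update_apply]
      refine ⟨?_, ?_, ?_⟩ <;> split_ifs <;> omega
    · have h6 : w < i → _ := h3 w
      simp only [Function.update_apply]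
      refine ⟨?_, ?_, ?_⟩ <;> split_ifs <;> omega
    · by_cases h6 : w = i
      · rw [h6, Function.update_self]
      · rw [Function.update_of_ne h6, h4 w (by omega)]
    · by_cases h6 : w = i
      · rw [h6, Function.update_self]
      · rw [Function.update_of_ne h6, h5 w (by omega)]
  · rintro τ' hk ⟨h1, h2⟩
    replace h := h.1.1.congr (τ := τ') fun a ha => hk.nat a (by revert a; decide)
    exact ⟨by simp [Test.Holds, NExpr.eval, h1, h.n1], h2⟩
  · simp [Test.cost, NExpr.cost]
    omega

theorem loadProducts_runs {σ : Store} (h : Dims m n σ) (hs : Source m n s d f D σ)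
    (hw : Warehouses n n f D σ) (hcnt : ∀ w < n, σ.nat nCnt w = 0) :
    Runs loadProducts σ (150 * m + 20) fun τ => Network m n s d (τ.nat nTl) (τ.nat nHd) ∧
      (∀ w < n, τ.nat nCnt w = count s (Finset.range m) w) ∧ ∀ p < m, τ.nat nNxt p = p := by
  let Inv : ℕ → Store → Prop := fun i τ => τ.nat vI 0 = i ∧
    (∀ e < n + n + n, τ.nat nTl e = σ.nat nTl e ∧ τ.nat nHd e = σ.nat nHd e) ∧
    (∀ p < i, τ.nat nTl (n + n + n + p) = n + s p ∧ τ.nat nHd (n + n + n + p) = d p) ∧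
    (∀ w < n, τ.nat nCnt w = count s (Finset.range i) w) ∧ ∀ p < i, τ.nat nNxt p = p
  unfold loadProducts
  refine Runs.mono (Runs.seq (Runs.flat (T := 3) (Q := fun τ => (Dims m n τ ∧
    Source m n s d f D τ) ∧ Inv 0 τ) rfl (by decide) ?_)
    (fun τ h => Runs.loop_up (Inv := Inv) 130 m h.2 ?_ ?_)) ?_ (fun _ h => h)
  · refine ⟨⟨h.congr (by simp [Prog.run]), hs.congr (by simp [Prog.run]) (by simp [Prog.run])⟩, ?_⟩
    refine ⟨by simp [Prog.run, NExpr.eval], ?_, ?_, ?_, ?_⟩ <;> simp [Prog.run, count]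
    simpa using hcnt
  · rintro i hi τ' hk ⟨h1, h2, h3, h4, h5⟩
    obtain ⟨⟨hr, hs⟩, -⟩ := h
    replace hr : Dims m n τ' := hr.congr fun a ha => hk.nat a (by revert a; decide)
    replace hs : Source m n s d f D τ' := hs.congr (fun a ha => hk.nat a (by revert a; decide))
      fun a ha => hk.real a (by revert a; decide)
    refine ⟨by simpa [Test.Holds, NExpr.eval, h1, hr.m1] using hi, Runs.flat rfl (by decide) ?_⟩
    simp only [Inv, block, Prog.run, NExpr.eval, run_loadArc, h1, hr.n1, hr.n3,
      nat_setNat_self, ne_eq, Nat.reduceEqDiff, not_false_eq_true, nat_setNat_of_ne,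
      Function.update_self, hs.src i hi, hs.tgt i hi, Nat.add_sub_cancel_left]
    refine ⟨trivial, fun e he => ?_, fun p hp => ?_, fun w hw => ?_, fun p hp => ?_⟩
    · rw [Function.update_of_ne (by omega), Function.update_of_ne (by omega)]
      exact h2 e he
    · by_cases h6 : p = i
      · simp [h6]
      · rw [Function.update_of_ne (by omega), Function.update_of_ne (by omega)]
        exact h3 p (by omega)
    · rw [Finset.range_add_one, count_insert (by simp), ← h4 w hw, Function.update_apply]
      by_cases h6 : s i = w
      · simp [h6]
      · simp [h6, Ne.symm h6]
    · by_cases h6 : p = i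
      · rw [h6, Function.update_self]
      · rw [Function.update_of_ne h6, h5 p (by omega)]
  · rintro τ' hk ⟨h1, h2, h3, h4, h5⟩
    replace h := h.1.1.congr (τ := τ') fun a ha => hk.nat a (by revert a; decide)
    refine ⟨by simp [Test.Holds, NExpr.eval, h1, h.m1], ⟨?_, ?_, ?_, ?_, ?_, ?_, ?_, ?_,
      hs.src_lt, hs.tgt_lt⟩, h4, h5⟩
    · exact fun w hn => (h2 w (by omega)).1.trans (hw.tl w hn).1
    · exact fun w hn => (h2 w (by omega)).2.trans (hw.hd w hn).1
    · exact fun w hn => (h2 _ (by omega)).1.trans (hw.tl w hn).2.1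
    · exact fun w hn => (h2 _ (by omega)).2.trans (hw.hd w hn).2.1
    · exact fun w hn => (h2 _ (by omega)).1.trans (hw.tl w hn).2.2
    · exact fun w hn => (h2 _ (by omega)).2.trans (hw.hd w hn).2.2
    · exact fun p hp => (h3 p hp).1
    · exact fun p hp => (h3 p hp).2
  · simp [Test.cost, NExpr.cost]
    omega

end RAM

namespace RAM

open Rounding

/-! ### The program for the number of time steps -/

/-- Compute in `vB` how many of the `vA` products leaving the warehouse `vI` may leave at once. -/
def countQuota : Prog := .seq (block [set vA (.get nCnt (var vI)), set vB (.lit 0), set vJ (.lit 0),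
    .setReal 5 (.lit 0) (.get 4 (var vI))])
  (.ite (.natEq (.get nFlag (var vI)) (.lit 1)) (set vB (var vA))
    (.loop (.natLt (var vJ) (var vA)) (block [
      .ite (.realLe (.get 0 (.lit 0)) (.get 5 (.lit 0)))
        (block [.setReal 5 (.lit 0) (.sub (.get 5 (.lit 0)) (.get 0 (.lit 0))),
          set vB (.add (var vB) (.lit 1))]) .skip,
      set vJ (.add (var vJ) (.lit 1))])))

/-- Compute in `vR` how many time steps `vA` products need if `vB` of them may leave at once. -/
def countSteps : Prog := .seq (block [set vR (.lit 0), set vT (var vA)])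
  (.loop (.natLt (.lit 0) (var vT))
    (block [set vT (.sub (var vT) (var vB)), set vR (.add (var vR) (.lit 1))]))

/-- Compute in `vRho` the number of time steps that suffice for every warehouse. -/
def countRounds : Prog := .seq (block [set vI (.lit 0), set vRho (.lit 1)])
  (.loop (.natLt (var vI) (var vN)) (.seq countQuota (.seq countSteps (block [
    .ite (.natLt (var vRho) (var vR)) (set vRho (var vR)) .skip,
    set vI (.add (var vI) (.lit 1))]))))

open Classical in
/-- How many of `a` products of size `k` may leave at once if the capacity is infinite (`F = 1`), or
`D`.  No division is needed for this. -/
def quota (k D : ℝ) (F a : ℕ) : ℕ :=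
  if F = 1 then a else Nat.findGreatest (fun q => (q : ℝ) * k ≤ D) a

theorem quota_le (k D : ℝ) (F a : ℕ) : quota k D F a ≤ a := by
  unfold quota
  split_ifs
  · exact le_rfl
  · exact Nat.findGreatest_le a

theorem quota_mul_le {k D : ℝ} {F : ℕ} (hD : 0 ≤ D) (hF : F ≠ 1) (a : ℕ) :
    (quota k D F a : ℝ) * k ≤ D := by
  classical
  rw [quota, if_neg hF]
  exact Nat.findGreatest_spec (P := fun q : ℕ => (q : ℝ) * k ≤ D) (Nat.zero_le a) (by simpa using hD)

theorem lt_quota_add_one_mul {k D : ℝ} {F a : ℕ} (h : quota k D F a < a) (hF : F ≠ 1) :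
    D < ((quota k D F a + 1 : ℕ) : ℝ) * k := by
  classical
  rw [quota, if_neg hF] at h ⊢
  exact not_le.1 (Nat.findGreatest_is_greatest (P := fun q : ℕ => (q : ℝ) * k ≤ D) (Nat.lt_succ_self _) h)

theorem countQuota_runs {σ : Store} {i a F : ℕ} {k D : ℝ} (hi : σ.nat vI 0 = i)
    (ha : σ.nat nCnt i = a) (hF : σ.nat nFlag i = F) (hD : σ.real 4 i = D) (hk : σ.real 0 0 = k)
    (hk0 : 0 ≤ k) :
    Runs countQuota σ (40 * a + 40) fun τ => τ.nat vA 0 = a ∧ τ.nat vB 0 = quota k D F a := by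
  classical
  let P : ℕ → Prop := fun q => (q : ℝ) * k ≤ D
  have hP : ∀ {q q'}, q ≤ q' → P q' → P q := fun {q q'} hq h =>
    le_trans (mul_le_mul_of_nonneg_right (by exact_mod_cast hq) hk0) h
  let Inv : ℕ → Store → Prop := fun j τ => τ.nat vJ 0 = j ∧ τ.nat vB 0 = Nat.findGreatest P j ∧
    τ.real 5 0 = D - Nat.findGreatest P j * k
  unfold countQuota
  refine Runs.mono (Runs.seq (Runs.flat (T := 20) (Q := fun τ => (τ.nat vI 0 = i ∧
    τ.nat vA 0 = a ∧ τ.nat nFlag i = F ∧ τ.real 0 0 = k) ∧ Inv 0 τ) rfl (by decide) ?_)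
    (fun τ h => ?_) (T₂ := 10 + (a * 40 + 5))) ?_ (fun _ h => h)
  · simp [Inv, block, Prog.run, NExpr.eval, RExpr.eval, hi, ha, hF, hD, hk]
  · obtain ⟨⟨hi, ha, hF, hk⟩, h⟩ := h
    by_cases h1 : F = 1
    · refine Runs.mono (Runs.ite_true ?_ (Runs.flat (T := 10) rfl (by decide) ?_)) ?_ fun _ h => h
      · simp [Test.Holds, NExpr.eval, hi, hF, h1]
      · simp [Prog.run, NExpr.eval, ha, quota, h1]
      · simp [Test.cost, NExpr.cost]
        omega
    · refine Runs.mono (Runs.ite_false ?_ (Runs.loop_up (Inv := Inv) 32 a h ?_ ?_)) ?_ fun _ h => h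
      · simp [Test.Holds, NExpr.eval, hi, hF, h1]
      · rintro j hj τ' hk' ⟨h2, h3, h4⟩
        rw [← hk'.nat _ (by decide)] at ha
        rw [← hk'.real _ (by decide)] at hk
        refine ⟨by simpa [Test.Holds, NExpr.eval, h2, ha] using hj, Runs.flat rfl (by decide) ?_⟩
        have hle := Nat.findGreatest_le (P := P) j
        have h5 : k ≤ D - Nat.findGreatest P j * k ↔ P (j + 1) := by
          constructor
          · intro h
            rcases hle.lt_or_eq with h6 | h6
            · refine absurd ?_ (Nat.findGreatest_is_greatest (P := P) (Nat.lt_succ_self _) h6)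
              simp only [P]
              push_cast
              linarith
            · rw [h6] at h
              simp only [P]
              push_cast
              linarith
          · intro h
            have h6 : Nat.findGreatest P j = j := Nat.findGreatest_eq (hP (Nat.le_succ j) h)
            simp only [P] at h
            push_cast at h
            rw [h6]
            linarith
        by_cases h6 : P (j + 1)
        · have h7 : Nat.findGreatest P j = j := Nat.findGreatest_eq (hP (Nat.le_succ j) h6)
          have h8 : Nat.findGreatest P (j + 1) = j + 1 := Nat.findGreatest_eq h6
          have h9 := h5.2 h6
          rw [h7] at h3 h4 h9
          simp only [Inv, h8]
          simp [block, Prog.run, NExpr.eval, RExpr.eval, Test.Holds, h2, h3, h4, hk, h9]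
          ring
        · have h9 : ¬ k ≤ D - Nat.findGreatest P j * k := fun h => h6 (h5.1 h)
          simp only [Inv, Nat.findGreatest_succ, if_neg h6]
          simp [block, Prog.run, NExpr.eval, RExpr.eval, Test.Holds, h2, h3, h4, hk, h9]
      · rintro τ' hk' ⟨h2, h3, h4⟩
        rw [← hk'.nat _ (by decide)] at ha
        refine ⟨by simp [Test.Holds, NExpr.eval, h2, ha], ha, ?_⟩
        rw [h3, quota, if_neg h1]
      · simp [Test.cost, NExpr.cost]
        omega
  · omega

theorem ceil_div_le {a q : ℕ} (h0 : 0 < a → 0 < q) : (a + q - 1) / q ≤ a := by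
  rcases Nat.eq_zero_or_pos a with rfl | h
  · rcases Nat.eq_zero_or_pos q with rfl | h'
    · simp
    · rw [Nat.div_eq_of_lt (by omega)]
  · have := h0 h
    rw [Nat.div_le_iff_le_mul_add_pred this]
    have := Nat.le_mul_of_pos_left a this
    omega

theorem countSteps_runs {σ : Store} {a q : ℕ} (ha : σ.nat vA 0 = a) (hq : σ.nat vB 0 = q)
    (hqa : q ≤ a) (h0 : 0 < a → 0 < q) :
    Runs countSteps σ (20 * a + 20) fun τ => τ.nat vR 0 = (a + q - 1) / q := by
  let Inv : ℕ → Store → Prop := fun i τ => τ.nat vR 0 = i ∧ τ.nat vT 0 = a - i * q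
  have hle : (a + q - 1) / q ≤ a := ceil_div_le h0
  have hlt : ∀ i < (a + q - 1) / q, i * q < a := by
    intro i hi
    have h1 : 0 < q := Nat.pos_of_ne_zero fun h => by simp [h] at hi
    have := (Nat.le_div_iff_mul_le h1).1 hi
    rw [Nat.succ_mul] at this
    omega
  have hge : a ≤ (a + q - 1) / q * q := by
    rcases Nat.eq_zero_or_pos a with h | h
    · omega
    · have h1 := h0 h
      have := Nat.lt_div_mul_add h1 (a := a + q - 1)
      omega
  unfold countSteps
  refine Runs.mono (Runs.seq (Runs.flat (T := 10) (Q := fun τ => τ.nat vB 0 = q ∧ Inv 0 τ) rfl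
    (by decide) ?_) (fun τ h => Runs.loop_up (Inv := Inv) 14 ((a + q - 1) / q) h.2 ?_ ?_)) ?_
    (fun _ h => h)
  · simp [Inv, block, Prog.run, NExpr.eval, ha, hq]
  · rintro i hi τ' hk ⟨h2, h3⟩
    have hq : τ'.nat vB 0 = q := by rw [hk.nat _ (by decide), h.1]
    have := hlt i hi
    refine ⟨by simp [Test.Holds, NExpr.eval, h3]; omega, Runs.flat rfl (by decide) ?_⟩
    simp only [Inv, Nat.succ_mul, ← Nat.sub_sub]
    simp [block, Prog.run, NExpr.eval, h2, h3, hq]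
  · rintro τ' hk ⟨h2, h3⟩
    exact ⟨by simp [Test.Holds, NExpr.eval, h3]; omega, h2⟩
  · simp [Test.cost, NExpr.cost]
    omega

theorem countRounds_runs {n : ℕ} {σ : Store} {a F : ℕ → ℕ} {k : ℝ} {D : ℕ → ℝ}
    (hn : σ.nat vN 0 = n) (ha : ∀ w < n, σ.nat nCnt w = a w) (hF : ∀ w < n, σ.nat nFlag w = F w)
    (hD : ∀ w < n, σ.real 4 w = D w) (hk : σ.real 0 0 = k) (hk0 : 0 ≤ k)
    (hpos : ∀ w < n, 0 < a w → 0 < quota k (D w) (F w) (a w)) {m : ℕ} (hm : ∀ w < n, a w ≤ m) :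
    Runs countRounds σ (n * (60 * m + 100) + 20) fun τ => τ.nat vRho 0 = max 1
      ((Finset.range n).sup fun w => (a w + quota k (D w) (F w) (a w) - 1) /
        quota k (D w) (F w) (a w)) := by
  let R : ℕ → ℕ := fun w => (a w + quota k (D w) (F w) (a w) - 1) / quota k (D w) (F w) (a w)
  let Inv : ℕ → Store → Prop := fun i τ => τ.nat vI 0 = i ∧
    τ.nat vRho 0 = max 1 ((Finset.range i).sup R)
  unfold countRounds
  refine Runs.mono (Runs.seq (Runs.flat (T := 10) (Q := fun τ => (τ.nat vN 0 = n ∧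
    τ.nat nCnt = σ.nat nCnt ∧ τ.nat nFlag = σ.nat nFlag ∧ τ.real 4 = σ.real 4 ∧
    τ.real 0 = σ.real 0) ∧ Inv 0 τ) rfl (by decide) ?_)
    (fun τ h => Runs.loop_up (Inv := Inv) ((40 * m + 40) + ((20 * m + 20) + 30)) n h.2 ?_ ?_)) ?_
    (fun _ h => h)
  · simp [Inv, block, Prog.run, NExpr.eval, hn]
  · rintro i hi τ₁ k₁ ⟨h1, h2⟩
    obtain ⟨⟨e1, e2, e3, e4, e5⟩, -⟩ := h
    rw [← k₁.nat _ (by decide)] at e1 e2 e3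
    rw [← k₁.real _ (by decide)] at e4 e5
    refine ⟨by simpa [Test.Holds, NExpr.eval, h1, e1] using hi, ?_⟩
    refine Runs.seq ((countQuota_runs (a := a i) (F := F i) (D := D i) (k := k) h1
      (by rw [e2, ha i hi]) (by rw [e3, hF i hi]) (by rw [e4, hD i hi]) (by rw [e5, hk]) hk0).keeps.mono
      (Nat.add_le_add_right (Nat.mul_le_mul_left _ (hm i hi)) _) fun _ h => h) ?_
    rintro τ₂ ⟨k₂, h3, h4⟩
    refine Runs.seq ((countSteps_runs h3 h4 (quota_le _ _ _ _) (hpos i hi)).keeps.mono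
      (Nat.add_le_add_right (Nat.mul_le_mul_left _ (hm i hi)) _) fun _ h => h) ?_
    rintro τ₃ ⟨k₃, h5⟩
    rw [← k₂.nat _ (by decide), ← k₃.nat _ (by decide)] at h1 h2
    refine Runs.flat rfl (by decide) ?_
    change _ = R i at h5
    simp only [Inv, Finset.range_add_one, Finset.sup_insert]
    rw [max_left_comm, ← h2, max_comm (R i)]
    by_cases h6 : τ₃.nat vRho 0 < R i
    · simp [block, Prog.run, NExpr.eval, Test.Holds, h1, h5, h6, max_eq_right h6.le]
    · simp [block, Prog.run, NExpr.eval, Test.Holds, h1, h5, h6, max_eq_left (not_lt.1 h6)]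
  · rintro τ' hk' ⟨h2, h3⟩
    have e1 : τ'.nat vN 0 = n := by rw [hk'.nat _ (by decide), h.1.1]
    exact ⟨by simp [Test.Holds, NExpr.eval, h2, e1], h3⟩
  · simp only [Test.cost, NExpr.cost]
    have : n * (60 * m + 100) = n * (60 * m + 95) + n * 5 := by ring
    ring_nf
    omega

end RAM

namespace RAM

open Rounding

/-! ### The number of time steps and the shares of an instance -/

/-- The function on all natural numbers given by `g` on the products. -/
def natMap {m n : ℕ} (g : Fin m → Fin n) : ℕ → ℕ := array fun p => (g p : ℕ)

theorem array_val {α : Type} [Zero α] {m : ℕ} (f : Fin m → α) (p : Fin m) : array f p = f p := by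
  simp [array]

theorem card_filter_range {m : ℕ} (P : ℕ → Prop) [DecidablePred P] :
    ((Finset.range m).filter P).card = (Finset.univ.filter fun p : Fin m => P p).card := by
  rw [Finset.card_filter, Finset.card_filter, Fin.sum_univ_eq_sum_range (fun p => if P p then 1 else 0)]

theorem count_natMap {m n : ℕ} (g : Fin m → Fin n) (w : Fin n) :
    count (natMap g) (Finset.range m) w = (Finset.univ.filter fun p => g p = w).card := by
  rw [count, card_filter_range]
  simp [natMap, array_val, Fin.val_inj]

theorem count_natMap_filter {m n : ℕ} (g : Fin m → Fin n) (κ : ℕ → ℕ) (w : Fin n) (i : ℕ) :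
    count (natMap g) ((Finset.range m).filter fun p => κ p = i) w =
      Realloc.colourCount g (fun p => κ p) w i := by
  rw [count, Finset.filter_filter, card_filter_range, Realloc.colourCount]
  simp [natMap, array_val, Fin.val_inj, and_comm]

variable {m n : ℕ}

theorem quota_pos (J : Realloc m n) {k : ℝ≥0} (hsize : ∀ p, J.size p = k) (w : Fin n)
    (h : 0 < J.numOut w) : 0 < quota k (J.dOut w).toReal (flag (J.dOut w)) (J.numOut w) := by
  have hk : (k : ℝ≥0∞) ≤ J.dOut w := by
    obtain ⟨p, hp⟩ := Finset.card_pos.1 h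
    have := J.size_le_dOut p
    rwa [hsize, (Finset.mem_filter.1 hp).2] at this
  unfold flag
  split_ifs with hd
  · simpa [quota] using h
  · by_contra hq
    have h1 := lt_quota_add_one_mul (k := k) (D := (J.dOut w).toReal) (F := 0) (a := J.numOut w)
      (by omega) (by simp)
    rw [show quota k (J.dOut w).toReal 0 (J.numOut w) = 0 by omega] at h1
    have h2 := ENNReal.toReal_mono hd hk
    simp at h1 h2
    linarith

theorem max_one_rounds_eq (J : Realloc m n) {k : ℝ≥0} (hsize : ∀ p, J.size p = k) (w : Fin n) :
    max 1 (Realloc.rounds k (J.numOut w) (J.dOut w)) = max 1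
      ((J.numOut w + quota k (J.dOut w).toReal (flag (J.dOut w)) (J.numOut w) - 1) /
        quota k (J.dOut w).toReal (flag (J.dOut w)) (J.numOut w)) := by
  have hq : ∀ q : ℕ, (q : ℝ≥0∞) * k = ENNReal.ofReal (q * k) := fun q => by
    rw [ENNReal.ofReal_mul (by positivity)]
    simp
  refine Realloc.max_one_rounds (quota_le _ _ _ _) (fun h => ?_) (fun h => ?_) ?_ fun h h' => ?_
  · obtain ⟨p, hp⟩ := Finset.card_pos.1 h
    have := J.size_le_dOut p
    rwa [hsize, (Finset.mem_filter.1 hp).2] at this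
  · simp [flag, h, quota]
  · rcases eq_or_ne (J.dOut w) ⊤ with h | h
    · simp [h]
    · rw [hq, ENNReal.ofReal_le_iff_le_toReal h]
      exact quota_mul_le ENNReal.toReal_nonneg (by simp [flag, h]) _
  · rw [hq, ENNReal.lt_ofReal_iff_toReal_lt h]
    exact lt_quota_add_one_mul h' (by simp [flag, h])

/-- The number of time steps in terms of the data that the program has. -/
theorem rhoMax_eq (J : Realloc m n) {k : ℝ≥0} (hsize : ∀ p, J.size p = k)
    (hin : ∀ w, J.dIn w = ⊤) : J.rhoMax k = max 1 ((Finset.range n).sup fun w =>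
      (count (natMap J.src) (Finset.range m) w + quota k (array (fun w => (J.dOut w).toReal) w)
        (array (fun w => flag (J.dOut w)) w) (count (natMap J.src) (Finset.range m) w) - 1) /
        quota k (array (fun w => (J.dOut w).toReal) w) (array (fun w => flag (J.dOut w)) w)
          (count (natMap J.src) (Finset.range m) w)) := by
  have h0 : ∀ a, Realloc.rounds k a ⊤ = 0 := fun a => by
    rcases eq_zero_or_pos k with rfl | hk
    · exact Realloc.rounds_size_zero _ _
    · exact Realloc.rounds_of_floor_top _ (by simp [ENNReal.top_div])
  refine eq_of_forall_ge_iff fun N => ?_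
  rw [Realloc.rhoMax, max_le_iff, max_le_iff, Finset.sup_le_iff, Finset.sup_le_iff]
  refine and_congr_right fun hN => ?_
  have key : ∀ w : Fin n, max (Realloc.rounds k (J.numOut w) (J.dOut w))
      (Realloc.rounds k (J.numIn w) (J.dIn w)) ≤ N ↔
      (count (natMap J.src) (Finset.range m) w + quota k (array (fun w => (J.dOut w).toReal) w)
        (array (fun w => flag (J.dOut w)) w) (count (natMap J.src) (Finset.range m) w) - 1) /
        quota k (array (fun w => (J.dOut w).toReal) w) (array (fun w => flag (J.dOut w)) w)
          (count (natMap J.src) (Finset.range m) w) ≤ N := fun w => by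
    have h1 := max_one_rounds_eq J hsize w
    rw [hin, h0, count_natMap, array_val, array_val, max_eq_left (Nat.zero_le _)]
    change _ ↔ (J.numOut w + _ - 1) / _ ≤ N
    have h2 : Realloc.rounds k (J.numOut w) (J.dOut w) ≤ N ↔
      max 1 (Realloc.rounds k (J.numOut w) (J.dOut w)) ≤ N := by simp [hN]
    rw [h2, h1]
    simp [hN, Realloc.numOut]
  constructor
  · intro h w hw
    exact (key ⟨w, Finset.mem_range.1 hw⟩).1 (h _ (Finset.mem_univ _))
  · intro h w _
    exact (key w).2 (h w (Finset.mem_range.2 w.2))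

theorem share_all (s d : ℕ → ℕ) {ρ : ℕ} (hρ : 0 < ρ) (G : Finset ℕ) :
    Share n s d (count s G) (count d G) ρ ρ G :=
  ⟨fun _ _ => Nat.mul_div_le _ _, fun _ _ => (Nat.lt_mul_div_succ _ hρ).le,
    fun _ _ => Nat.mul_div_le _ _, fun _ _ => (Nat.lt_mul_div_succ _ hρ).le, fun _ _ h => h,
    fun _ _ h => h⟩

theorem Coloured.balanced {J : Realloc m n} {ρ R : ℕ} {l : List ℕ} {σ τ : Store}
    (h : Coloured m n (natMap J.src) (natMap J.tgt) (count (natMap J.src) (Finset.range m))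
      (count (natMap J.tgt) (Finset.range m)) ρ R 0 ρ l σ τ) (hl : l.toFinset = Finset.range m) :
    J.Balanced ρ (fun p => τ.nat nKey p) := by
  have hshare := h.share
  rw [hl] at hshare
  refine ⟨fun p => ?_, fun w i hi => ?_, fun w i hi => ?_, fun w i hi => ?_, fun w i hi => ?_,
    fun w i hi hw => ?_, fun w i hi hw => ?_⟩
  · have hp : (p : ℕ) ∈ l := by
      rw [← List.mem_toFinset, hl, Finset.mem_range]
      exact p.2
    have := (h.key p hp).2
    omega
  all_goals have hs := hshare i (Nat.zero_le i) (by omega)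
  · have := hs.out_ge w w.2
    rwa [count_natMap_filter, count_natMap, one_mul] at this
  · have := hs.out_le w w.2
    rwa [count_natMap_filter, count_natMap, one_mul] at this
  · have := hs.in_ge w w.2
    rwa [count_natMap_filter, count_natMap, one_mul] at this
  · have := hs.in_le w w.2
    rwa [count_natMap_filter, count_natMap, one_mul] at this
  · have := hs.surplus w w.2 (by rwa [count_natMap, count_natMap])
    rwa [count_natMap_filter, count_natMap_filter] at this
  · have := hs.deficit w w.2 (by rwa [count_natMap, count_natMap])
    rwa [count_natMap_filter, count_natMap_filter] at this

end RAM

namespace RAM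

open Rounding

/-! ### The whole program -/

/-- Set up the lists of the colour classes and colour all products. -/
def colourAll : Prog := .seq (block [.setNat nEn (.lit 0) (var vRho),
  .setNat nHead (.lit 0) (var vM), set vLo (.lit 0)]) colour

/-- Compute a balanced colouring of the products in the direction `vMode`. -/
def schedule : Prog := .seq loadWarehouses (.seq loadProducts (.seq countRounds colourAll))

/-- Read the numbers of products and warehouses. -/
def readDims : Prog := block [set vM (.get 0 (.lit 0)), set vN (.get 0 (.lit 1)),
  set vN2 (.add (var vN) (var vN)), set vN3 (.add (var vN2) (var vN))]

/-- Set `vMode` to `0` if all carry-in capacities are infinite, and to `1` otherwise. -/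
def chooseMode : Prog := .seq (block [set vI (.lit 0), set vMode (.lit 0)])
  (.loop (.natLt (var vI) (var vN)) (block [
    .ite (.natEq (.get 5 (var vI)) (.lit 0)) (set vMode (.lit 1)) .skip,
    set vI (.add (var vI) (.lit 1))]))

/-- Reverse the schedule in time. -/
def reverse : Prog := .seq (block [set vI (.lit 0), set vT (.lit 0)])
  (.seq (.loop (.natLt (var vI) (var vM)) (block [
    .ite (.natLt (var vT) (.add (.get nKey (var vI)) (.get 3 (var vI))))
      (set vT (.add (.get nKey (var vI)) (.get 3 (var vI)))) .skip,
    set vI (.add (var vI) (.lit 1))]))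
  (.seq (set vI (.lit 0))
  (.loop (.natLt (var vI) (var vM)) (block [
    .setNat nKey (var vI) (.sub (var vT) (.add (.get nKey (var vI)) (.get 3 (var vI)))),
    set vI (.add (var vI) (.lit 1))]))))

/-- The program for the reallocation problem with uniform product size. -/
def program : Prog := .seq readDims (.seq chooseMode (.seq schedule
  (.ite (.natEq (var vMode) (.lit 0)) .skip reverse)))

variable {m n : ℕ}

theorem chain_range {nxt : ℕ → ℕ} {k : ℕ} (h : ∀ p < k, nxt p = p) :
    Chain nxt k (List.range k).reverse := by
  induction k with
  | zero => rfl
  | succ k ih =>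
    rw [List.range_succ, List.reverse_append]
    refine ⟨rfl, ?_⟩
    rw [h k (Nat.lt_succ_self k)]
    exact ih fun p hp => h p (by omega)

theorem colourAll_runs {s d o r : ℕ → ℕ} {ρ R : ℕ} {σ : Store} (hn : 0 < n) (hR : 0 < R)
    (h : Ready m n s d σ) (hm : σ.nat vM 0 = m) (hρ : σ.nat vRho 0 = R)
    (hS : Share n s d o r ρ R (Finset.range m)) (hnxt : ∀ p < m, σ.nat nNxt p = p)
    (hkey : ∀ p < m, σ.nat nKey p = 0) :
    Runs colourAll σ (4000 * (n * (m * Nat.clog 2 R + 2 * R - 1)) + 30) fun τ => ∃ σ' l,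
      l.toFinset = Finset.range m ∧ Coloured m n s d o r ρ R 0 R l σ' τ := by
  unfold colourAll
  refine Runs.mono (Runs.seq (Runs.flat (T := 20) (Q := fun τ =>
    Pending m n s d o r ρ R 0 R (List.range m).reverse τ) rfl (by decide) ?_)
    (fun τ h => colour_runs hn hR h (T := 5) (Q := fun τ => ∃ σ' l,
      l.toFinset = Finset.range m ∧ Coloured m n s d o r ρ R 0 R l σ' τ) fun τ' h' => ?_)) ?_
    (fun _ h => h)
  · refine ⟨h.congr (by simp [block, Prog.run]), ?_, ?_, by omega, ?_, ?_, ?_, ?_, ?_, ?_⟩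
    · simp [block, Prog.run, hρ]
    · simp [block, Prog.run, NExpr.eval]
    · simp [block, Prog.run, NExpr.eval, hρ]
    · simpa [block, Prog.run, NExpr.eval, hm] using chain_range hnxt
    · exact List.nodup_reverse.2 List.nodup_range
    · simp
    · convert hS using 1
      ext p
      simp
    · simpa [block, Prog.run, NExpr.eval] using hkey
  · refine Runs.loop_exit (b := .natLt (var vLo) (var vRho)) (Q := fun τ => ∃ σ' l,
      l.toFinset = Finset.range m ∧ Coloured m n s d o r ρ R 0 R l σ' τ) ?_
      ⟨τ, _, by ext p; simp, h'⟩
    simp [Test.Holds, NExpr.eval, h'.current, h'.colours]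
  · simp only [List.length_reverse, List.length_range]
    omega

theorem rhoMax_le (J : Realloc m n) {k : ℝ≥0} (hsize : ∀ p, J.size p = k)
    (hin : ∀ w, J.dIn w = ⊤) (hm : 0 < m) : J.rhoMax k ≤ m := by
  rw [rhoMax_eq J hsize hin, max_le_iff, Finset.sup_le_iff]
  refine ⟨hm, fun w hw => ?_⟩
  lift w to Fin n using Finset.mem_range.1 hw
  rw [count_natMap, array_val, array_val]
  exact (ceil_div_le (quota_pos J hsize w)).trans ((Finset.card_le_univ _).trans_eq (by simp))

theorem schedule_runs {J : Realloc m n} {k : ℝ≥0} {σ : Store} (hsize : ∀ p, J.size p = k)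
    (hin : ∀ w, J.dIn w = ⊤) (hm : 0 < m) (h : Dims m n σ)
    (hs : Source m n (natMap J.src) (natMap J.tgt) (array fun w => flag (J.dOut w))
      (array fun w => (J.dOut w).toReal) σ) (hk : σ.real 0 0 = k)
    (hcnt : ∀ w < n, σ.nat nCnt w = 0) (hkey : ∀ p < m, σ.nat nKey p = 0) :
    Runs schedule σ (10000 * (n * (m * (Nat.clog 2 m + 1)))) fun τ =>
      J.Balanced (J.rhoMax k) fun p => τ.nat nKey p := by
  have hn : 0 < n := (Nat.zero_le _).trans_lt (J.src ⟨0, hm⟩).2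
  unfold schedule
  refine Runs.mono (Runs.seq (loadWarehouses_runs h hs).keeps ?_ (T₂ := (150 * m + 20) +
    ((n * (60 * m + 100) + 20) + (4000 * (n * (m * Nat.clog 2 m + 2 * m - 1)) + 30)))) ?_
    fun _ h => h
  · rintro τ₁ ⟨k₁, h₁⟩
    have d₁ : Dims m n τ₁ := h.congr fun a ha => k₁.nat a (by revert a; decide)
    have s₁ := hs.congr (τ := τ₁) (fun a ha => k₁.nat a (by revert a; decide))
      fun a ha => k₁.real a (by revert a; decide)
    rw [← k₁.nat _ (by decide)] at hcnt hkey
    rw [← k₁.real _ (by decide)] at hk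
    refine Runs.seq (loadProducts_runs d₁ s₁ h₁ hcnt).keeps ?_
    rintro τ₂ ⟨k₂, hnet, hcnt₂, hnxt⟩
    have d₂ : Dims m n τ₂ := d₁.congr fun a ha => k₂.nat a (by revert a; decide)
    rw [← k₂.nat _ (by decide)] at hkey
    rw [← k₂.real _ (by decide)] at hk
    refine Runs.seq (countRounds_runs (a := count (natMap J.src) (Finset.range m)) (m := m)
      (F := array fun w => flag (J.dOut w)) (D := array fun w => (J.dOut w).toReal) d₂.n1 hcnt₂
      ?_ ?_ hk k.2 ?_ ?_).keeps ?_
    · rw [k₂.nat _ (by decide)]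
      exact h₁.flag
    · rw [k₂.real _ (by decide)]
      exact h₁.cap
    · intro w hw
      lift w to Fin n using hw
      rw [count_natMap, array_val, array_val]
      exact quota_pos J hsize w
    · intro w _
      exact (Finset.card_filter_le _ _).trans_eq (Finset.card_range m)
    rintro τ₃ ⟨k₃, hρ⟩
    rw [← rhoMax_eq J hsize hin] at hρ
    have d₃ : Dims m n τ₃ := d₂.congr fun a ha => k₃.nat a (by revert a; decide)
    rw [← k₃.nat _ (by decide)] at hkey hnxt
    rw [← k₃.nat nTl (by decide), ← k₃.nat nHd (by decide)] at hnet
    refine Runs.mono (colourAll_runs hn (J.rhoMax_pos k) ⟨d₃.n1, d₃.n2, d₃.n3, hnet⟩ d₃.m1 hρ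
      (share_all (natMap J.src) (natMap J.tgt) (J.rhoMax_pos k) _) hnxt hkey) ?_ ?_
    · have hle := rhoMax_le J hsize hin hm
      gcongr
    · rintro τ₄ ⟨σ', l, hl, h4⟩
      exact h4.balanced hl
  · have e1 : m ≤ n * m := Nat.le_mul_of_pos_left m hn
    have e2 : n ≤ n * m := Nat.le_mul_of_pos_right n hm
    have e3 : n * (m * Nat.clog 2 m + 2 * m - 1) ≤ n * (m * Nat.clog 2 m + 2 * m) :=
      Nat.mul_le_mul_left _ (Nat.sub_le _ _)
    have e4 : 0 < n * m := Nat.mul_pos hn hm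
    nlinarith

theorem chooseMode_runs {I : Realloc m n} {σ : Store} (h : Dims m n σ)
    (hf : σ.nat 5 = array fun w => flag (I.dIn w)) : Runs chooseMode σ (40 * n + 20) fun τ =>
      (τ.nat vMode 0 = 0 ∧ ∀ w, I.dIn w = ⊤) ∨ (τ.nat vMode 0 = 1 ∧ ∃ w, I.dIn w ≠ ⊤) := by
  let Inv : ℕ → Store → Prop := fun i τ => τ.nat vI 0 = i ∧
    ((τ.nat vMode 0 = 0 ∧ ∀ w : Fin n, (w : ℕ) < i → I.dIn w = ⊤) ∨
      (τ.nat vMode 0 = 1 ∧ ∃ w, I.dIn w ≠ ⊤))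
  unfold chooseMode
  refine Runs.mono (Runs.seq (Runs.flat (T := 10) (Q := fun τ => (Dims m n τ ∧
    τ.nat 5 = array fun w => flag (I.dIn w)) ∧ Inv 0 τ) rfl (by decide) ?_)
    (fun τ h => Runs.loop_up (Inv := Inv) 20 n h.2 ?_ ?_)) ?_ (fun _ h => h)
  · refine ⟨⟨h.congr (by simp [block, Prog.run]), by simp [block, Prog.run, hf]⟩, ?_⟩
    simp [Inv, block, Prog.run, NExpr.eval]
  · rintro i hi τ' hk ⟨h1, h2⟩
    obtain ⟨⟨hr, hf⟩, -⟩ := h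
    rw [← hk.nat _ (by decide)] at hf
    replace hr : Dims m n τ' := hr.congr fun a ha => hk.nat a (by revert a; decide)
    refine ⟨by simpa [Test.Holds, NExpr.eval, h1, hr.n1] using hi, Runs.flat rfl (by decide) ?_⟩
    have h3 : τ'.nat 5 i = flag (I.dIn ⟨i, hi⟩) := by
      rw [hf]
      exact array_val _ ⟨i, hi⟩
    by_cases h4 : I.dIn ⟨i, hi⟩ = ⊤
    · rw [flag, if_pos h4] at h3
      refine ⟨by simp [block, Prog.run, NExpr.eval, Test.Holds, h1, h3], ?_⟩
      rcases h2 with ⟨h5, h6⟩ | ⟨h5, h6⟩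
      · refine Or.inl ⟨by simp [block, Prog.run, NExpr.eval, Test.Holds, h1, h3, h5],
          fun w hw => ?_⟩
        rcases Nat.lt_succ_iff_lt_or_eq.1 hw with h7 | h7
        · exact h6 w h7
        · obtain rfl : w = ⟨i, hi⟩ := Fin.ext h7
          exact h4
      · exact Or.inr ⟨by simp [block, Prog.run, NExpr.eval, Test.Holds, h1, h3, h5], h6⟩
    · rw [flag, if_neg h4] at h3
      exact ⟨by simp [block, Prog.run, NExpr.eval, Test.Holds, h1, h3],
        Or.inr ⟨by simp [block, Prog.run, NExpr.eval, Test.Holds, h1, h3], _, h4⟩⟩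
  · rintro τ' hk ⟨h1, h2⟩
    replace h := h.1.1.congr (τ := τ') fun a ha => hk.nat a (by revert a; decide)
    exact ⟨by simp [Test.Holds, NExpr.eval, h1, h.n1],
      h2.imp_left fun h => ⟨h.1, fun w => h.2 w w.2⟩⟩
  · simp [Test.cost, NExpr.cost]
    omega

theorem reverse_runs {σ : Store} {κ t : ℕ → ℕ} (hm : σ.nat vM 0 = m) (hκ : σ.nat nKey = κ)
    (ht : σ.nat 3 = t) : Runs reverse σ (100 * m + 60) fun τ =>
      ∀ p < m, τ.nat nKey p = (Finset.range m).sup (fun q => κ q + t q) - (κ p + t p) := by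
  let Inv : ℕ → Store → Prop := fun i τ => τ.nat vI 0 = i ∧
    τ.nat vT 0 = (Finset.range i).sup fun q => κ q + t q
  let Inv' : ℕ → Store → Prop := fun i τ => τ.nat vI 0 = i ∧
    (∀ p < i, τ.nat nKey p = (Finset.range m).sup (fun q => κ q + t q) - (κ p + t p)) ∧
    ∀ p ≥ i, τ.nat nKey p = κ p
  unfold reverse
  refine Runs.mono (Runs.seq (Runs.flat (T := 10) (Q := fun τ => (τ.nat vM 0 = m ∧ τ.nat nKey = κ ∧
    τ.nat 3 = t) ∧ Inv 0 τ) rfl (by decide) ?_) (T₂ := (m * 50 + 5) + (3 + (m * 50 + 5)))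
    (fun τ h => Runs.seq (Runs.mono (Runs.loop_up (Q := Inv m) (Inv := Inv) 40 m h.2 ?_ ?_) ?_
      (fun _ h => h)).keeps ?_)) ?_ (fun _ h => h)
  · simp [Inv, block, Prog.run, NExpr.eval, hm, hκ, ht]
  · rintro i hi τ' hk ⟨h1, h2⟩
    obtain ⟨⟨hm, hκ, ht⟩, -⟩ := h
    rw [← hk.nat _ (by decide)] at hm hκ ht
    refine ⟨by simpa [Test.Holds, NExpr.eval, h1, hm] using hi, Runs.flat rfl (by decide) ?_⟩
    simp only [Inv, Finset.range_add_one, Finset.sup_insert]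
    rw [← h2]
    by_cases h3 : τ'.nat vT 0 < κ i + t i
    · have := max_eq_left h3.le
      simp [block, Prog.run, NExpr.eval, Test.Holds, h1, hκ, ht, h3, this]
    · have := max_eq_right (not_lt.1 h3)
      simp [block, Prog.run, NExpr.eval, Test.Holds, h1, hκ, ht, h3, this]
  · rintro τ' hk ⟨h1, h2⟩
    have e1 : τ'.nat vM 0 = m := by rw [hk.nat _ (by decide), h.1.1]
    exact ⟨by simp [Test.Holds, NExpr.eval, h1, e1], h1, h2⟩
  · simp [Test.cost, NExpr.cost]
    omega
  · rintro τ₁ ⟨k₁, -, hT⟩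
    obtain ⟨⟨hm, hκ, ht⟩, -⟩ := h
    rw [← k₁.nat _ (by decide)] at hm hκ ht
    refine Runs.seq (Runs.flat (T := 3) (Q := fun τ => (τ.nat vM 0 = m ∧
      τ.nat vT 0 = (Finset.range m).sup (fun q => κ q + t q) ∧ τ.nat 3 = t) ∧ Inv' 0 τ) rfl
      (by decide) ?_) fun τ₂ h₂ => Runs.mono (Runs.loop_up (Inv := Inv') 40 m h₂.2 ?_ ?_) ?_
      fun _ h => h
    · simp [Inv', Prog.run, NExpr.eval, hm, hκ, ht, hT]
    · rintro i hi τ' hk ⟨h1, h2, h3⟩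
      obtain ⟨⟨hm, hT, ht⟩, -⟩ := h₂
      rw [← hk.nat _ (by decide)] at hm hT ht
      refine ⟨by simpa [Test.Holds, NExpr.eval, h1, hm] using hi, Runs.flat rfl (by decide) ?_⟩
      simp only [Inv', block, Prog.run, NExpr.eval, h1, hT, ht, h3 i le_rfl, nat_setNat_self, ne_eq,
        Nat.reduceEqDiff, not_false_eq_true, nat_setNat_of_ne, Function.update_self]
      refine ⟨trivial, fun p hp => ?_, fun p hp => ?_⟩
      · by_cases h6 : p = i
        · rw [h6, Function.update_self]
        · rw [Function.update_of_ne h6, h2 p (by omega)]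
      · rw [Function.update_of_ne (by omega), h3 p (by omega)]
    · rintro τ' hk ⟨h1, h2, -⟩
      have e1 : τ'.nat vM 0 = m := by rw [hk.nat _ (by decide), h₂.1.1]
      exact ⟨by simp [Test.Holds, NExpr.eval, h1, e1], h2⟩
    · simp [Test.cost, NExpr.cost]
      omega
  · omega

/-- In both cases one of the directions has unconstrained carry-in, and the colouring for it can be
turned into a schedule. -/
theorem program_runs {I : Realloc m n} {k : ℝ≥0} (hm : 0 < m) (hsize : ∀ p, I.size p = k)
    (hd : (∀ w, I.dIn w = ⊤) ∨ ∀ w, I.dOut w = ⊤) :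
    Runs program (encode I) (20000 * (n * (m * (Nat.clog 2 m + 1)))) fun σ =>
      I.IsApprox 2 (output m σ) ∧
        (0 < k → (∀ w, I.dIn w = ⊤) → I.UniformOutput k (output m σ)) := by
  have hn : 0 < n := (Nat.zero_le _).trans_lt (I.src ⟨0, hm⟩).2
  have hlt : ∀ g : Fin m → Fin n, ∀ p < m, natMap g p < n := fun g p hp => by
    simp [natMap, array, hp]
  unfold program
  refine Runs.mono (Runs.seq (Runs.flat (T := 30) (Q := Dims m n) rfl (by decide) ?_).keeps ?_
    (T₂ := (40 * n + 20) + (10000 * (n * (m * (Nat.clog 2 m + 1))) + (100 * m + 70)))) ?_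
    fun _ h => h
  · constructor <;> simp [block, readDims, Prog.run, NExpr.eval, encode, array, add_assoc]
  · rintro τ₁ ⟨k₁, d₁⟩
    refine Runs.seq (chooseMode_runs (I := I) d₁ (by rw [k₁.nat _ (by decide)]; rfl)).keeps ?_
    rintro τ₂ ⟨k₂, h₂⟩
    have d₂ : Dims m n τ₂ := d₁.congr fun a ha => k₂.nat a (by revert a; decide)
    have e₂ : ∀ a ∈ [1, 2, 3, 4, 5, nKey, nCnt], τ₂.nat a = (encode I).nat a := fun a ha => by
      rw [k₂.nat a (by revert a; decide), k₁.nat a (by revert a; decide)]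
    have f₂ : ∀ a ∈ [0, 1, 2], τ₂.real a = (encode I).real a := fun a ha => by
      rw [k₂.real a (by revert a; decide), k₁.real a (by revert a; decide)]
    have hk : τ₂.real 0 0 = k := by
      rw [f₂ 0 (by decide), ← hsize ⟨0, hm⟩]
      exact array_val (fun p => (I.size p : ℝ)) ⟨0, hm⟩
    have hcnt : ∀ w < n, τ₂.nat nCnt w = 0 := fun w _ => by rw [e₂ nCnt (by decide)]; rfl
    have hkey : ∀ p < m, τ₂.nat nKey p = 0 := fun w _ => by rw [e₂ nKey (by decide)]; rfl
    rcases h₂ with ⟨hmode, hin⟩ | ⟨hmode, hin⟩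
    · have hs : Source m n (natMap I.src) (natMap I.tgt) (array fun w => flag (I.dOut w))
          (array fun w => (I.dOut w).toReal) τ₂ := by
        refine ⟨fun p _ => ?_, fun p _ => ?_, fun w _ => ?_, fun w _ => ?_, hlt _, hlt _⟩ <;>
          rw [if_pos hmode]
        · rw [e₂ 1 (by decide)]; rfl
        · rw [e₂ 2 (by decide)]; rfl
        · rw [e₂ 4 (by decide)]; rfl
        · rw [f₂ 1 (by decide)]; rfl
      refine Runs.seq (schedule_runs (J := I) hsize hin hm d₂ hs hk hcnt hkey).keeps ?_
      rintro τ₃ ⟨k₃, h₃⟩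
      rw [← k₃.nat _ (by decide)] at hmode
      refine Runs.mono (Runs.ite_true (by simpa [Test.Holds, NExpr.eval] using hmode)
        (Runs.flat (T := 1) rfl (by decide) ?_)) ?_ fun _ h => h
      · exact ⟨h₃.isApprox hsize hin, fun _ _ => h₃.uniformOutput⟩
      · simp [Test.cost, NExpr.cost]
    · have hin' : ∀ w, I.rev.dIn w = ⊤ := hd.resolve_left fun h => hin.elim fun w hw => hw (h w)
      have hs : Source m n (natMap I.rev.src) (natMap I.rev.tgt)
          (array fun w => flag (I.rev.dOut w)) (array fun w => (I.rev.dOut w).toReal) τ₂ := by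
        refine ⟨fun p _ => ?_, fun p _ => ?_, fun w _ => ?_, fun w _ => ?_, hlt _, hlt _⟩ <;>
          rw [if_neg (by omega)]
        · rw [e₂ 2 (by decide)]; rfl
        · rw [e₂ 1 (by decide)]; rfl
        · rw [e₂ 5 (by decide)]; rfl
        · rw [f₂ 2 (by decide)]; rfl
      refine Runs.seq (schedule_runs (J := I.rev) hsize hin' hm d₂ hs hk hcnt hkey).keeps ?_
      rintro τ₃ ⟨k₃, h₃⟩
      rw [← k₃.nat _ (by decide)] at hmode
      have d₃ : Dims m n τ₃ := d₂.congr fun a ha => k₃.nat a (by revert a; decide)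
      have ht : τ₃.nat 3 = array I.transit := by
        rw [k₃.nat _ (by decide), e₂ 3 (by decide)]; rfl
      refine Runs.mono (Runs.ite_false (by simp [Test.Holds, NExpr.eval, hmode])
        (reverse_runs d₃.m1 rfl ht)) ?_ fun τ₄ h₄ => ⟨?_, fun _ h => absurd h (by simpa using hin)⟩
      · simp [Test.cost, NExpr.cost]
        omega
      · have hsup : (Finset.range m).sup (fun q => τ₃.nat nKey q + array I.transit q) =
            I.rev.completion fun p => τ₃.nat nKey p := by
          refine eq_of_forall_ge_iff fun N => ?_
          rw [Realloc.completion, Finset.sup_le_iff, Finset.sup_le_iff]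
          constructor
          · intro h p _
            have := h p (Finset.mem_range.2 p.2)
            rwa [array_val] at this
          · intro h p hp
            lift p to Fin m using Finset.mem_range.1 hp
            rw [array_val]
            exact h p (Finset.mem_univ _)
        refine (h₃.isApprox hsize hin').of_rev fun p => ?_
        have h5 := I.rev.transit_lt_completion (fun p => τ₃.nat nKey p) p
        have h6 := h₄ p p.2
        rw [hsup, array_val] at h6
        rw [output, h6]
        change τ₃.nat nKey p + I.transit p ≤ _ at h5
        omega
  · have e1 : m ≤ n * m := Nat.le_mul_of_pos_left m hn
    have e2 : n ≤ n * m := Nat.le_mul_of_pos_right n hm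
    have e3 : 0 < n * m := Nat.mul_pos hn hm
    have e4 : n * (m * (Nat.clog 2 m + 1)) = n * m * Nat.clog 2 m + n * m := by ring
    rw [e4]
    have e5 : 0 ≤ n * m * Nat.clog 2 m := Nat.zero_le _
    omega

theorem clog_add_one_le (m : ℕ) :
    ((Nat.clog 2 m + 1 : ℕ) : ℝ) ≤ 3 / Real.log 2 * Real.log (max (m : ℝ) 2) := by
  have h2 : (0 : ℝ) < Real.log 2 := Real.log_pos (by norm_num)
  have h3 : Real.log 2 ≤ Real.log (max (m : ℝ) 2) :=
    Real.log_le_log (by norm_num) (le_max_right _ _)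
  have h1 : (Nat.clog 2 m : ℝ) < Real.log (max (m : ℝ) 2) / Real.log 2 + 1 := by
    refine lt_of_le_of_lt ?_ (Nat.ceil_lt_add_one (div_nonneg (h2.le.trans h3) h2.le))
    have : ((max m 2 : ℕ) : ℝ) = max (m : ℝ) 2 := by push_cast; rfl
    rw [← this, ← Real.logb, ← Nat.cast_ofNat (R := ℝ), Real.natCeil_logb_natCast]
    exact_mod_cast Nat.clog_mono_right 2 (le_max_left m 2)
  have h4 : 1 ≤ Real.log (max (m : ℝ) 2) / Real.log 2 := (one_le_div h2).2 h3
  rw [div_mul_eq_mul_div, mul_div_assoc]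
  push_cast
  linarith

end RAM

end

theorem theorem2 :
    -- every output of algorithm Uniform is 2-approximate if carry-in is unconstrained
    (∀ (m n : ℕ) (I : Realloc m n) (k : ℝ≥0), 0 < k → (∀ p, I.size p = k) → (∀ w, I.dIn w = ⊤) →
      ∀ φ : Fin m → ℕ, I.UniformOutput k φ → I.IsApprox 2 φ) ∧
    -- the problem is 2-approximable in time `O(m n log m)`, by Uniform in the first of the two cases
    ∃ (c : RAM.Prog) (C : ℝ), ∀ (m n : ℕ) (I : Realloc m n) (k : ℝ≥0), 0 < m →
      (∀ p, I.size p = k) → ((∀ w, I.dIn w = ⊤) ∨ (∀ w, I.dOut w = ⊤)) →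
      ∃ (σ : RAM.Store) (t : ℕ), RAM.Exec c (RAM.encode I) σ t ∧
        (t : ℝ) ≤ C * (m * n * Real.log (max m 2)) ∧
        I.IsApprox 2 (RAM.output m σ) ∧
        (0 < k → (∀ w, I.dIn w = ⊤) → I.UniformOutput k (RAM.output m σ)) := by
  refine ⟨fun m n I k hk hsize hin φ hφ => I.isApprox_of_uniformOutput hk hsize hin hφ,
    RAM.program, 20000 * (3 / Real.log 2), fun m n I k hm hsize hd => ?_⟩
  obtain ⟨σ, t, h, ht, h₁, h₂⟩ := RAM.program_runs hm hsize hd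
  refine ⟨σ, t, h, ?_, h₁, h₂⟩
  calc (t : ℝ) ≤ ((20000 * (n * (m * (Nat.clog 2 m + 1))) : ℕ) : ℝ) := by exact_mod_cast ht
    _ = 20000 * (m * n) * ((Nat.clog 2 m + 1 : ℕ) : ℝ) := by push_cast; ring
    _ ≤ 20000 * (m * n) * (3 / Real.log 2 * Real.log (max (m : ℝ) 2)) :=
      mul_le_mul_of_nonneg_left (RAM.clog_add_one_le m) (by positivity)
    _ = 20000 * (3 / Real.log 2) * (m * n * Real.log (max (m : ℝ) 2)) := by ring
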